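/- Work in real quantum theory: systems are finite-dimensional real Hilbert spaces, processes are linear maps, the dagger is the adjoint. For a finite abelian group $K$ (written additively) let $\mathbb R[K]$ have orthonormal basis $(|k\rangle)_{k\in K}$; let $Z_K$ be the point structure (copy $|k\rangle\mapsto|k\rangle\otimes|k\rangle$, delete $|k\rangle\mapsto 1$) and $X_K$ the group structure (multiplication $|a\rangle\otimes|b\rangle\mapsto|a+b\rangle$, unit $|0\rangle$), completed to Frobenius structures by adjoints. A classical state of such a structure is a state that it copies, deletes and transposes; a structure has enough classical states if parallel linear maps agreeing on all of them are equal. A function $f:G\to\mathbb Z_2^N$ hides $H\le G$ if $f(x)=f(y)\iff x-y\in H$. 1. *Requirements.* Let $G$ be a finite abelian group, $H\le G$, $N\ge 0$. (a) For each $K\in\{G,H,G/H,\mathbb Z_2^N\}$, $(Z_K,X_K)$ is a strongly complementary pair of balanced-symmetric quasi-special dagger-Frobenius algebras, both commutative, with $Z_K$ special and $X_K$ of normalisation $\sqrt{|K|}$, and $K$ is isomorphic to the group of $Z_K$-classical states under the multiplication of $X_K$. (b) There is an absorbing scalar $0$. (c) $Z_H$ and $Z_{G/H}$ have enough classical states.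 Moreover, the classical states of $X_G$, and those of $Z_{\mathbb Z_2^N}$, are orthogonal, and $Z_{\mathbb Z_2^N}$ has enough of them; hence the full measurement requirement (d) — $X_G$ and $Z_{\mathbb Z_2^N}$ have enough classical states, and these are orthogonal — holds if and only if $2g=0$ for all $g\in G$, i.e. $G\cong\mathbb Z_2^M$. For every $f:G\to\mathbb Z_2^N$ hiding $H$, the linear extension of $f$ is a classical map and satisfies the coherent factorisation promise: it equals $s\circ q$ with $s$ a classical isometry and $q:\mathbb R[G]\to\mathbb R[G/H]$ a homomorphism of strongly complementary pairs, with an isometric section and with kernel described coherently by a classical isometric homomorphism $i_H:\mathbb R[H]\to\mathbb R[G]$. 2. *Characters.* The $X_G$-classical states are exactly the states $|\chi\rangle=\sum_g\chi(g)|g\rangle$ for real-valued multiplicative characters $\chi$ of $G$. Every subgroup of $G$ is determined by the set of real characters that are trivial on it if and only if $2g=0$ for all $g\in G$. 3. *Quantum subroutine.* For every finite abelian $G$ and $f:G\to\mathbb Z_2^N$, the oracle $U_f$ built from copying on $G$, $f$, and the group multiplication of $\mathbb Z_2^N$ is unitary and maps $|g\rangle\otimes|t\rangle$ to $|g\rangle\otimes|f(g)\oplus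 t\rangle$. If $f$ hides $H$, then preparing $|G|^{-1/2}\sum_g|g\rangle\otimes|0\rangle$, applying $U_f$, and measuring, the joint outcome $(b,\chi)$, with $\chi$ a real character, has probability $|H|^2/|G|^2$ if $b\in\operatorname{im}f$ and $\chi$ is trivial on $H$, and probability $0$ otherwise. 4. *The case $G=\mathbb Z_2^M$.* The $X_G$-classical states are the states $\sum_g(-1)^{p\cdot g}|g\rangle$ for a unique $p\in\mathbb Z_2^M$, and the outcome probabilities in 3 sum to $1$. There is a deterministic classical algorithm, running in time polynomial in $M+k$, which for all $M,k,N$ and every $f:\mathbb Z_2^M\to\mathbb Z_2^N$ hiding $H$ outputs, from the characters $p$ obtained in $M+k$ independent runs of the subroutine, generators of $H$ with probability at least $1-2^{-k}$. 5. *Simon's problem.* There is a polynomial-time real quantum algorithm (a polynomial-time uniform family of quantum circuits over the real gates NOT, Hadamard, CNOT, Toffoli and the oracle gate, started in $|0\dots0\rangle$ and measured in the computational basis, with polynomial-time classical post-processing) which, for every $n$ and every $f:\mathbb Z_2^n\to\mathbb Z_2^n$ for which there is $z\neq 0$ with $f(x)=f(y)\iff x=y\text{ or }x=y\oplus z$,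 outputs $z$ with probability at least $2/3$ on input $1^n$ with oracle $f$. 6. *Separation.* Let $\mathrm{BQP}_{\mathbb R}^O$ be the class of languages decided with error at most $1/3$ by polynomial-time real quantum algorithms (as in 5) with oracle $O$, and $\mathrm{BPP}^O$ the class of those decided with error at most $1/3$ by polynomial-time randomised classical algorithms with oracle $O$. There is a family $O=(f_n:\mathbb Z_2^n\to\mathbb Z_2^n)_{n\ge 0}$, satisfying the promise of Simon's problem for every $n\ge1$, such that $\mathrm{BQP}_{\mathbb R}^{O}\not\subseteq\mathrm{BPP}^{O}$. -/

import Mathlib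

universe u v

open scoped TensorProduct

namespace RealQT

noncomputable section

/-! ## Frobenius structures on finite-dimensional real Hilbert spaces

Systems are finite-dimensional real inner product spaces, processes are linear maps, the dagger is
`LinearMap.adjoint`, parallel composition is `⊗[ℝ]`, and the trivial system is `ℝ`. -/

/-- The data of a dagger-Frobenius algebra: a comultiplication and a counit.  The multiplication and
the unit are their adjoints. -/
structure Observable (E : Type u) [NormedAddCommGroup E] [InnerProductSpace ℝ E]
    [FiniteDimensional ℝ E] where
  comul : E →ₗ[ℝ] E ⊗[ℝ] E
  counit : E →ₗ[ℝ] ℝ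

section Laws

variable {E : Type u} [NormedAddCommGroup E] [InnerProductSpace ℝ E] [FiniteDimensional ℝ E]
variable {F : Type v} [NormedAddCommGroup F] [InnerProductSpace ℝ F] [FiniteDimensional ℝ F]

/-- `U` is unitary (orthogonal, since the scalars are real). -/
def IsUnitary (U : E →ₗ[ℝ] F) : Prop :=
  LinearMap.adjoint U ∘ₗ U = LinearMap.id ∧ U ∘ₗ LinearMap.adjoint U = LinearMap.id

/-- `V` is an isometry. -/
def IsIsometric (V : E →ₗ[ℝ] F) : Prop := LinearMap.adjoint V ∘ₗ V = LinearMap.id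

namespace Observable

/-- Multiplication, the adjoint of the comultiplication. -/
def mul (A : Observable E) : E ⊗[ℝ] E →ₗ[ℝ] E := LinearMap.adjoint A.comul

/-- Unit, the adjoint of the counit. -/
def unit (A : Observable E) : ℝ →ₗ[ℝ] E := LinearMap.adjoint A.counit

/-- The cap `E ⊗ E → ℝ`. -/
def cap (A : Observable E) : E ⊗[ℝ] E →ₗ[ℝ] ℝ := A.counit ∘ₗ A.mul

/-- The cup `ℝ → E ⊗ E`. -/
def cup (A : Observable E) : ℝ →ₗ[ℝ] E ⊗[ℝ] E := A.comul ∘ₗ A.unit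

/-- Coassociativity, the counit laws, and the Frobenius law; associativity and the unit laws of
`mul` and `unit` are their adjoints. -/
structure IsDaggerFrobenius (A : Observable E) : Prop where
  coassoc : (TensorProduct.assoc ℝ E E E).toLinearMap ∘ₗ A.comul.rTensor E ∘ₗ A.comul
    = A.comul.lTensor E ∘ₗ A.comul
  counit_left : (TensorProduct.lid ℝ E).toLinearMap ∘ₗ A.counit.rTensor E ∘ₗ A.comul
    = LinearMap.id
  counit_right : (TensorProduct.rid ℝ E).toLinearMap ∘ₗ A.counit.lTensor E ∘ₗ A.comul
    = LinearMap.id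
  frobenius_left : A.mul.rTensor E ∘ₗ (TensorProduct.assoc ℝ E E E).symm.toLinearMap ∘ₗ
    A.comul.lTensor E = A.comul ∘ₗ A.mul
  frobenius_right : A.mul.lTensor E ∘ₗ (TensorProduct.assoc ℝ E E E).toLinearMap ∘ₗ
    A.comul.rTensor E = A.comul ∘ₗ A.mul

/-- Commutativity. -/
def IsCommutative (A : Observable E) : Prop :=
  A.mul ∘ₗ (TensorProduct.comm ℝ E E).toLinearMap = A.mul

/-- Speciality. -/
def IsSpecial (A : Observable E) : Prop := A.mul ∘ₗ A.comul = LinearMap.id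

/-- Quasi-speciality with normalisation scalar `ξ`. -/
def IsQuasiSpecial (A : Observable E) (ξ : ℝ) : Prop :=
  ξ ≠ 0 ∧ A.mul ∘ₗ A.comul = (ξ * ξ) • LinearMap.id

/-- Balanced symmetry. -/
def IsBalancedSymmetric (A : Observable E) : Prop :=
  A.cap ∘ₗ (TensorProduct.comm ℝ E E).toLinearMap = A.cap

/-- Balanced-symmetric quasi-special dagger-Frobenius algebras. -/
structure IsQSFA (A : Observable E) : Prop where
  frobenius : A.IsDaggerFrobenius
  quasiSpecial : ∃ ξ : ℝ, A.IsQuasiSpecial ξ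
  balanced : A.IsBalancedSymmetric

/-- A state is classical when it is copied, deleted and transposed. -/
structure IsClassicalState (A : Observable E) (ψ : E) : Prop where
  copied : A.comul ψ = ψ ⊗ₜ[ℝ] ψ
  deleted : A.counit ψ = 1
  transposed : ∀ x : E, inner ℝ ψ x = A.cap (ψ ⊗ₜ[ℝ] x)

/-- Two parallel processes agreeing on all classical states coincide. -/
def HasEnoughClassicalStates (A : Observable E) : Prop :=
  ∀ (K : Type u) [NormedAddCommGroup K] [InnerProductSpace ℝ K] [FiniteDimensional ℝ K]
    (S T : E →ₗ[ℝ] K), (∀ ψ, A.IsClassicalState ψ → S ψ = T ψ) → S = T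

/-- Distinct classical states are orthogonal. -/
def HasOrthogonalClassicalStates (A : Observable E) : Prop :=
  ∀ ψ φ, A.IsClassicalState ψ → A.IsClassicalState φ → ψ ≠ φ → inner ℝ ψ φ = 0

/-- `(cap_X ⊗ id) ∘ (id ⊗ cup_Z)`. -/
def antipode (Z X : Observable E) : E →ₗ[ℝ] E :=
  (TensorProduct.lid ℝ E).toLinearMap ∘ₗ X.cap.rTensor E ∘ₗ
    (TensorProduct.assoc ℝ E E E).symm.toLinearMap ∘ₗ Z.cup.lTensor E ∘ₗ
    (TensorProduct.rid ℝ E).symm.toLinearMap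

/-- Complementary pairs: the Hopf law, with a unitary self-adjoint antipode. -/
structure IsComplementary (Z X : Observable E) : Prop where
  left : Z.IsQSFA
  right : X.IsQSFA
  antipode_unitary : IsUnitary (antipode Z X)
  antipode_selfAdjoint : LinearMap.adjoint (antipode Z X) = antipode Z X
  hopf_left : X.mul ∘ₗ (antipode Z X).rTensor E ∘ₗ Z.comul = X.unit ∘ₗ Z.counit
  hopf_right : X.mul ∘ₗ (antipode Z X).lTensor E ∘ₗ Z.comul = X.unit ∘ₗ Z.counit

/-- Strongly complementary pairs: `X.mul` and `X.unit` are copied and deleted by `Z`. -/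
structure IsStronglyComplementary (Z X : Observable E) : Prop where
  complementary : IsComplementary Z X
  mul_copied : Z.comul ∘ₗ X.mul = TensorProduct.map X.mul X.mul ∘ₗ
    (TensorProduct.tensorTensorTensorComm ℝ E E E E).toLinearMap ∘ₗ
    TensorProduct.map Z.comul Z.comul
  mul_deleted : Z.counit ∘ₗ X.mul =
    (TensorProduct.lid ℝ ℝ).toLinearMap ∘ₗ TensorProduct.map Z.counit Z.counit
  unit_copied : Z.comul (X.unit 1) = X.unit 1 ⊗ₜ[ℝ] X.unit 1
  unit_deleted : Z.counit (X.unit 1) = 1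

/-- `K` is isomorphic to the group of `Z`-classical states under the multiplication of `X`. -/
def Encodes (Z X : Observable E) (K : Type v) [AddCommGroup K] : Prop :=
  ∃ e : K ≃ {ψ : E // Z.IsClassicalState ψ},
    (∀ a b, X.mul ((e a : E) ⊗ₜ[ℝ] (e b : E)) = e (a + b)) ∧ X.unit 1 = e 0

/-- `T` is an `A`-to-`B` classical map: it is copied, deleted and transposed. -/
structure IsClassicalMap (A : Observable E) (B : Observable F) (T : E →ₗ[ℝ] F) : Prop where
  copied : B.comul ∘ₗ T = TensorProduct.map T T ∘ₗ A.comul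
  deleted : B.counit ∘ₗ T = A.counit
  transposed : LinearMap.adjoint T =
    (TensorProduct.rid ℝ E).toLinearMap ∘ₗ B.cap.lTensor E ∘ₗ (T.rTensor F).lTensor E ∘ₗ
      (TensorProduct.assoc ℝ E E F).toLinearMap ∘ₗ A.cup.rTensor F ∘ₗ
      (TensorProduct.lid ℝ F).symm.toLinearMap

/-- `T` is a `(Z, X)`-to-`(Z', X')` homomorphism. -/
structure IsPairHom (Z X : Observable E) (Z' X' : Observable F) (T : E →ₗ[ℝ] F) : Prop where
  classical : IsClassicalMap Z Z' T
  map_mul : T ∘ₗ X.mul = X'.mul ∘ₗ TensorProduct.map T T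
  map_unit : T ∘ₗ X.unit = X'.unit
  map_antipode : T ∘ₗ antipode Z X = antipode Z' X' ∘ₗ T

end Observable

end Laws

/-! ## The real group algebra -/

section GroupAlgebra

/-- The real Hilbert space `ℝ[K]` with orthonormal basis `K`. -/
abbrev Sp (K : Type u) [Fintype K] : Type u := EuclideanSpace ℝ K

/-- The basis vector `|k⟩`. -/
def ket {K : Type u} [Fintype K] (k : K) : Sp K := EuclideanSpace.basisFun K ℝ k

/-- Linear maps out of `ℝ[K]` are given by their values on basis vectors. -/
def linExt {K : Type u} [Fintype K] {E : Type v} [AddCommGroup E] [Module ℝ E] (f : K → E) :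
    Sp K →ₗ[ℝ] E :=
  (EuclideanSpace.basisFun K ℝ).toBasis.constr ℝ f

/-- The coherent version `|a⟩ ↦ |f a⟩` of a function. -/
def coherent {K : Type u} [Fintype K] {L : Type v} [Fintype L] (f : K → L) : Sp K →ₗ[ℝ] Sp L :=
  linExt fun k => ket (f k)

/-- The point structure: `|k⟩ ↦ |k⟩ ⊗ |k⟩` and `|k⟩ ↦ 1`. -/
def point (K : Type u) [Fintype K] : Observable (Sp K) where
  comul := linExt fun k => ket k ⊗ₜ[ℝ] ket k
  counit := linExt fun _ => 1

open Classical in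
/-- The group structure: `|k⟩ ↦ ∑_{a + b = k} |a⟩ ⊗ |b⟩` and `|k⟩ ↦ [k = 0]`; its multiplication and
unit are `|a⟩ ⊗ |b⟩ ↦ |a + b⟩` and `|0⟩`. -/
def grp (K : Type u) [Fintype K] [AddCommGroup K] : Observable (Sp K) where
  comul := linExt fun k => ∑ a : K, ket a ⊗ₜ[ℝ] ket (k - a)
  counit := linExt fun k => if k = 0 then 1 else 0

/-- The state `∑_g χ(g) |g⟩` of a real-valued multiplicative character. -/
def charState {G : Type u} [Fintype G] [AddCommGroup G] (χ : AddChar G ℝ) : Sp G :=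
  WithLp.toLp 2 fun g => χ g

/-- `χ` annihilates `H`. -/
def Annihilates {G : Type u} [AddCommGroup G] (χ : AddChar G ℝ) (H : AddSubgroup G) : Prop :=
  ∀ h ∈ H, χ h = 1

/-- `f` is a subgroup hiding function with hidden subgroup `H`. -/
def Hides {G : Type u} [AddCommGroup G] {L : Type v} (f : G → L) (H : AddSubgroup G) : Prop :=
  ∀ x y, f x = f y ↔ x - y ∈ H

/-- Bit strings of length `n`, under bitwise XOR. -/
abbrev Bits (n : ℕ) : Type := Fin n → ZMod 2

end GroupAlgebra

/-! ## The requirements of the quantum subroutine -/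

section Requirements

/-- `K` is encoded by a strongly complementary pair, with special commutative point structure and
commutative group structure of normalisation `√|K|`. -/
structure HasEncoding (K : Type u) [Fintype K] [AddCommGroup K] : Prop where
  pair : Observable.IsStronglyComplementary (point K) (grp K)
  point_special : (point K).IsSpecial
  point_comm : (point K).IsCommutative
  grp_quasiSpecial : (grp K).IsQuasiSpecial √(Fintype.card K)
  grp_comm : (grp K).IsCommutative
  encodes : Observable.Encodes (point K) (grp K) K

/-- (a) the four relevant groups are encoded by strongly complementary pairs. -/
structure RequirementA (G : Type u) [AddCommGroup G] [Fintype G] (H : AddSubgroup G) [Fintype H]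
    [Fintype (G ⧸ H)] (N : ℕ) : Prop where
  main : HasEncoding G
  hidden : HasEncoding H
  quotient : HasEncoding (G ⧸ H)
  labels : HasEncoding (Bits N)

/-- (b) there is an absorbing scalar. -/
def RequirementB : Prop := ∃ z : ℝ →ₗ[ℝ] ℝ, ∀ s : ℝ →ₗ[ℝ] ℝ, s ∘ₗ z = z ∧ z ∘ₗ s = z

/-- (c) the point structures of the subgroup and of the quotient have enough classical states. -/
structure RequirementC (G : Type u) [AddCommGroup G] (H : AddSubgroup G) [Fintype H]
    [Fintype (G ⧸ H)] : Prop where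
  hidden : (point H).HasEnoughClassicalStates
  quotient : (point (G ⧸ H)).HasEnoughClassicalStates

/-- (d) the two measured observables have enough classical states, which are orthogonal. -/
structure RequirementD (G : Type u) [AddCommGroup G] [Fintype G] (N : ℕ) : Prop where
  main_enough : (grp G).HasEnoughClassicalStates
  main_orthogonal : (grp G).HasOrthogonalClassicalStates
  labels_enough : (point (Bits N)).HasEnoughClassicalStates
  labels_orthogonal : (point (Bits N)).HasOrthogonalClassicalStates

/-- The coherent factorisation promise: `f = s ∘ q` with `s` a classical isometry and `q` a
homomorphism of strongly complementary pairs that has an isometric section `r` and kernel the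
image of the classical isometric homomorphism `i`. -/
def CoherentPromise {G : Type u} [AddCommGroup G] [Fintype G] (H : AddSubgroup G) [Fintype H]
    [Fintype (G ⧸ H)] {N : ℕ} (f : G → Bits N) : Prop :=
  Observable.IsClassicalMap (point G) (point (Bits N)) (coherent f) ∧
  ∃ (q : Sp G →ₗ[ℝ] Sp (G ⧸ H)) (s : Sp (G ⧸ H) →ₗ[ℝ] Sp (Bits N))
    (r : Sp (G ⧸ H) →ₗ[ℝ] Sp G) (i : Sp H →ₗ[ℝ] Sp G),
    coherent f = s ∘ₗ q ∧
    Observable.IsClassicalMap (point (G ⧸ H)) (point (Bits N)) s ∧ IsIsometric s ∧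
    Observable.IsPairHom (point G) (grp G) (point (G ⧸ H)) (grp (G ⧸ H)) q ∧
    IsIsometric r ∧ q ∘ₗ r = LinearMap.id ∧
    Observable.IsPairHom (point H) (grp H) (point G) (grp G) i ∧ IsIsometric i ∧
    q ∘ₗ i = (grp (G ⧸ H)).unit ∘ₗ (point H).counit ∧
    LinearMap.adjoint q ∘ₗ (grp (G ⧸ H)).unit = i ∘ₗ (point H).unit

end Requirements

/-! ## The quantum subroutine -/

section Subroutine

variable {G : Type u} [AddCommGroup G] [Fintype G] {N : ℕ}

/-- The oracle `(id ⊗ mul) ∘ (id ⊗ f ⊗ id) ∘ (copy ⊗ id)`. -/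
def oracle (f : G → Bits N) : Sp G ⊗[ℝ] Sp (Bits N) →ₗ[ℝ] Sp G ⊗[ℝ] Sp (Bits N) :=
  (grp (Bits N)).mul.lTensor (Sp G) ∘ₗ
    (TensorProduct.assoc ℝ (Sp G) (Sp (Bits N)) (Sp (Bits N))).toLinearMap ∘ₗ
    ((coherent f).lTensor (Sp G)).rTensor (Sp (Bits N)) ∘ₗ
    (point G).comul.rTensor (Sp (Bits N))

/-- The scalar of the outcome `(b, ψ)`: prepare `∑_g |g⟩ ⊗ |0⟩`, apply the oracle, and test against
`ψ ⊗ |b⟩`, where the prepared state and the `grp G`-classical state `ψ` are both normalised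
by `1/√|G|`. -/
def subroutineScalar (f : G → Bits N) (b : Bits N) (ψ : Sp G) : ℝ :=
  (Fintype.card G : ℝ)⁻¹ *
    inner ℝ (ψ ⊗ₜ[ℝ] ket b) (oracle f ((point G).unit 1 ⊗ₜ[ℝ] (grp (Bits N)).unit 1))

/-- The probability of the joint outcome `(b, ψ)`. -/
def subroutineProb (f : G → Bits N) (b : Bits N) (ψ : Sp G) : ℝ := subroutineScalar f b ψ ^ 2

/-- For `p ∈ ℤ₂^M`, the state `∑_g (-1)^(p · g) |g⟩`. -/
def bitCharState {M : ℕ} (p : Bits M) : Sp (Bits M) :=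
  WithLp.toLp 2 fun g => if ∑ i, p i * g i = 0 then 1 else -1

end Subroutine

end

/-! ## Classical computation

Structured programs on finitely many stacks of bits (each stack is a work tape), with an oracle
`O` mapping strings to strings. Every elementary instruction takes one step; an oracle query also
takes the time to write the query and to read the answer. -/

/-- The classical programs. Registers, numbered by `ℕ`, are stacks of bits. -/
inductive Prog : Type
  | skip : Prog
  | push (r : ℕ) (b : Bool) : Prog
  | pop (r : ℕ) : Prog
  /-- Replace register `s` by the oracle's answer to the contents of register `r`. -/
  | query (r s : ℕ) : Prog
  | seq (p q : Prog) : Prog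
  /-- Continue with `p`, `p₀` or `p₁` if register `r` is empty, or has top bit `false`, `true`. -/
  | branch (r : ℕ) (p p₀ p₁ : Prog) : Prog
  /-- While register `r` is nonempty, do `p`. -/
  | loop (r : ℕ) (p : Prog) : Prog

/-- `Run O p σ t τ`: with oracle `O`, the program `p` started in `σ` stops in `τ` after exactly
`t` steps. -/
inductive Run (O : List Bool → List Bool) :
    Prog → (ℕ → List Bool) → ℕ → (ℕ → List Bool) → Prop
  | skip (σ) : Run O .skip σ 1 σ
  | push (σ) (r : ℕ) (b : Bool) : Run O (.push r b) σ 1 (Function.update σ r (b :: σ r))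
  | pop (σ) (r : ℕ) : Run O (.pop r) σ 1 (Function.update σ r (σ r).tail)
  | query (σ) (r s : ℕ) : Run O (.query r s) σ (1 + (σ r).length + (O (σ r)).length)
      (Function.update σ s (O (σ r)))
  | seq {σ τ υ : ℕ → List Bool} {p q : Prog} {t₁ t₂ : ℕ} :
      Run O p σ t₁ τ → Run O q τ t₂ υ → Run O (.seq p q) σ (t₁ + t₂) υ
  | branchEmpty {σ τ : ℕ → List Bool} {r : ℕ} {p p₀ p₁ : Prog} {t : ℕ} :
      σ r = [] → Run O p σ t τ → Run O (.branch r p p₀ p₁) σ (1 + t) τ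
  | branchFalse {σ τ : ℕ → List Bool} {r : ℕ} {p p₀ p₁ : Prog} {l : List Bool} {t : ℕ} :
      σ r = false :: l → Run O p₀ σ t τ → Run O (.branch r p p₀ p₁) σ (1 + t) τ
  | branchTrue {σ τ : ℕ → List Bool} {r : ℕ} {p p₀ p₁ : Prog} {l : List Bool} {t : ℕ} :
      σ r = true :: l → Run O p₁ σ t τ → Run O (.branch r p p₀ p₁) σ (1 + t) τ
  | loopDone {σ : ℕ → List Bool} {r : ℕ} {p : Prog} : σ r = [] → Run O (.loop r p) σ 1 σ
  | loopStep {σ τ υ : ℕ → List Bool} {r : ℕ} {p : Prog} {t₁ t₂ : ℕ} :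
      σ r ≠ [] → Run O p σ t₁ τ → Run O (.loop r p) τ t₂ υ →
      Run O (.loop r p) σ (1 + t₁ + t₂) υ

/-- Inputs `x`, `y` in registers `0`, `1`; all other registers empty. -/
def inputStore (x y : List Bool) : ℕ → List Bool
  | 0 => x
  | 1 => y
  | _ => []

/-- On inputs `x`, `y`, the program stops after at most `T` steps with `out` in register `0`. -/
def Computes (O : List Bool → List Bool) (p : Prog) (x y out : List Bool) (T : ℕ) : Prop :=
  ∃ (σ : ℕ → List Bool) (t : ℕ), Run O p (inputStore x y) t σ ∧ t ≤ T ∧ σ 0 = out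

/-- The trivial oracle, for computations that use none. -/
def noOracle : List Bool → List Bool := fun _ => []

noncomputable section

/-- `L ∈ BPP^O`: a polynomial-time program, given the input and polynomially many uniform random
bits, decides `L` with error probability at most `1/3`. -/
def BPP (O : List Bool → List Bool) : Set (Set (List Bool)) :=
  {L | ∃ (p : Prog) (rand time : Polynomial ℕ), ∀ x : List Bool,
    (∀ ρ : Fin (rand.eval x.length) → Bool,
      ∃ out, Computes O p x (List.ofFn ρ) out (time.eval x.length)) ∧
    (x ∈ L → 2 / 3 ≤ (Nat.card {ρ : Fin (rand.eval x.length) → Bool //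
      Computes O p x (List.ofFn ρ) [true] (time.eval x.length)} : ℝ) / 2 ^ rand.eval x.length) ∧
    (x ∉ L → (Nat.card {ρ : Fin (rand.eval x.length) → Bool //
      Computes O p x (List.ofFn ρ) [true] (time.eval x.length)} : ℝ) / 2 ^ rand.eval x.length
        ≤ 1 / 3)}

/-! ## Real quantum circuits -/

/-- Gates on `w` wires: NOT, Hadamard, CNOT, Toffoli, and the oracle gate. -/
inductive Gate (w : ℕ) : Type
  | not (i : Fin w) : Gate w
  | had (i : Fin w) : Gate w
  | cnot (c i : Fin w) (h : c ≠ i) : Gate w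
  | toffoli (c d i : Fin w) (h : c ≠ d ∧ c ≠ i ∧ d ≠ i) : Gate w
  | oracle (ins outs : List (Fin w)) (h : (ins ++ outs).Nodup) : Gate w

/-- Action on computational basis states of the gates that permute them. The oracle gate
is `|x⟩ ⊗ |t⟩ ↦ |x⟩ ⊗ |O(x) ⊕ t⟩`, on the wires `ins` and `outs` (missing bits of `O(x)` count as
`0`). -/
def Gate.act {w : ℕ} (O : List Bool → List Bool) (x : Fin w → Bool) : Gate w → (Fin w → Bool)
  | .not i => Function.update x i (!x i)
  | .had _ => x
  | .cnot c i _ => Function.update x i (x i ^^ x c)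
  | .toffoli c d i _ => Function.update x i (x i ^^ (x c && x d))
  | .oracle ins outs _ => fun j =>
      if j ∈ outs then x j ^^ (O (ins.map x)).getD (outs.idxOf j) false else x j

/-- The real orthogonal matrix of a gate on `(ℝ²)^{⊗ w}`. -/
def Gate.matrix {w : ℕ} (O : List Bool → List Bool) :
    Gate w → Matrix (Fin w → Bool) (Fin w → Bool) ℝ
  | .had i => Matrix.of fun y x =>
      if ∀ j, j ≠ i → y j = x j then (if x i && y i then -1 else 1) / √2 else 0
  | g => Matrix.of fun y x => if y = g.act O x then 1 else 0

/-- A real quantum circuit; the head of the list of gates is applied first. -/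
structure Circuit : Type where
  width : ℕ
  gates : List (Gate width)

/-- The amplitudes of the final state, starting from `|0…0⟩`. -/
def Circuit.final (C : Circuit) (O : List Bool → List Bool) : (Fin C.width → Bool) → ℝ :=
  C.gates.foldl (fun ψ g => (g.matrix O).mulVec ψ) (Pi.single (fun _ => false) 1)

/-- The probability of reading `y` when all wires are measured in the computational basis. -/
def Circuit.prob (C : Circuit) (O : List Bool → List Bool) (y : Fin C.width → Bool) : ℝ :=
  C.final O y ^ 2

/-- Unary code of a number. -/
def unary (n : ℕ) : List Bool := List.replicate n true ++ [false]

/-- Code of a list of wires. -/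
def wiresCode {w : ℕ} (l : List (Fin w)) : List Bool :=
  l.flatMap (fun i => true :: unary i) ++ [false]

/-- Code of a gate: a three-bit tag and the wires. -/
def Gate.code {w : ℕ} : Gate w → List Bool
  | .not i => [false, false, false] ++ unary i
  | .had i => [false, false, true] ++ unary i
  | .cnot c i _ => [false, true, false] ++ unary c ++ unary i
  | .toffoli c d i _ => [false, true, true] ++ unary c ++ unary d ++ unary i
  | .oracle ins outs _ => [true, false, false] ++ wiresCode ins ++ wiresCode outs

/-- Code of a circuit. -/
def Circuit.code (C : Circuit) : List Bool := unary C.width ++ C.gates.flatMap Gate.code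

/-! ## Efficient real quantum algorithms -/

/-- A polynomial-time real quantum algorithm: a polynomial-time uniform family of real quantum
circuits with oracle gates, one circuit for each input, and polynomial-time classical
post-processing of the input and of the measured bits. -/
structure RealQuantumAlgorithm : Type where
  circuit : List Bool → Circuit
  pre : Prog
  post : Prog
  time : Polynomial ℕ
  uniform : ∀ x, Computes noOracle pre x [] (circuit x).code (time.eval x.length)
  post_halts : ∀ (x : List Bool) (y : Fin (circuit x).width → Bool),
    ∃ out, Computes noOracle post x (List.ofFn y) out (time.eval x.length)

open Classical in
/-- The probability that the algorithm outputs `out` on input `x`, with oracle `O`. -/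
def RealQuantumAlgorithm.outputProb (A : RealQuantumAlgorithm) (O : List Bool → List Bool)
    (x out : List Bool) : ℝ :=
  ∑ y : Fin (A.circuit x).width → Bool,
    if Computes noOracle A.post x (List.ofFn y) out (A.time.eval x.length)
    then (A.circuit x).prob O y else 0

/-- `L ∈ BQP_ℝ^O`: a polynomial-time real quantum algorithm with access to `O` decides `L` with
error probability at most `1/3`. -/
def BQPReal (O : List Bool → List Bool) : Set (Set (List Bool)) :=
  {L | ∃ A : RealQuantumAlgorithm, ∀ x : List Bool,
    (x ∈ L → 2 / 3 ≤ A.outputProb O x [true]) ∧ (x ∉ L → A.outputProb O x [true] ≤ 1 / 3)}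

/-! ## Simon's problem and the classical post-processing -/

/-- Elements of `ℤ₂^n` as strings for the machines. -/
def toStr {n : ℕ} (x : Bits n) : List Bool := List.ofFn fun i => decide (x i = 1)

/-- The oracle of a family of functions `f n : ℤ₂^n → ℤ₂^n`. -/
def oracleOf (f : ∀ n, Bits n → Bits n) : List Bool → List Bool := fun l =>
  toStr (f l.length fun i => if l.get i then 1 else 0)

/-- The promise of Simon's problem, with solution `z`. -/
def IsSimon {n : ℕ} (f : Bits n → Bits n) (z : Bits n) : Prop :=
  z ≠ 0 ∧ ∀ x y, f x = f y ↔ x = y ∨ x = y + z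

/-- The string lists generators of `H`. -/
def ListsGenerators {M : ℕ} (out : List Bool) (H : AddSubgroup (Bits M)) : Prop :=
  ∃ l : List (Bits M), out = l.flatMap toStr ∧ AddSubgroup.closure {g | g ∈ l} = H

/-- The concatenation of a tuple of samples. -/
def samplesStr {M m : ℕ} (p : Fin m → Bits M) : List Bool := (List.ofFn p).flatMap toStr

open Classical in
/-- The probability that `post`, applied to `M` and to the character outcomes of `m` independent
runs of the quantum subroutine, outputs generators of `H` within time `T`. -/
def recoveryProb {M N : ℕ} (f : Bits M → Bits N) (H : AddSubgroup (Bits M)) (post : Prog)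
    (m T : ℕ) : ℝ :=
  ∑ ω : Fin m → Bits N × Bits M,
    if ∃ out, Computes noOracle post (List.replicate M true) (samplesStr fun i => (ω i).2) out T ∧
      ListsGenerators out H
    then ∏ i, subroutineProb f (ω i).1 (bitCharState (ω i).2) else 0

end

end RealQT

open RealQT

/-!
The categorical part is the character theory of a finite abelian group over the reals. On the
basis of kets `point G` copies and `grp G` multiplies, so the Frobenius and bialgebra laws become
identities in `G` (`hasEncoding`). The states copied by `grp G`
are the real characters (`grp_isClassicalState_iff`). Real characters have values `±1`, so they
factor through `G / 2G` and separate points exactly if `2g = 0` for all `g`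
(`requirementD_iff`, `annihilators_determine_iff`). The amplitude of an outcome `(f g₀, χ)` of the
subroutine is the sum of `χ` over the coset `g₀ + H` divided by `|G|`; it vanishes unless `χ` is
trivial on `H` (`subroutineProb_charState_of_annihilates`, `subroutineProb_charState_eq_zero`).

For `G = ℤ₂^M` the samples are uniform on the annihilator of `H`. A vector outside `H` is orthogonal
to each sample with probability one half, so by the union bound the common kernel of `M + k` samples
is `H`, except with probability `2^(-k)` (`one_sub_le_sum_orthogonal_eq`). The post-processing
computes this kernel: it keeps a basis, starting from the standard one, and for every sample removes
the first basis vector that is not orthogonal to it, adding that vector to the other such vectors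
(`recoverProg`, `one_sub_le_recoveryProb`).

For Simon's problem, `n + 2` copies of the subroutine form one circuit, two layers of Hadamard gates
around the oracle gates. Its amplitudes are products of those of the subroutine
(`simonCircuit_prob`), its code is written out by an explicit program (`exec_simonPre`), and the
elimination ends with the single vector `z` except with probability `1/4` (`simon_solved`).

For the separation the language is given by the first bit of the solution on `n` bits. The quantum
algorithm decides it for every oracle with Simon's promise (`firstBitLanguage_mem_BQPReal`). The
oracles with the promise form a compact space, and every randomised polynomial-time program decides
the language for a closed set of oracles. There are countably many programs, so if every oracle were
handled by some program, by Baire's theorem one program would handle all oracles that agree with a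
given one on finitely many lengths. On a large length this contradicts counting: a deterministic
algorithm with `T` queries run on `π ∘ rep z`, where `π` is a permutation and `rep z` chooses
representatives modulo `z`, sees only distinct answers unless `z` is a difference of two queries,
and hence behaves as on a relabelled permutation, independently of `z`
(`card_mul_card_le_card_wrong_add`, `two_pow_le_of_decidesAt`,
`exists_firstBitLanguage_notMem_BPP`).
-/

namespace RealQT

/-! ### Linear maps and adjoints on the group algebra -/

section Kets

variable {K : Type u} [Fintype K] {L : Type v} [Fintype L]

@[simp] lemma linExt_ket {E : Type v} [AddCommGroup E] [Module ℝ E] (f : K → E) (k : K) :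
    linExt f (ket k) = f k := by
  have := (EuclideanSpace.basisFun K ℝ).toBasis.constr_basis ℝ f k
  simpa [linExt, ket] using this

@[simp] lemma coherent_ket (f : K → L) (k : K) : coherent f (ket k) = ket (f k) := by
  simp [coherent]

lemma linearMap_ext_ket {E : Type v} [AddCommGroup E] [Module ℝ E] {S T : Sp K →ₗ[ℝ] E}
    (h : ∀ k, S (ket k) = T (ket k)) : S = T :=
  (EuclideanSpace.basisFun K ℝ).toBasis.ext fun k => by simpa [ket] using h k

lemma linearMap_ext_ket₂ {E : Type*} [AddCommGroup E] [Module ℝ E]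
    {S T : Sp K ⊗[ℝ] Sp L →ₗ[ℝ] E}
    (h : ∀ k l, S (ket k ⊗ₜ ket l) = T (ket k ⊗ₜ ket l)) : S = T := by
  refine TensorProduct.ext ?_
  refine (EuclideanSpace.basisFun K ℝ).toBasis.ext fun k => ?_
  refine (EuclideanSpace.basisFun L ℝ).toBasis.ext fun l => ?_
  simpa [ket] using h k l

open Classical in
lemma inner_ket_ket (a b : K) : inner ℝ (ket a) (ket b) = if a = b then (1 : ℝ) else 0 :=
  (orthonormal_iff_ite.mp (EuclideanSpace.basisFun K ℝ).orthonormal) a b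

lemma inner_ket_left (a : K) (x : Sp K) : inner ℝ (ket a) x = x a :=
  EuclideanSpace.basisFun_inner K ℝ x a

lemma inner_ket_right (a : K) (x : Sp K) : inner ℝ x (ket a) = x a := by
  rw [real_inner_comm, inner_ket_left]

lemma eq_sum_ket (x : Sp K) : x = ∑ k, x k • ket k := by
  conv_lhs => rw [← (EuclideanSpace.basisFun K ℝ).sum_repr x]
  simp [ket]

open Classical in
@[simp] lemma ket_apply (a b : K) : (ket a : Sp K) b = if a = b then (1 : ℝ) else 0 := by
  rw [← inner_ket_right, inner_ket_ket]

lemma ket_injective : Function.Injective (ket : K → Sp K) := by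
  classical
  intro a b h
  have := congrArg (fun x : Sp K => x b) h
  simpa using this

lemma eq_adjoint_of_ket {S : Sp K →ₗ[ℝ] Sp L} {T : Sp L →ₗ[ℝ] Sp K}
    (h : ∀ k l, inner ℝ (T (ket l)) (ket k) = inner ℝ (ket l) (S (ket k))) :
    LinearMap.adjoint S = T := by
  symm
  rw [LinearMap.eq_adjoint_iff_basis (EuclideanSpace.basisFun L ℝ).toBasis
    (EuclideanSpace.basisFun K ℝ).toBasis]
  intro l k
  simpa [ket] using h k l

lemma adjoint_ket_apply {E : Type*} [NormedAddCommGroup E] [InnerProductSpace ℝ E]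
    [FiniteDimensional ℝ E] (S : Sp K →ₗ[ℝ] E) (x : E) :
    LinearMap.adjoint S x = ∑ k, inner ℝ (S (ket k)) x • ket k := by
  conv_lhs => rw [eq_sum_ket (LinearMap.adjoint S x)]
  refine Finset.sum_congr rfl fun k _ => ?_
  rw [← inner_ket_left, LinearMap.adjoint_inner_right]

open Classical in
@[simp] lemma point_comul_ket (k : K) : (point K).comul (ket k) = ket k ⊗ₜ[ℝ] ket k := by
  simp [point]

@[simp] lemma point_counit_ket (k : K) : (point K).counit (ket k) = 1 := by
  simp [point]

open Classical in
@[simp] lemma point_mul_ket (a b : K) :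
    (point K).mul (ket a ⊗ₜ[ℝ] ket b) = if a = b then ket a else 0 := by
  rw [Observable.mul, adjoint_ket_apply]
  simp only [point_comul_ket, TensorProduct.inner_tmul, inner_ket_ket]
  rw [Finset.sum_eq_single a]
  · by_cases h : a = b <;> simp [h]
  · intro k _ hk
    simp [hk]
  · simp

@[simp] lemma point_unit_one : (point K).unit 1 = ∑ k : K, ket k := by
  rw [Observable.unit, adjoint_ket_apply]
  simp

open Classical in
@[simp] lemma point_cap_ket (a b : K) :
    (point K).cap (ket a ⊗ₜ[ℝ] ket b) = if a = b then 1 else 0 := by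
  simp only [Observable.cap, LinearMap.comp_apply, point_mul_ket]
  split_ifs <;> simp

variable [AddCommGroup K]

open Classical in
@[simp] lemma grp_comul_ket (k : K) :
    (grp K).comul (ket k) = ∑ a : K, ket a ⊗ₜ[ℝ] ket (k - a) := by
  simp [grp]

open Classical in
@[simp] lemma grp_counit_ket (k : K) : (grp K).counit (ket k) = if k = 0 then 1 else 0 := by
  simp [grp]

@[simp] lemma grp_mul_ket (a b : K) : (grp K).mul (ket a ⊗ₜ[ℝ] ket b) = ket (a + b) := by
  classical
  rw [Observable.mul, adjoint_ket_apply]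
  simp only [grp_comul_ket, sum_inner, TensorProduct.inner_tmul, inner_ket_ket]
  rw [Finset.sum_eq_single (a + b)]
  · rw [Finset.sum_eq_single a] <;> simp +contextual
  · intro k _ hk
    rw [Finset.sum_eq_zero, zero_smul]
    intro c _
    by_cases hc : c = a
    · subst hc
      simp [sub_eq_iff_eq_add, add_comm b, hk]
    · simp [hc]
  · simp

@[simp] lemma grp_unit_one : (grp K).unit 1 = ket 0 := by
  classical
  rw [Observable.unit, adjoint_ket_apply]
  simp

open Classical in
@[simp] lemma grp_cap_ket (a b : K) :
    (grp K).cap (ket a ⊗ₜ[ℝ] ket b) = if a + b = 0 then 1 else 0 := by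
  simp [Observable.cap]

end Kets

/-! ### The point structure and the group structure -/

section Encoding

variable {K : Type u} [Fintype K]

variable (K) in
lemma point_isSpecial : (point K).IsSpecial :=
  linearMap_ext_ket fun k => by simp

variable (K) in
lemma point_isCommutative : (point K).IsCommutative :=
  linearMap_ext_ket₂ fun a b => by
    by_cases h : a = b
    · simp [h]
    · simp [h, Ne.symm h]

variable (K) in
lemma point_isDaggerFrobenius : (point K).IsDaggerFrobenius where
  coassoc := linearMap_ext_ket fun k => by simp
  counit_left := linearMap_ext_ket fun k => by simp
  counit_right := linearMap_ext_ket fun k => by simp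
  frobenius_left := linearMap_ext_ket₂ fun a b => by
    by_cases h : a = b <;> simp [h]
  frobenius_right := linearMap_ext_ket₂ fun a b => by
    by_cases h : a = b <;> simp [h]

lemma Observable.IsCommutative.isBalancedSymmetric {E : Type u} [NormedAddCommGroup E]
    [InnerProductSpace ℝ E] [FiniteDimensional ℝ E] {A : Observable E} (h : A.IsCommutative) :
    A.IsBalancedSymmetric := by
  rw [Observable.IsBalancedSymmetric, Observable.cap, LinearMap.comp_assoc, h]

variable (K) in
lemma point_isQSFA : (point K).IsQSFA where
  frobenius := point_isDaggerFrobenius K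
  quasiSpecial := ⟨1, one_ne_zero, by
    rw [mul_one, one_smul]
    exact point_isSpecial K⟩
  balanced := (point_isCommutative K).isBalancedSymmetric

@[simp] lemma point_cup_one : (point K).cup 1 = ∑ k : K, ket k ⊗ₜ[ℝ] ket k := by
  simp [Observable.cup]

variable [AddCommGroup K]

@[simp] lemma antipode_ket (k : K) :
    Observable.antipode (point K) (grp K) (ket k) = ket (-k) := by
  classical
  simp only [Observable.antipode, LinearMap.comp_apply, LinearEquiv.coe_coe,
    TensorProduct.rid_symm_apply, LinearMap.lTensor_tmul, point_cup_one, TensorProduct.tmul_sum,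
    map_sum, TensorProduct.assoc_symm_tmul, LinearMap.rTensor_tmul, grp_cap_ket,
    TensorProduct.lid_tmul]
  rw [Finset.sum_eq_single (-k)]
  · simp
  · intro b _ hb
    rw [if_neg, zero_smul]
    intro h
    exact hb (eq_neg_of_add_eq_zero_right h)
  · simp

variable (K) in
lemma grp_isCommutative : (grp K).IsCommutative :=
  linearMap_ext_ket₂ fun a b => by simp [add_comm]

variable (K) in
lemma grp_isQuasiSpecial : (grp K).IsQuasiSpecial √(Fintype.card K) := by
  refine ⟨?_, linearMap_ext_ket fun k => ?_⟩
  · rw [Real.sqrt_ne_zero']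
    exact_mod_cast Fintype.card_pos
  · rw [Real.mul_self_sqrt (Nat.cast_nonneg _)]
    simp [map_sum, ← Nat.cast_smul_eq_nsmul ℝ]

variable (K) in
lemma grp_isDaggerFrobenius : (grp K).IsDaggerFrobenius where
  coassoc := linearMap_ext_ket fun k => by
    simp only [LinearMap.comp_apply, grp_comul_ket, map_sum, LinearMap.rTensor_tmul,
      TensorProduct.sum_tmul, LinearEquiv.coe_coe, TensorProduct.assoc_tmul,
      LinearMap.lTensor_tmul, TensorProduct.tmul_sum]
    rw [Finset.sum_comm]
    refine Finset.sum_congr rfl fun a _ => ?_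
    refine Fintype.sum_equiv (Equiv.subRight a) _ _ fun b => ?_
    simp
  counit_left := linearMap_ext_ket fun k => by
    classical
    simp only [LinearMap.comp_apply, grp_comul_ket, map_sum, LinearMap.rTensor_tmul,
      LinearEquiv.coe_coe, grp_counit_ket, TensorProduct.lid_tmul]
    simp
  counit_right := linearMap_ext_ket fun k => by
    classical
    simp only [LinearMap.comp_apply, grp_comul_ket, map_sum, LinearMap.lTensor_tmul,
      LinearEquiv.coe_coe, grp_counit_ket, TensorProduct.rid_tmul, sub_eq_zero]
    simp
  frobenius_left := linearMap_ext_ket₂ fun a b => by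
    simp only [LinearMap.comp_apply, grp_comul_ket, map_sum, LinearMap.rTensor_tmul,
      LinearEquiv.coe_coe, TensorProduct.assoc_symm_tmul, LinearMap.lTensor_tmul,
      TensorProduct.tmul_sum, grp_mul_ket]
    refine Fintype.sum_equiv (Equiv.addLeft a) _ _ fun c => ?_
    simp
  frobenius_right := linearMap_ext_ket₂ fun a b => by
    simp only [LinearMap.comp_apply, grp_comul_ket, map_sum, LinearMap.rTensor_tmul,
      LinearEquiv.coe_coe, TensorProduct.assoc_tmul, LinearMap.lTensor_tmul,
      TensorProduct.sum_tmul, grp_mul_ket]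
    refine Finset.sum_congr rfl fun c _ => ?_
    rw [sub_add_eq_add_sub]

variable (K) in
lemma grp_isQSFA : (grp K).IsQSFA where
  frobenius := grp_isDaggerFrobenius K
  quasiSpecial := ⟨_, grp_isQuasiSpecial K⟩
  balanced := (grp_isCommutative K).isBalancedSymmetric

variable (K) in
lemma antipode_adjoint : LinearMap.adjoint (Observable.antipode (point K) (grp K)) =
    Observable.antipode (point K) (grp K) := by
  classical
  refine eq_adjoint_of_ket fun k l => ?_
  simp only [antipode_ket, inner_ket_ket, neg_eq_iff_eq_neg]

variable (K) in
lemma antipode_comp_antipode : Observable.antipode (point K) (grp K) ∘ₗ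
    Observable.antipode (point K) (grp K) = LinearMap.id :=
  linearMap_ext_ket fun k => by simp

variable (K) in
lemma isStronglyComplementary : Observable.IsStronglyComplementary (point K) (grp K) where
  complementary :=
    { left := point_isQSFA K
      right := grp_isQSFA K
      antipode_unitary := by
        rw [IsUnitary, antipode_adjoint, antipode_comp_antipode]
        exact ⟨rfl, rfl⟩
      antipode_selfAdjoint := antipode_adjoint K
      hopf_left := linearMap_ext_ket fun k => by simp
      hopf_right := linearMap_ext_ket fun k => by simp }
  mul_copied := linearMap_ext_ket₂ fun a b => by simp
  mul_deleted := linearMap_ext_ket₂ fun a b => by simp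
  unit_copied := by simp
  unit_deleted := by simp

omit [AddCommGroup K] in
lemma point_comul_apply (ψ : Sp K) : (point K).comul ψ = ∑ k, (ψ k • ket k) ⊗ₜ[ℝ] ket k := by
  conv_lhs => rw [eq_sum_ket ψ]
  simp [TensorProduct.smul_tmul']

omit [AddCommGroup K] in
lemma point_counit_apply (ψ : Sp K) : (point K).counit ψ = ∑ k, ψ k := by
  conv_lhs => rw [eq_sum_ket ψ]
  simp

omit [AddCommGroup K] in
open Classical in
lemma inner_ket_tmul_point_comul (a b : K) (ψ : Sp K) :
    inner ℝ (ket a ⊗ₜ[ℝ] ket b) ((point K).comul ψ) = if a = b then ψ a else 0 := by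
  rw [point_comul_apply]
  simp only [inner_sum, TensorProduct.inner_tmul, real_inner_smul_right, inner_ket_ket]
  rw [Finset.sum_eq_single a] <;> simp +contextual [eq_comm]

omit [AddCommGroup K] in
lemma point_cap_ket_tmul (k : K) (x : Sp K) : (point K).cap (ket k ⊗ₜ[ℝ] x) = x k := by
  classical
  conv_lhs => rw [eq_sum_ket x]
  simp [TensorProduct.tmul_sum, TensorProduct.tmul_smul, map_sum]

omit [AddCommGroup K] in
/-- A copied state is idempotent in every coordinate, a deleted one has total weight one. -/
lemma point_isClassicalState_iff (ψ : Sp K) :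
    (point K).IsClassicalState ψ ↔ ∃ k, ψ = ket k := by
  classical
  constructor
  · intro h
    have hc : ∀ a b, (if a = b then ψ a else 0) = ψ a * ψ b := fun a b => by
      rw [← inner_ket_tmul_point_comul, h.copied, TensorProduct.inner_tmul, inner_ket_left,
        inner_ket_left]
    have hd : ∑ k, ψ k = 1 := by rw [← point_counit_apply, h.deleted]
    obtain ⟨k, hk⟩ : ∃ k, ψ k ≠ 0 := by
      by_contra! h0
      simp [h0] at hd
    refine ⟨k, ?_⟩
    ext l
    have h1 := hc k k
    have h2 := hc k l
    rw [if_pos rfl] at h1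
    rw [ket_apply]
    split_ifs at h2 ⊢ with hkl
    · exact mul_left_cancel₀ hk (by rw [← h2, mul_one])
    · exact (mul_eq_zero.mp h2.symm).resolve_left hk
  · rintro ⟨k, rfl⟩
    exact ⟨by simp, by simp, fun x => by rw [inner_ket_left, point_cap_ket_tmul]⟩

variable (K) in
lemma encodes_point_grp : Observable.Encodes (point K) (grp K) K := by
  refine ⟨Equiv.ofBijective (fun k => ⟨ket k, (point_isClassicalState_iff _).2 ⟨k, rfl⟩⟩)
    ⟨fun a b h => ket_injective (congrArg Subtype.val h), ?_⟩, ?_, ?_⟩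
  · rintro ⟨ψ, h⟩
    obtain ⟨k, rfl⟩ := (point_isClassicalState_iff _).1 h
    exact ⟨k, rfl⟩
  · intro a b
    exact grp_mul_ket a b
  · exact grp_unit_one

variable (K) in
lemma hasEncoding : HasEncoding K where
  pair := isStronglyComplementary K
  point_special := point_isSpecial K
  point_comm := point_isCommutative K
  grp_quasiSpecial := grp_isQuasiSpecial K
  grp_comm := grp_isCommutative K
  encodes := encodes_point_grp K

omit [AddCommGroup K] in
variable (K) in
lemma point_hasEnoughClassicalStates : (point K).HasEnoughClassicalStates := by
  intro E _ _ _ S T h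
  exact linearMap_ext_ket fun k => h _ ((point_isClassicalState_iff _).2 ⟨k, rfl⟩)

omit [AddCommGroup K] in
variable (K) in
lemma point_hasOrthogonalClassicalStates : (point K).HasOrthogonalClassicalStates := by
  classical
  intro ψ φ hψ hφ hne
  obtain ⟨a, rfl⟩ := (point_isClassicalState_iff _).1 hψ
  obtain ⟨b, rfl⟩ := (point_isClassicalState_iff _).1 hφ
  rw [inner_ket_ket, if_neg fun h => hne (by rw [h])]

end Encoding

/-! ### Real characters and the classical states of the group structure -/

section Characters

variable {G : Type u} [Fintype G] [AddCommGroup G]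

omit [AddCommGroup G] in
lemma tensor_ext_ket {L : Type v} [Fintype L] {x y : Sp G ⊗[ℝ] Sp L}
    (h : ∀ a b, inner ℝ (ket a ⊗ₜ[ℝ] ket b) x = inner ℝ (ket a ⊗ₜ[ℝ] ket b) y) : x = y := by
  refine InnerProductSpace.ext_inner_left_basis (𝕜 := ℝ)
    ((EuclideanSpace.basisFun G ℝ).toBasis.tensorProduct
      (EuclideanSpace.basisFun L ℝ).toBasis) ?_
  rintro ⟨a, b⟩
  simpa [ket] using h a b

lemma inner_ket_tmul_grp_comul (a b : G) (ψ : Sp G) :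
    inner ℝ (ket a ⊗ₜ[ℝ] ket b) ((grp G).comul ψ) = ψ (a + b) := by
  rw [← LinearMap.adjoint_inner_left]
  change inner ℝ ((grp G).mul _) ψ = _
  rw [grp_mul_ket, inner_ket_left]

lemma grp_counit_apply (ψ : Sp G) : (grp G).counit ψ = ψ 0 := by
  have h := LinearMap.adjoint_inner_left (grp G).counit ψ 1
  change inner ℝ ((grp G).unit 1) ψ = _ at h
  rw [grp_unit_one, inner_ket_left] at h
  simpa using h.symm

lemma grp_cap_tmul_ket (ψ : Sp G) (b : G) : (grp G).cap (ψ ⊗ₜ[ℝ] ket b) = ψ (-b) := by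
  classical
  conv_lhs => rw [eq_sum_ket ψ]
  simp [TensorProduct.sum_tmul, ← TensorProduct.smul_tmul', add_eq_zero_iff_eq_neg]

/-- A real character of a finite group takes only the values `±1`. -/
lemma AddChar.real_mul_self (χ : AddChar G ℝ) (g : G) : χ g * χ g = 1 := by
  have h : χ g ^ Fintype.card G = 1 := by
    rw [← AddChar.map_nsmul_eq_pow, card_nsmul_eq_zero, AddChar.map_zero_eq_one]
  have h' : |χ g| = 1 := by
    rw [← pow_eq_one_iff_of_nonneg (abs_nonneg _) (Fintype.card_ne_zero (α := G)), ← abs_pow, h,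
      abs_one]
  rw [← abs_mul_abs_self, h', one_mul]

lemma AddChar.real_map_neg (χ : AddChar G ℝ) (g : G) : χ (-g) = χ g := by
  rw [AddChar.map_neg_eq_inv]
  exact (eq_inv_of_mul_eq_one_left (AddChar.real_mul_self χ g)).symm

lemma charState_apply (χ : AddChar G ℝ) (g : G) : charState χ g = χ g := rfl

lemma charState_injective : Function.Injective (charState : AddChar G ℝ → Sp G) := by
  intro χ φ h
  ext g
  rw [← charState_apply, h, charState_apply]

lemma grp_isClassicalState_iff (ψ : Sp G) :
    (grp G).IsClassicalState ψ ↔ ∃ χ : AddChar G ℝ, ψ = charState χ := by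
  constructor
  · intro h
    refine ⟨⟨ψ, ?_, fun a b => ?_⟩, rfl⟩
    · rw [← grp_counit_apply, h.deleted]
    · rw [← inner_ket_tmul_grp_comul, h.copied, TensorProduct.inner_tmul, inner_ket_left,
        inner_ket_left]
  · rintro ⟨χ, rfl⟩
    refine ⟨tensor_ext_ket fun a b => ?_, ?_, fun x => ?_⟩
    · rw [inner_ket_tmul_grp_comul, TensorProduct.inner_tmul, inner_ket_left, inner_ket_left]
      exact AddChar.map_add_eq_mul χ a b
    · rw [grp_counit_apply]
      exact AddChar.map_zero_eq_one χ
    · have : innerₛₗ ℝ (charState χ) = (grp G).cap ∘ₗ TensorProduct.mk ℝ _ _ (charState χ) :=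
        linearMap_ext_ket fun g => by
          simp only [innerₛₗ_apply_apply, inner_ket_right, LinearMap.comp_apply,
            TensorProduct.mk_apply, grp_cap_tmul_ket]
          exact (AddChar.real_map_neg χ g).symm
      exact LinearMap.congr_fun this x

lemma inner_charState (χ φ : AddChar G ℝ) :
    inner ℝ (charState χ) (charState φ) = ∑ g, χ g * φ g := by
  simp [PiLp.inner_apply, charState_apply, mul_comm]

variable (G) in
lemma grp_hasOrthogonalClassicalStates : (grp G).HasOrthogonalClassicalStates := by
  intro ψ φ hψ hφ hne
  obtain ⟨χ, rfl⟩ := (grp_isClassicalState_iff _).1 hψ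
  obtain ⟨χ', rfl⟩ := (grp_isClassicalState_iff _).1 hφ
  rw [inner_charState]
  have h : χ * χ' ≠ 0 := by
    intro h
    refine hne (congrArg _ ?_)
    ext g
    have h1 : χ g * χ' g = 1 := by
      rw [← AddChar.mul_apply, h, AddChar.zero_apply]
    have h2 := AddChar.real_mul_self χ' g
    exact mul_right_cancel₀ (right_ne_zero_of_mul_eq_one h2) (h1.trans h2.symm)
  simpa using AddChar.sum_eq_zero_iff_ne_zero.2 h

/-- In a group of exponent two the complex characters are real, so real characters separate
points. -/
lemma exists_real_addChar_ne_one (hG : ∀ g : G, g + g = 0) {a : G} (ha : a ≠ 0) :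
    ∃ χ : AddChar G ℝ, χ a ≠ 1 := by
  obtain ⟨ψ, hψ⟩ := AddChar.exists_apply_ne_zero.2 ha
  have him : ∀ g, (ψ g).im = 0 := fun g => by
    have h : ψ g * ψ g = 1 := by rw [← AddChar.map_add_eq_mul, hG, AddChar.map_zero_eq_one]
    rcases mul_self_eq_one_iff.1 h with h | h <;> simp [h]
  refine ⟨⟨fun g => (ψ g).re, by simp, fun x y => ?_⟩, fun h => hψ ?_⟩
  · simp [AddChar.map_add_eq_mul, him]
  · exact Complex.ext h (him a)

lemma sum_real_addChar_eq_zero (hG : ∀ g : G, g + g = 0) {a : G} (ha : a ≠ 0) :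
    ∑ χ : AddChar G ℝ, χ a = 0 := by
  obtain ⟨χ₀, h₀⟩ := exists_real_addChar_ne_one hG ha
  have h : ∑ χ : AddChar G ℝ, χ a = χ₀ a * ∑ χ : AddChar G ℝ, χ a := by
    rw [Finset.mul_sum]
    refine (Fintype.sum_equiv (Equiv.mulLeft χ₀) _ _ fun χ => ?_).symm
    simp
  by_contra hne
  exact h₀ (mul_right_cancel₀ hne (by rw [one_mul, ← h]))

/-- The group structure has enough classical states exactly for groups of exponent two: inversion
always fixes the real characters, and conversely `|a⟩` is the average of `χ(a) |χ⟩`. -/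
lemma grp_hasEnoughClassicalStates_iff :
    (grp G).HasEnoughClassicalStates ↔ ∀ g : G, g + g = 0 := by
  classical
  constructor
  · intro h g
    have hS : coherent (fun g : G => -g) = LinearMap.id := by
      refine h (Sp G) _ _ fun ψ hψ => ?_
      obtain ⟨χ, rfl⟩ := (grp_isClassicalState_iff _).1 hψ
      conv_lhs => rw [eq_sum_ket (charState χ)]
      conv_rhs => rw [LinearMap.id_apply, eq_sum_ket (charState χ)]
      simp only [map_sum, map_smul, coherent_ket]
      refine Fintype.sum_equiv (Equiv.neg G) _ _ fun g => ?_
      simp [charState_apply, AddChar.real_map_neg]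
    have hk := LinearMap.congr_fun hS (ket g)
    rw [coherent_ket, LinearMap.id_apply] at hk
    have := ket_injective hk
    rw [← this, ← sub_eq_add_neg, sub_eq_zero, this]
  · intro hG E _ _ _ S T h
    refine linearMap_ext_ket fun a => ?_
    have key : ∑ χ : AddChar G ℝ, χ a • charState χ
        = (Fintype.card (AddChar G ℝ) : ℝ) • ket a := by
      ext b
      have h1 : ∀ χ : AddChar G ℝ, χ a * χ b = χ (a + b) := fun χ =>
        (AddChar.map_add_eq_mul χ a b).symm
      simp only [WithLp.ofLp_sum, Finset.sum_apply, WithLp.ofLp_smul, Pi.smul_apply,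
        charState_apply, smul_eq_mul, h1, ket_apply]
      by_cases hab : a = b
      · subst hab
        simp [hG]
      · rw [if_neg hab, mul_zero]
        refine sum_real_addChar_eq_zero hG fun h0 => hab ?_
        rw [add_eq_zero_iff_eq_neg.1 h0, neg_eq_iff_add_eq_zero, hG]
    have hc : (Fintype.card (AddChar G ℝ) : ℝ) ≠ 0 := by
      exact_mod_cast Fintype.card_ne_zero
    have hST : ∀ R : Sp G →ₗ[ℝ] E, (Fintype.card (AddChar G ℝ) : ℝ) • R (ket a)
        = ∑ χ : AddChar G ℝ, χ a • R (charState χ) := fun R => by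
      rw [← map_smul, ← key, map_sum]
      simp
    refine smul_right_injective E hc ?_
    simp only [hST]
    exact Finset.sum_congr rfl fun χ _ => by
      rw [h _ ((grp_isClassicalState_iff _).2 ⟨χ, rfl⟩)]

omit [Fintype G] in
lemma bits_add_self {N : ℕ} (x : Bits N) : x + x = 0 := by
  ext i
  exact CharTwo.add_self_eq_zero _

lemma requirementD_iff (N : ℕ) : RequirementD G N ↔ ∀ g : G, g + g = 0 :=
  ⟨fun h => grp_hasEnoughClassicalStates_iff.1 h.main_enough, fun h =>
    { main_enough := grp_hasEnoughClassicalStates_iff.2 h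
      main_orthogonal := grp_hasOrthogonalClassicalStates G
      labels_enough := point_hasEnoughClassicalStates _
      labels_orthogonal := point_hasOrthogonalClassicalStates _ }⟩

lemma requirementB : RequirementB :=
  ⟨0, fun s => ⟨LinearMap.comp_zero s, LinearMap.zero_comp s⟩⟩

/-- In a group of exponent two, an element outside `H` is detected by a real character that is
trivial on `H`. -/
lemma exists_annihilates_ne_one (hG : ∀ g : G, g + g = 0) (H : AddSubgroup G) {a : G}
    (ha : a ∉ H) : ∃ χ : AddChar G ℝ, Annihilates χ H ∧ χ a ≠ 1 := by
  have : Fintype (G ⧸ H) := Fintype.ofFinite _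
  have hQ : ∀ q : G ⧸ H, q + q = 0 := fun q => by
    induction q using QuotientAddGroup.induction_on with
    | H g => rw [← QuotientAddGroup.mk_add, hG, QuotientAddGroup.mk_zero]
  obtain ⟨χ, hχ⟩ := exists_real_addChar_ne_one hQ (a := (a : G ⧸ H))
    (fun h => ha ((QuotientAddGroup.eq_zero_iff a).1 h))
  refine ⟨χ.compAddMonoidHom (QuotientAddGroup.mk' H), fun h hh => ?_, hχ⟩
  have h0 : (h : G ⧸ H) = 0 := (QuotientAddGroup.eq_zero_iff h).2 hh
  simp [h0]

lemma annihilators_determine_iff :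
    (∀ H H' : AddSubgroup G, (∀ χ : AddChar G ℝ, Annihilates χ H ↔ Annihilates χ H') → H = H') ↔
      ∀ g : G, g + g = 0 := by
  constructor
  · intro h g
    have := h ⊥ (AddSubgroup.zmultiples (g + g)) fun χ => by
      refine iff_of_true (fun x hx => ?_) fun x hx => ?_
      · rw [AddSubgroup.mem_bot.1 hx, AddChar.map_zero_eq_one]
      · obtain ⟨n, rfl⟩ := AddSubgroup.mem_zmultiples_iff.1 hx
        rw [AddChar.map_zsmul_eq_zpow, AddChar.map_add_eq_mul, AddChar.real_mul_self, one_zpow]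
    rw [← AddSubgroup.mem_bot, this]
    exact AddSubgroup.mem_zmultiples _
  · intro hG
    have key : ∀ H H' : AddSubgroup G,
        (∀ χ : AddChar G ℝ, Annihilates χ H ↔ Annihilates χ H') → H ≤ H' := by
      intro H H' h a ha
      by_contra hn
      obtain ⟨χ, h1, h2⟩ := exists_annihilates_ne_one hG H' hn
      exact h2 ((h χ).2 h1 a ha)
    intro H H' h
    exact le_antisymm (key H H' h) (key H' H fun χ => (h χ).symm)

end Characters

/-! ### The coherent factorisation promise -/

section Promise

variable {K : Type u} [Fintype K] {L : Type v} [Fintype L]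

open Classical in
lemma coherent_adjoint_ket (f : K → L) (l : L) :
    LinearMap.adjoint (coherent f) (ket l) = ∑ k, if f k = l then ket k else 0 := by
  rw [adjoint_ket_apply]
  refine Finset.sum_congr rfl fun k _ => ?_
  rw [coherent_ket, inner_ket_ket]
  split_ifs <;> simp

lemma coherent_isClassicalMap (f : K → L) :
    Observable.IsClassicalMap (point K) (point L) (coherent f) where
  copied := linearMap_ext_ket fun k => by simp
  deleted := linearMap_ext_ket fun k => by simp
  transposed := linearMap_ext_ket fun l => by
    classical
    rw [coherent_adjoint_ket]
    simp [TensorProduct.sum_tmul, map_sum]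

lemma coherent_comp {M : Type*} [Fintype M] (g : L → M) (f : K → L) :
    coherent g ∘ₗ coherent f = coherent (g ∘ f) :=
  linearMap_ext_ket fun k => by simp

lemma coherent_isIsometric {f : K → L} (hf : Function.Injective f) :
    IsIsometric (coherent f) := by
  classical
  refine linearMap_ext_ket fun k => ?_
  rw [LinearMap.comp_apply, coherent_ket, coherent_adjoint_ket]
  simp [hf.eq_iff]

lemma coherent_isPairHom [AddCommGroup K] [AddCommGroup L] (f : K →+ L) :
    Observable.IsPairHom (point K) (grp K) (point L) (grp L) (coherent f) where
  classical := coherent_isClassicalMap f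
  map_mul := linearMap_ext_ket₂ fun a b => by simp
  map_unit := LinearMap.ext_ring (by simp)
  map_antipode := linearMap_ext_ket fun k => by simp

lemma coherentPromise {G : Type u} [AddCommGroup G] [Fintype G] (H : AddSubgroup G) [Fintype H]
    [Fintype (G ⧸ H)] {N : ℕ} {f : G → Bits N} (hf : Hides f H) : CoherentPromise H f := by
  classical
  have hwd : ∀ x y : G, QuotientAddGroup.leftRel H x y → f x = f y := fun x y h => by
    rw [hf x y, ← neg_mem_iff, neg_sub, sub_eq_neg_add]
    exact QuotientAddGroup.leftRel_apply.1 h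
  let s : G ⧸ H → Bits N := Quotient.lift f hwd
  have hs : Function.Injective s := by
    rintro ⟨x⟩ ⟨y⟩ h
    refine QuotientAddGroup.eq.2 ?_
    rw [← sub_eq_neg_add, ← neg_sub, neg_mem_iff]
    exact (hf x y).1 h
  refine ⟨coherent_isClassicalMap f, coherent (QuotientAddGroup.mk' H), coherent s,
    coherent Quotient.out, coherent H.subtype, ?_, coherent_isClassicalMap s,
    coherent_isIsometric hs, coherent_isPairHom _, coherent_isIsometric Quotient.out_injective,
    ?_, coherent_isPairHom _, coherent_isIsometric Subtype.val_injective, ?_, ?_⟩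
  · rw [coherent_comp]
    rfl
  · refine linearMap_ext_ket fun k => ?_
    simp
  · refine linearMap_ext_ket fun h => ?_
    have h0 : ((h : G) : G ⧸ H) = 0 := (QuotientAddGroup.eq_zero_iff _).2 h.2
    simp [h0]
  · refine LinearMap.ext_ring ?_
    rw [LinearMap.comp_apply, LinearMap.comp_apply, grp_unit_one, point_unit_one,
      coherent_adjoint_ket, map_sum]
    simp only [QuotientAddGroup.mk'_apply, QuotientAddGroup.eq_zero_iff, coherent_ket,
      AddSubgroup.coe_subtype]
    rw [← Finset.sum_filter]
    exact Finset.sum_subtype _ (by simp) _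

end Promise

/-! ### The oracle and the quantum subroutine -/

section Oracle

variable {G : Type u} [AddCommGroup G] [Fintype G] {N : ℕ}

omit [AddCommGroup G] in
@[simp] lemma oracle_ket (f : G → Bits N) (g : G) (t : Bits N) :
    oracle f (ket g ⊗ₜ[ℝ] ket t) = ket g ⊗ₜ[ℝ] ket (f g + t) := by
  simp [oracle]

omit [AddCommGroup G] in
lemma oracle_isUnitary (f : G → Bits N) : IsUnitary (oracle f) := by
  classical
  have hinv : oracle f ∘ₗ oracle f = LinearMap.id := linearMap_ext_ket₂ fun g t => by
    simp [← add_assoc, bits_add_self]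
  have hadj : LinearMap.adjoint (oracle f) = oracle f := by
    symm
    let B := (EuclideanSpace.basisFun G ℝ).toBasis.tensorProduct
      (EuclideanSpace.basisFun (Bits N) ℝ).toBasis
    rw [LinearMap.eq_adjoint_iff_basis B B]
    rintro ⟨a, s⟩ ⟨b, t⟩
    have : inner ℝ (oracle f (ket a ⊗ₜ[ℝ] ket s)) (ket b ⊗ₜ[ℝ] ket t) =
        inner ℝ (ket a ⊗ₜ[ℝ] ket s) (oracle f (ket b ⊗ₜ[ℝ] ket t)) := by
      simp only [oracle_ket, TensorProduct.inner_tmul, inner_ket_ket]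
      by_cases hab : a = b
      · subst hab
        have : f a + s = t ↔ s = f a + t := by
          constructor <;> rintro rfl <;> rw [← add_assoc, bits_add_self, zero_add]
        congr 1
        by_cases h : s = f a + t
        · rw [if_pos (this.2 h), if_pos h]
        · rw [if_neg (mt this.1 h), if_neg h]
      · simp [hab]
    simpa [B, ket] using this
  rw [IsUnitary, hadj]
  exact ⟨hinv, hinv⟩

omit [AddCommGroup G] in
lemma subroutineScalar_eq (f : G → Bits N) (b : Bits N) (ψ : Sp G) :
    subroutineScalar f b ψ = (Fintype.card G : ℝ)⁻¹ * ∑ g, if f g = b then ψ g else 0 := by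
  classical
  rw [subroutineScalar, point_unit_one, grp_unit_one, TensorProduct.sum_tmul, map_sum, inner_sum]
  congr 1
  refine Finset.sum_congr rfl fun g _ => ?_
  rw [oracle_ket, TensorProduct.inner_tmul, inner_ket_right, inner_ket_ket, add_zero]
  simp [eq_comm]

/-- The fibre of `f` over `f g₀` is the coset `g₀ + H`, and a character that is trivial on `H` is
constant there; a nontrivial one sums to zero. -/
lemma subroutineScalar_charState {f : G → Bits N} {H : AddSubgroup G} (hf : Hides f H) (g₀ : G)
    (χ : AddChar G ℝ) : subroutineScalar f (f g₀) (charState χ) =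
      (Fintype.card G : ℝ)⁻¹ * (χ g₀ * ∑ᶠ h : H, χ h) := by
  classical
  have : Fintype H := Fintype.ofFinite H
  rw [subroutineScalar_eq, finsum_eq_sum_of_fintype]
  congr 1
  rw [Finset.mul_sum, ← Finset.sum_filter]
  refine Finset.sum_bij' (fun g hg => ⟨g - g₀, (hf g g₀).1 (Finset.mem_filter.1 hg).2⟩)
    (fun h _ => g₀ + h) ?_ ?_ ?_ ?_ ?_
  · simp
  · intro h _
    simp [hf _ _]
  · intro g _
    simp
  · intro h _
    simp
  · intro g _
    rw [← AddChar.map_add_eq_mul, add_sub_cancel]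
    rfl

lemma subroutineProb_charState_of_annihilates {f : G → Bits N} {H : AddSubgroup G}
    (hf : Hides f H) {b : Bits N} {χ : AddChar G ℝ} (hb : b ∈ Set.range f)
    (hχ : Annihilates χ H) : subroutineProb f b (charState χ) =
      (Nat.card H : ℝ) ^ 2 / (Nat.card G : ℝ) ^ 2 := by
  obtain ⟨g₀, rfl⟩ := hb
  have : Fintype H := Fintype.ofFinite H
  have h1 : ∀ h : H, χ h = 1 := fun h => hχ h h.2
  rw [subroutineProb, subroutineScalar_charState hf, mul_pow, mul_pow, pow_two (χ g₀),
    AddChar.real_mul_self, finsum_eq_sum_of_fintype]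
  simp [h1]
  ring

lemma subroutineProb_charState_eq_zero {f : G → Bits N} {H : AddSubgroup G}
    (hf : Hides f H) {b : Bits N} {χ : AddChar G ℝ}
    (h : ¬ (b ∈ Set.range f ∧ Annihilates χ H)) : subroutineProb f b (charState χ) = 0 := by
  by_cases hb : b ∈ Set.range f
  · obtain ⟨g₀, rfl⟩ := hb
    have : Fintype H := Fintype.ofFinite H
    have hne : χ.compAddMonoidHom H.subtype ≠ 0 := fun h0 => h ⟨⟨g₀, rfl⟩, fun x hx => by
      simpa using DFunLike.congr_fun h0 (⟨x, hx⟩ : H)⟩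
    have hsum := AddChar.sum_eq_zero_iff_ne_zero.2 hne
    simp only [AddChar.compAddMonoidHom_apply, AddSubgroup.coe_subtype] at hsum
    rw [subroutineProb, subroutineScalar_charState hf, finsum_eq_sum_of_fintype, hsum]
    simp
  · rw [subroutineProb, subroutineScalar_eq, Finset.sum_eq_zero, mul_zero, zero_pow two_ne_zero]
    exact fun g _ => if_neg fun hg => hb ⟨g, hg⟩

end Oracle

/-! ### Characters of `ℤ₂^M` -/

section BitCharacters

variable {M : ℕ}

lemma zmod_two_eq_zero_or_one (a : ZMod 2) : a = 0 ∨ a = 1 := by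
  revert a
  decide

/-- The real character `g ↦ (-1)^(p · g)`. -/
noncomputable def bitChar (p : Bits M) : AddChar (Bits M) ℝ where
  toFun g := if p ⬝ᵥ g = 0 then 1 else -1
  map_zero_eq_one' := by simp
  map_add_eq_mul' x y := by
    rw [dotProduct_add]
    rcases zmod_two_eq_zero_or_one (p ⬝ᵥ x) with hx | hx <;>
      rcases zmod_two_eq_zero_or_one (p ⬝ᵥ y) with hy | hy <;> simp [hx, hy, CharTwo.add_self_eq_zero]

lemma bitChar_apply (p g : Bits M) : bitChar p g = if p ⬝ᵥ g = 0 then 1 else -1 := rfl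

lemma bitChar_comm (p g : Bits M) : bitChar p g = bitChar g p := by
  rw [bitChar_apply, bitChar_apply, dotProduct_comm]

lemma bitCharState_apply (p g : Bits M) : bitCharState p g = bitChar p g := rfl

lemma bitChar_eq_one_iff (p g : Bits M) : bitChar p g = 1 ↔ p ⬝ᵥ g = 0 := by
  rw [bitChar_apply]
  split_ifs with h <;> simp [h]
  norm_num

lemma bitChar_injective : Function.Injective (bitChar : Bits M → AddChar (Bits M) ℝ) := by
  intro p q h
  ext i
  have h1 := bitChar_eq_one_iff p (Pi.single i 1)
  rw [h, bitChar_eq_one_iff, dotProduct_single_one, dotProduct_single_one] at h1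
  rcases zmod_two_eq_zero_or_one (p i) with hp | hp <;>
    rcases zmod_two_eq_zero_or_one (q i) with hq | hq <;> simp_all

lemma bitChar_surjective : Function.Surjective (bitChar : Bits M → AddChar (Bits M) ℝ) :=
  (Fintype.bijective_iff_injective_and_card _).2 ⟨bitChar_injective,
    (Fintype.card_le_of_injective _ bitChar_injective).antisymm
      (AddChar.card_addChar_le (Bits M) ℝ)⟩ |>.2

lemma grp_bits_isClassicalState_iff (ψ : Sp (Bits M)) :
    (grp (Bits M)).IsClassicalState ψ ↔ ∃! p : Bits M, ψ = bitCharState p := by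
  rw [grp_isClassicalState_iff]
  constructor
  · rintro ⟨χ, rfl⟩
    obtain ⟨p, rfl⟩ := bitChar_surjective χ
    exact ⟨p, rfl, fun q hq => (bitChar_injective (charState_injective hq)).symm⟩
  · rintro ⟨p, rfl, -⟩
    exact ⟨bitChar p, rfl⟩

lemma sum_bitChar (x : Bits M) :
    ∑ p : Bits M, bitChar p x = if x = 0 then (2 : ℝ) ^ M else 0 := by
  classical
  have h := AddChar.sum_eq_ite (bitChar x)
  have h0 : bitChar x = 0 ↔ x = 0 := by
    have : bitChar (0 : Bits M) = 0 := by
      ext g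
      rw [bitChar_apply, zero_dotProduct, if_pos rfl, AddChar.zero_apply]
    rw [← this, bitChar_injective.eq_iff]
  simp only [h0] at h
  simp_rw [bitChar_comm _ x, h]
  simp

end BitCharacters

/-! ### The distribution of the samples -/

section Samples

variable {M N : ℕ}

/-- The Fourier transform of the distribution of the sampled characters: Parseval's identity turns
it into the probability that translation by `x` preserves the value of `f`. -/
lemma sum_subroutineProb_mul_bitChar {f : Bits M → Bits N} {H : AddSubgroup (Bits M)}
    [DecidablePred (· ∈ H)] (hf : Hides f H) (x : Bits M) :
    ∑ ω : Bits N × Bits M, subroutineProb f ω.1 (bitCharState ω.2) * bitChar ω.2 x =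
      if x ∈ H then 1 else 0 := by
  classical
  have hcard : (Fintype.card (Bits M) : ℝ) = 2 ^ M := by simp
  have hM : (2 : ℝ) ^ M ≠ 0 := by positivity
  have key : ∀ b : Bits N, ∑ p : Bits M, subroutineProb f b (bitCharState p) * bitChar p x =
      ((2 : ℝ) ^ M)⁻¹ * ∑ g, if f g = b ∧ f (g + x) = b then 1 else 0 := by
    intro b
    have h1 : ∀ p : Bits M, subroutineProb f b (bitCharState p) * bitChar p x =
        (((2 : ℝ) ^ M)⁻¹) ^ 2 * ∑ g, ∑ g', if f g = b ∧ f g' = b then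
          bitChar p (g + g' + x) else 0 := by
      intro p
      rw [subroutineProb, subroutineScalar_eq, hcard, mul_pow, mul_assoc]
      congr 1
      rw [pow_two, Finset.sum_mul_sum, Finset.sum_mul]
      refine Finset.sum_congr rfl fun g _ => ?_
      rw [Finset.sum_mul]
      refine Finset.sum_congr rfl fun g' _ => ?_
      rw [AddChar.map_add_eq_mul, AddChar.map_add_eq_mul]
      by_cases h1 : f g = b <;> by_cases h2 : f g' = b <;> simp [h1, h2, bitCharState_apply]
    simp_rw [h1]
    rw [← Finset.mul_sum, Finset.sum_comm, pow_two, mul_assoc]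
    congr 1
    rw [Finset.mul_sum]
    refine Finset.sum_congr rfl fun g _ => ?_
    rw [Finset.sum_comm, Finset.sum_eq_single (g + x)]
    · have : g + (g + x) + x = 0 := by
        rw [← add_assoc, bits_add_self, zero_add, bits_add_self]
      simp only [this, AddChar.map_zero_eq_one]
      split_ifs <;> simp [hM]
    · intro g' _ hg'
      split_ifs
      · rw [sum_bitChar, if_neg]
        intro h0
        apply hg'
        have : g' = (g + x) + (g + g' + x) := by
          have h1 : (g + x) + (g + g' + x) = (g + g) + (x + x) + g' := by abel
          rw [h1, bits_add_self, bits_add_self, zero_add, zero_add]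
        rw [this, h0, add_zero]
      · simp
    · simp
  rw [Fintype.sum_prod_type]
  simp_rw [key]
  rw [← Finset.mul_sum, Finset.sum_comm]
  have h2 : ∀ g : Bits M, (∑ b : Bits N, if f g = b ∧ f (g + x) = b then (1 : ℝ) else 0) =
      if x ∈ H then 1 else 0 := by
    intro g
    have hx : f (g + x) = f g ↔ x ∈ H := by rw [hf, add_sub_cancel_left]
    rw [Finset.sum_eq_single (f g)]
    · simp [hx]
    · intro b _ hb
      rw [if_neg fun h => hb h.1.symm]
    · simp
  simp_rw [h2]
  split_ifs <;> simp

lemma subroutineProb_nonneg (f : Bits M → Bits N) (b : Bits N) (ψ : Sp (Bits M)) :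
    0 ≤ subroutineProb f b ψ := sq_nonneg _

lemma sum_subroutineProb {f : Bits M → Bits N} {H : AddSubgroup (Bits M)} (hf : Hides f H) :
    ∑ ω : Bits N × Bits M, subroutineProb f ω.1 (bitCharState ω.2) = 1 := by
  classical
  simpa using sum_subroutineProb_mul_bitChar hf 0

lemma dotProduct_eq_zero_of_subroutineProb_ne_zero {f : Bits M → Bits N}
    {H : AddSubgroup (Bits M)} (hf : Hides f H) {b : Bits N} {p x : Bits M} (hx : x ∈ H)
    (hp : subroutineProb f b (bitCharState p) ≠ 0) : p ⬝ᵥ x = 0 := by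
  classical
  have h := sum_subroutineProb_mul_bitChar hf x
  rw [if_pos hx, ← sum_subroutineProb hf, ← sub_eq_zero, ← Finset.sum_sub_distrib,
    ← neg_eq_zero, ← Finset.sum_neg_distrib] at h
  rw [Finset.sum_eq_zero_iff_of_nonneg] at h
  · by_contra hn
    have h' := h (b, p) (Finset.mem_univ _)
    rw [bitChar_apply, if_neg hn] at h'
    apply hp
    dsimp only at h'
    linarith
  · rintro ⟨b, p⟩ -
    have := subroutineProb_nonneg f b (bitCharState p)
    rw [bitChar_apply]
    split_ifs <;> simp [this]

lemma sum_subroutineProb_orthogonal {f : Bits M → Bits N} {H : AddSubgroup (Bits M)}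
    (hf : Hides f H) {x : Bits M} (hx : x ∉ H) :
    ∑ ω : Bits N × Bits M,
      (if ω.2 ⬝ᵥ x = 0 then subroutineProb f ω.1 (bitCharState ω.2) else 0) = 1 / 2 := by
  classical
  have h := sum_subroutineProb_mul_bitChar hf x
  have h1 := sum_subroutineProb hf
  rw [if_neg hx] at h
  have : ∀ ω : Bits N × Bits M,
      (if ω.2 ⬝ᵥ x = 0 then subroutineProb f ω.1 (bitCharState ω.2) else 0) =
      (subroutineProb f ω.1 (bitCharState ω.2) +
        subroutineProb f ω.1 (bitCharState ω.2) * bitChar ω.2 x) / 2 := by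
    intro ω
    rw [bitChar_apply]
    split_ifs <;> ring
  simp_rw [this]
  rw [← Finset.sum_div, Finset.sum_add_distrib, h, h1]
  norm_num

/-- A union bound over the elements outside `H`: each of them is orthogonal to all of `m`
independent samples with probability `2^(-m)`. -/
lemma one_sub_le_sum_orthogonal_eq {f : Bits M → Bits N} {H : AddSubgroup (Bits M)}
    (hf : Hides f H) (m : ℕ) (Q : (Fin m → Bits N × Bits M) → Prop) [DecidablePred Q]
    (hQ : ∀ ω, (∀ x, x ∈ H ↔ ∀ i, (ω i).2 ⬝ᵥ x = 0) → Q ω) :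
    1 - 2 ^ M / 2 ^ m ≤ ∑ ω : Fin m → Bits N × Bits M,
      if Q ω then ∏ i, subroutineProb f (ω i).1 (bitCharState (ω i).2) else 0 := by
  classical
  set μ : Bits N × Bits M → ℝ := fun ω => subroutineProb f ω.1 (bitCharState ω.2) with hμ
  have hμ0 : ∀ ω, 0 ≤ μ ω := fun ω => subroutineProb_nonneg _ _ _
  have htot : ∑ ω : Fin m → Bits N × Bits M, ∏ i, μ (ω i) = 1 := by
    rw [← Fintype.sum_pow, sum_subroutineProb hf, one_pow]
  have hbad : ∀ x ∉ H, ∑ ω : Fin m → Bits N × Bits M,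
      ∏ i, (if (ω i).2 ⬝ᵥ x = 0 then μ (ω i) else 0) = 1 / 2 ^ m := by
    intro x hx
    rw [← Fintype.sum_pow (fun ω : Bits N × Bits M => if ω.2 ⬝ᵥ x = 0 then μ ω else 0),
      sum_subroutineProb_orthogonal hf hx, div_pow, one_pow]
  have hpt : ∀ ω : Fin m → Bits N × Bits M, ∏ i, μ (ω i) ≤
      (if Q ω then ∏ i, μ (ω i) else 0) + ∑ x : Bits M, if x ∈ H then 0 else
        ∏ i, (if (ω i).2 ⬝ᵥ x = 0 then μ (ω i) else 0) := by
    intro ω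
    have hnn : ∀ x : Bits M, 0 ≤ if x ∈ H then 0 else
        ∏ i, (if (ω i).2 ⬝ᵥ x = 0 then μ (ω i) else 0) := by
      intro x
      split_ifs
      · exact le_rfl
      · exact Finset.prod_nonneg fun i _ => by split_ifs <;> simp [hμ0]
    by_cases hq : Q ω
    · rw [if_pos hq]
      exact le_add_of_nonneg_right (Finset.sum_nonneg fun x _ => hnn x)
    rw [if_neg hq, zero_add]
    by_cases h0 : ∏ i, μ (ω i) = 0
    · rw [h0]
      exact Finset.sum_nonneg fun x _ => hnn x
    have hH : ∀ x ∈ H, ∀ i, (ω i).2 ⬝ᵥ x = 0 := fun x hx i =>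
      dotProduct_eq_zero_of_subroutineProb_ne_zero hf hx
        (Finset.prod_ne_zero_iff.1 h0 i (Finset.mem_univ i))
    obtain ⟨x, hx, hxω⟩ : ∃ x, x ∉ H ∧ ∀ i, (ω i).2 ⬝ᵥ x = 0 := by
      by_contra! hc
      refine hq (hQ ω fun x => ⟨hH x, fun h => ?_⟩)
      by_contra hx
      obtain ⟨i, hi⟩ := hc x hx
      exact hi (h i)
    calc ∏ i, μ (ω i) = if x ∈ H then 0 else
          ∏ i, (if (ω i).2 ⬝ᵥ x = 0 then μ (ω i) else 0) := by simp [hx, hxω]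
      _ ≤ _ := Finset.single_le_sum (f := fun x : Bits M => if x ∈ H then 0 else
          ∏ i, (if (ω i).2 ⬝ᵥ x = 0 then μ (ω i) else 0)) (fun x _ => hnn x) (Finset.mem_univ x)
  have hsum := Finset.sum_le_sum fun ω (_ : ω ∈ Finset.univ) => hpt ω
  rw [htot, Finset.sum_add_distrib, Finset.sum_comm] at hsum
  have hle : ∑ x : Bits M, ∑ ω : Fin m → Bits N × Bits M, (if x ∈ H then 0 else
      ∏ i, (if (ω i).2 ⬝ᵥ x = 0 then μ (ω i) else 0)) ≤ ∑ x : Bits M, (1 / 2 ^ m : ℝ) := by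
    refine Finset.sum_le_sum fun x _ => ?_
    by_cases hx : x ∈ H
    · simp [hx]
    · simp only [if_neg hx]
      exact (hbad x hx).le
  have hconst : ∑ x : Bits M, (1 / 2 ^ m : ℝ) = 2 ^ M / 2 ^ m := by
    simp [div_eq_mul_inv]
  linarith

end Samples

/-! ### Verified stack programs -/

section Exec

variable {O : List Bool → List Bool}

/-- The program `p` started in `σ` stops in `τ` after at most `T` steps. -/
def Exec (O : List Bool → List Bool) (p : Prog) (σ : ℕ → List Bool) (T : ℕ)
    (τ : ℕ → List Bool) : Prop :=
  ∃ t ≤ T, Run O p σ t τ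

lemma Exec.of_le {p : Prog} {σ τ : ℕ → List Bool} {T T' : ℕ} (h : Exec O p σ T τ) (hT : T ≤ T') :
    Exec O p σ T' τ :=
  let ⟨t, ht, hr⟩ := h
  ⟨t, ht.trans hT, hr⟩

lemma Exec.congr {p : Prog} {σ σ' τ τ' : ℕ → List Bool} {T T' : ℕ} (h : Exec O p σ T τ)
    (hσ : σ = σ') (hT : T ≤ T') (hτ : τ = τ') : Exec O p σ' T' τ' := by
  subst hσ hτ
  exact h.of_le hT

lemma Exec.skip {σ : ℕ → List Bool} : Exec O .skip σ 1 σ := ⟨1, le_rfl, .skip σ⟩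

lemma Exec.push {σ : ℕ → List Bool} {r : ℕ} {b : Bool} :
    Exec O (.push r b) σ 1 (Function.update σ r (b :: σ r)) := ⟨1, le_rfl, .push σ r b⟩

lemma Exec.pop {σ : ℕ → List Bool} {r : ℕ} :
    Exec O (.pop r) σ 1 (Function.update σ r (σ r).tail) := ⟨1, le_rfl, .pop σ r⟩

lemma Exec.seq {p q : Prog} {σ τ υ : ℕ → List Bool} {T₁ T₂ : ℕ} (hp : Exec O p σ T₁ τ)
    (hq : Exec O q τ T₂ υ) : Exec O (.seq p q) σ (T₁ + T₂) υ :=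
  let ⟨_, h₁, r₁⟩ := hp
  let ⟨_, h₂, r₂⟩ := hq
  ⟨_, add_le_add h₁ h₂, .seq r₁ r₂⟩

lemma Exec.branchEmpty {p p₀ p₁ : Prog} {σ τ : ℕ → List Bool} {r T : ℕ} (h : σ r = [])
    (hp : Exec O p σ T τ) : Exec O (.branch r p p₀ p₁) σ (T + 1) τ :=
  let ⟨t, ht, hr⟩ := hp
  ⟨1 + t, by omega, .branchEmpty h hr⟩

lemma Exec.branchCons {p p₀ p₁ : Prog} {σ τ : ℕ → List Bool} {r T : ℕ} {b : Bool} {l : List Bool}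
    (h : σ r = b :: l) (hp : Exec O (bif b then p₁ else p₀) σ T τ) :
    Exec O (.branch r p p₀ p₁) σ (T + 1) τ := by
  obtain ⟨t, ht, hr⟩ := hp
  cases b
  · exact ⟨1 + t, by omega, .branchFalse h hr⟩
  · exact ⟨1 + t, by omega, .branchTrue h hr⟩

lemma Exec.loopDone {p : Prog} {σ : ℕ → List Bool} {r : ℕ} (h : σ r = []) :
    Exec O (.loop r p) σ 1 σ := ⟨1, le_rfl, .loopDone h⟩

lemma Exec.loopStep {p : Prog} {σ τ υ : ℕ → List Bool} {r T₁ T₂ : ℕ} (h : σ r ≠ [])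
    (hp : Exec O p σ T₁ τ) (hl : Exec O (.loop r p) τ T₂ υ) :
    Exec O (.loop r p) σ (1 + T₁ + T₂) υ :=
  let ⟨_, h₁, r₁⟩ := hp
  let ⟨_, h₂, r₂⟩ := hl
  ⟨_, by omega, .loopStep h r₁ r₂⟩

/-- The store with the given contents of the first registers, the others being empty. -/
def st (L : List (List Bool)) : ℕ → List Bool := fun r => L.getD r []

@[simp] lemma st_apply (L : List (List Bool)) (r : ℕ) : st L r = L.getD r [] := rfl

@[simp] lemma update_st {L : List (List Bool)} {r : ℕ} (h : r < L.length) (v : List Bool) :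
    Function.update (st L) r v = st (L.set r v) := by
  funext s
  by_cases hs : s = r
  · subst hs
    simp [h, List.getD_eq_getElem?_getD]
  · simp [Function.update_of_ne hs, List.getD_eq_getElem?_getD, Ne.symm hs]

/-- The effect of a loop-free program on the store `st L`. -/
def straightEval : Prog → List (List Bool) → List (List Bool)
  | .push r b, L => L.set r (b :: L.getD r [])
  | .pop r, L => L.set r (L.getD r []).tail
  | .seq p q, L => straightEval q (straightEval p L)
  | .branch r p p₀ p₁, L =>
    match L.getD r [] with
    | [] => straightEval p L
    | false :: _ => straightEval p₀ L
    | true :: _ => straightEval p₁ L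
  | _, L => L

/-- A bound for the running time of a loop-free program. -/
def straightCost : Prog → ℕ
  | .seq p q => straightCost p + straightCost q
  | .branch _ p p₀ p₁ => max (straightCost p) (max (straightCost p₀) (straightCost p₁)) + 1
  | _ => 1

/-- The program has no loops and no queries, and uses only the registers below `k`. -/
def isStraight (k : ℕ) : Prog → Bool
  | .skip => true
  | .push r _ => r < k
  | .pop r => r < k
  | .seq p q => isStraight k p && isStraight k q
  | .branch r p p₀ p₁ => r < k && isStraight k p && isStraight k p₀ && isStraight k p₁
  | _ => false

lemma exec_straight {p : Prog} {L : List (List Bool)} {k : ℕ} (hp : isStraight k p = true)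
    (hL : L.length = k) : Exec O p (st L) (straightCost p) (st (straightEval p L)) ∧
      (straightEval p L).length = k := by
  induction p generalizing L with
  | skip => exact ⟨Exec.skip, hL⟩
  | push r b =>
    have hr : r < L.length := by simpa [isStraight, hL] using hp
    exact ⟨Exec.push.congr rfl le_rfl (by simp [hr, straightEval]), by simp [straightEval, hL]⟩
  | pop r =>
    have hr : r < L.length := by simpa [isStraight, hL] using hp
    exact ⟨Exec.pop.congr rfl le_rfl (by simp [hr, straightEval]), by simp [straightEval, hL]⟩
  | query r s => simp [isStraight] at hp
  | loop r p => simp [isStraight] at hp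
  | seq p q ihp ihq =>
    simp only [isStraight, Bool.and_eq_true] at hp
    have h1 := ihp hp.1 hL
    have h2 := ihq hp.2 h1.2
    exact ⟨h1.1.seq h2.1, h2.2⟩
  | branch r p p₀ p₁ ih ih₀ ih₁ =>
    simp only [isStraight, Bool.and_eq_true] at hp
    have h := ih hp.1.1.2 hL
    have h₀ := ih₀ hp.1.2 hL
    have h₁ := ih₁ hp.2 hL
    simp only [straightEval, straightCost]
    split <;> rename_i hr
    · exact ⟨(Exec.branchEmpty (by simpa using hr) h.1).of_le (by omega), h.2⟩
    · exact ⟨(Exec.branchCons (b := false) (by simpa using hr) h₀.1).of_le (by omega), h₀.2⟩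
    · exact ⟨(Exec.branchCons (b := true) (by simpa using hr) h₁.1).of_le (by omega), h₁.2⟩

/-- Move register `r` onto register `s`, reversing it. -/
def mv (r s : ℕ) : Prog :=
  .loop r (.branch r .skip (.seq (.pop r) (.push s false)) (.seq (.pop r) (.push s true)))

lemma exec_mv {r s : ℕ} (h : r ≠ s) (σ : ℕ → List Bool) :
    Exec O (mv r s) σ (4 * (σ r).length + 1)
      (Function.update (Function.update σ r []) s ((σ r).reverse ++ σ s)) := by
  generalize hl : σ r = l
  induction l generalizing σ with
  | nil =>
    refine (Exec.loopDone hl).congr rfl (by simp) ?_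
    funext x
    by_cases hx : x = s
    · subst hx; simp
    · by_cases hx' : x = r
      · subst hx'; simp [hl, hx]
      · simp [hx, hx']
  | cons b l ih =>
    have h1 := ih (Function.update (Function.update σ r l) s (b :: σ s)) (by simp [h])
    refine (Exec.loopStep (by simp [hl]) (Exec.branchCons hl (T := 2)
      (τ := Function.update (Function.update σ r l) s (b :: σ s)) ?_) h1).congr rfl
      (by simp; omega) ?_
    · cases b
      · exact (Exec.seq Exec.pop Exec.push).congr rfl le_rfl (by simp [hl, h.symm])
      · exact (Exec.seq Exec.pop Exec.push).congr rfl le_rfl (by simp [hl, h.symm])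
    · funext x
      by_cases hx : x = s
      · subst hx; simp
      · by_cases hx' : x = r
        · subst hx'; simp [h]
        · simp [hx, hx']

/-- Empty register `r`. -/
def clear (r : ℕ) : Prog := .loop r (.pop r)

lemma exec_clear {r : ℕ} (σ : ℕ → List Bool) :
    Exec O (clear r) σ (2 * (σ r).length + 1) (Function.update σ r []) := by
  generalize hl : σ r = l
  induction l generalizing σ with
  | nil =>
    refine (Exec.loopDone hl).congr rfl (by simp) ?_
    rw [← hl, Function.update_eq_self]
  | cons b l ih =>
    exact (Exec.loopStep (by simp [hl]) Exec.pop (ih (Function.update σ r (σ r).tail)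
      (by simp [hl]))).congr rfl (by simp; omega) (by simp)

/-- Run the programs of a list in order. -/
def block : List Prog → Prog
  | [] => .skip
  | [p] => p
  | p :: q :: l => .seq p (block (q :: l))

lemma Exec.block_single {p : Prog} {σ τ : ℕ → List Bool} {T : ℕ} (hp : Exec O p σ T τ) :
    Exec O (block [p]) σ T τ := hp

lemma Exec.block_cons {p q : Prog} {l : List Prog} {σ τ υ : ℕ → List Bool} {T₁ T₂ : ℕ}
    (hp : Exec O p σ T₁ τ) (hq : Exec O (block (q :: l)) τ T₂ υ) :
    Exec O (block (p :: q :: l)) σ (T₁ + T₂) υ := hp.seq hq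

/-- The flag with value `b`: a register that is nonempty exactly when `b` is true. -/
def flag (b : Bool) : List Bool := bif b then [true] else []

end Exec

/-! ### Elimination over `ℤ₂` on stacks -/

section Elimination

variable {O : List Bool → List Bool}

/-- The inner product of two bit vectors. -/
def ldot : List Bool → List Bool → Bool
  | a :: p, b :: w => (a && b) ^^ ldot p w
  | _, _ => false

/-- Registers: `2` a sample, `3` its processed part, `4` the processed part of a vector, `6` the
parity, `7` the vector followed by further data. -/
def dotProg : Prog :=
  .loop 2 (.branch 2 .skip
    (block [.pop 2, .push 3 false, .branch 7 .skip (.seq (.pop 7) (.push 4 false))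
      (.seq (.pop 7) (.push 4 true))])
    (block [.pop 2, .push 3 true, .branch 7 .skip (.seq (.pop 7) (.push 4 false))
      (block [.pop 7, .push 4 true, .branch 6 (.push 6 true) (.pop 6) (.pop 6)])]))

lemma exec_dotProg (N S V B B' C : List Bool) (p w T W : List Bool) (d : Bool)
    (h : p.length = w.length) :
    Exec O dotProg (st [N, S, p, T, W, V, flag d, w ++ B, B', C]) (9 * p.length + 1)
      (st [N, S, [], p.reverse ++ T, w.reverse ++ W, V, flag (d ^^ ldot p w), B, B', C]) := by
  induction p generalizing w T W d with
  | nil =>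
    obtain rfl : w = [] := by simpa using h.symm
    exact (Exec.loopDone (by simp)).congr rfl (by simp) (by simp [ldot])
  | cons a p ih =>
    obtain _ | ⟨b, w⟩ := w
    · simp at h
    have h' : p.length = w.length := by simpa using h
    refine (Exec.loopStep (by simp) ((exec_straight (k := 10) rfl rfl).1.congr rfl
      (τ' := st [N, S, p, a :: T, b :: W, V, flag (d ^^ (a && b)), w ++ B, B', C]) le_rfl ?_)
      (ih w (a :: T) (b :: W) (d ^^ (a && b)) h')).congr rfl ?_ (by simp [ldot])
    · cases a <;> cases b <;> cases d <;> rfl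
    · simp [straightCost, block]
      omega

/-- The sum of two bit vectors. -/
def lxor : List Bool → List Bool → List Bool := List.zipWith xor

/-- Registers: `4` a vector and `5` the pivot, both reversed, `8` the output; `3` collects the
pivot. -/
def xorProg : Prog :=
  block [.loop 4 (.branch 4 .skip
      (.branch 5 .skip
        (block [.pop 4, .pop 5, .push 3 false, .push 8 false])
        (block [.pop 4, .pop 5, .push 3 true, .push 8 true]))
      (.branch 5 .skip
        (block [.pop 4, .pop 5, .push 3 false, .push 8 true])
        (block [.pop 4, .pop 5, .push 3 true, .push 8 false]))),
    mv 3 5]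

lemma exec_xorLoop (N S P D B C w v T B' : List Bool) (h : w.length = v.length) :
    Exec O (.loop 4 (.branch 4 .skip
      (.branch 5 .skip
        (block [.pop 4, .pop 5, .push 3 false, .push 8 false])
        (block [.pop 4, .pop 5, .push 3 true, .push 8 true]))
      (.branch 5 .skip
        (block [.pop 4, .pop 5, .push 3 false, .push 8 true])
        (block [.pop 4, .pop 5, .push 3 true, .push 8 false]))))
      (st [N, S, P, T, w, v, D, B, B', C]) (7 * w.length + 1)
      (st [N, S, P, v.reverse ++ T, [], [], D, B, (lxor w v).reverse ++ B', C]) := by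
  induction w generalizing v T B' with
  | nil =>
    obtain rfl : v = [] := by simpa using h.symm
    exact (Exec.loopDone (by simp)).congr rfl (by simp) (by simp [lxor])
  | cons a w ih =>
    obtain _ | ⟨b, v⟩ := v
    · simp at h
    refine (Exec.loopStep (by simp) ((exec_straight (k := 10) rfl rfl).1.congr rfl
      (τ' := st [N, S, P, b :: T, w, v, D, B, (a ^^ b) :: B', C]) le_rfl ?_)
      (ih v (b :: T) ((a ^^ b) :: B') (by simpa using h))).congr rfl ?_ (by simp [lxor])
    · cases a <;> cases b <;> rfl
    · simp [straightCost, block]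
      omega

lemma lxor_reverse (w v : List Bool) (h : w.length = v.length) :
    (lxor w.reverse v.reverse).reverse = lxor w v := by
  unfold lxor
  rw [List.reverse_zipWith (by simpa using h), List.reverse_reverse, List.reverse_reverse]

lemma exec_xorProg (N S P D B C w v B' : List Bool) (h : w.length = v.length) :
    Exec O xorProg (st [N, S, P, [], w.reverse, v.reverse, D, B, B', C]) (11 * w.length + 2)
      (st [N, S, P, [], [], v.reverse, D, B, lxor w v ++ B', C]) := by
  refine (Exec.block_cons (exec_xorLoop N S P D B C w.reverse v.reverse [] B' (by simpa using h))
    (Exec.block_single (exec_mv (r := 3) (s := 5) (by decide) _))).congr rfl ?_ ?_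
  · simp [h]
    omega
  · simp [lxor_reverse w v h]

/-- Process one vector of register `7` against the sample in register `2`. -/
def vecProg : Prog :=
  .seq (block [dotProg, mv 3 2]) (.branch 6 (mv 4 8) .skip
    (.seq (.pop 6) (.branch 5 (block [mv 4 3, mv 3 5]) xorProg xorProg)))

/-- One step of the elimination for the sample `p`: vectors orthogonal to `p` are kept, the first
other one becomes the pivot, which is added to the remaining ones. -/
def elimStep {n : ℕ} (p : Bits n) (s : Option (Bits n) × List (Bits n)) (w : Bits n) :
    Option (Bits n) × List (Bits n) :=
  if p ⬝ᵥ w = 0 then (s.1, w :: s.2) else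
    match s.1 with
    | none => (some w, s.2)
    | some v => (some v, (w + v) :: s.2)

/-- The contents of the pivot register. -/
def pivotStr {n : ℕ} : Option (Bits n) → List Bool
  | none => []
  | some v => (toStr v).reverse

@[simp] lemma length_toStr {n : ℕ} (x : Bits n) : (toStr x).length = n := by simp [toStr]

lemma toStr_succ {n : ℕ} (x : Bits (n + 1)) :
    toStr x = decide (x 0 = 1) :: toStr (fun i => x i.succ) := by
  simp [toStr, List.ofFn_succ]

lemma ldot_toStr {n : ℕ} (p w : Bits n) : ldot (toStr p) (toStr w) = decide (p ⬝ᵥ w = 1) := by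
  induction n with
  | zero => simp [toStr, ldot]
  | succ n ih =>
    have hs : p ⬝ᵥ w = p 0 * w 0 + (fun i : Fin n => p i.succ) ⬝ᵥ (fun i => w i.succ) :=
      Fin.sum_univ_succ _
    rw [toStr_succ, toStr_succ, ldot, ih, hs]
    rcases zmod_two_eq_zero_or_one (p 0) with h1 | h1 <;>
    rcases zmod_two_eq_zero_or_one (w 0) with h2 | h2 <;>
    rcases zmod_two_eq_zero_or_one ((fun i : Fin n => p i.succ) ⬝ᵥ (fun i => w i.succ)) with h3 | h3 <;>
    rw [h1, h2, h3] <;> decide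

lemma lxor_toStr {n : ℕ} (w v : Bits n) : lxor (toStr w) (toStr v) = toStr (w + v) := by
  induction n with
  | zero => simp [toStr, lxor]
  | succ n ih =>
    rw [toStr_succ, toStr_succ, toStr_succ, lxor, List.zipWith_cons_cons]
    congr 1
    · rw [Pi.add_apply]
      rcases zmod_two_eq_zero_or_one (w 0) with h1 | h1 <;>
      rcases zmod_two_eq_zero_or_one (v 0) with h2 | h2 <;>
      rw [h1, h2] <;> decide
    · exact ih _ _

lemma exec_vecProg {n : ℕ} (hn : 0 < n) (p w : Bits n) (N S B C : List Bool)
    (s : Option (Bits n) × List (Bits n)) :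
    Exec O vecProg (st [N, S, toStr p, [], [], pivotStr s.1, [], toStr w ++ B,
        s.2.flatMap toStr, C]) (30 * n + 10)
      (st [N, S, toStr p, [], [], pivotStr (elimStep p s w).1, [], B,
        (elimStep p s w).2.flatMap toStr, C]) := by
  have hdot : Exec O (block [dotProg, mv 3 2]) (st [N, S, toStr p, [], [], pivotStr s.1, [],
      toStr w ++ B, s.2.flatMap toStr, C]) (13 * n + 2) (st [N, S, toStr p, [],
      (toStr w).reverse, pivotStr s.1, flag (decide (p ⬝ᵥ w = 1)), B, s.2.flatMap toStr, C]) := by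
    refine (Exec.block_cons (exec_dotProg N S (pivotStr s.1) B (s.2.flatMap toStr) C (toStr p)
      (toStr w) [] [] false (by simp)) (Exec.block_single (exec_mv (r := 3) (s := 2)
        (by decide) _))).congr rfl ?_ ?_
    · simp
      omega
    · simp [ldot_toStr]
  obtain ⟨V, acc⟩ := s
  rcases zmod_two_eq_zero_or_one (p ⬝ᵥ w) with h0 | h1
  · simp only [h0, zero_ne_one, decide_false] at hdot
    refine (hdot.seq (Exec.branchEmpty (by simp [flag])
      (exec_mv (r := 4) (s := 8) (by decide) _))).congr rfl ?_ ?_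
    · simp
      omega
    · simp [elimStep, h0, flag]
  · simp only [h1, decide_true] at hdot
    cases V with
    | none =>
      refine (hdot.seq (Exec.branchCons (b := true) (l := []) (by simp [flag]) (T := 8 * n + 10)
        (Exec.seq Exec.pop (Exec.branchEmpty (T := 8 * n + 2)
          (τ := st [N, S, toStr p, [], [], (toStr w).reverse, [], B, acc.flatMap toStr, C])
          (by simp [pivotStr]) ?_) |>.of_le (by omega)))).congr rfl (by omega) ?_
      · refine (Exec.block_cons (exec_mv (r := 4) (s := 3) (by decide) _)
          (Exec.block_single (exec_mv (r := 3) (s := 5) (by decide) _))).congr rfl ?_ ?_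
        · simp
          omega
        · simp [pivotStr, flag]
      · simp [elimStep, h1, pivotStr]
    | some v =>
      obtain ⟨b, l, hbl⟩ : ∃ b l, (toStr v).reverse = b :: l := by
        cases h : (toStr v).reverse with
        | nil => simp [← List.length_eq_zero_iff, hn.ne'] at h
        | cons b l => exact ⟨b, l, rfl⟩
      refine (hdot.seq (Exec.branchCons (b := true) (l := []) (by simp [flag]) (T := 11 * n + 10)
        (Exec.seq Exec.pop (Exec.branchCons (T := 11 * n + 2) (b := b) (l := l)
          (τ := st [N, S, toStr p, [], [], (toStr v).reverse, [], B,
            toStr (w + v) ++ acc.flatMap toStr, C])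
          (by simp [pivotStr, hbl]) ?_) |>.of_le (by omega)))).congr rfl (by omega) ?_
      · rw [Bool.cond_self]
        exact (exec_xorProg N S (toStr p) [] B C (toStr w) (toStr v) (acc.flatMap toStr)
          (by simp)).congr (by simp [pivotStr, flag]) (by simp) (by rw [lxor_toStr])
      · simp [elimStep, h1, pivotStr]

end Elimination

section Elimination

variable {O : List Bool → List Bool}

/-- The generators that the elimination keeps for the sample `p`. -/
def eliminate {n : ℕ} (p : Bits n) (L : List (Bits n)) : List (Bits n) :=
  (L.foldl (elimStep p) (none, [])).2

lemma length_foldl_elimStep_le {n : ℕ} (p : Bits n) (L : List (Bits n))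
    (s : Option (Bits n) × List (Bits n)) :
    (L.foldl (elimStep p) s).2.length ≤ s.2.length + L.length := by
  induction L generalizing s with
  | nil => simp
  | cons w L ih =>
    refine (ih (elimStep p s w)).trans ?_
    have : (elimStep p s w).2.length ≤ s.2.length + 1 := by
      unfold elimStep
      split_ifs
      · simp
      · split <;> simp
    simp only [List.length_cons]
    omega

lemma length_eliminate_le {n : ℕ} (p : Bits n) (L : List (Bits n)) :
    (eliminate p L).length ≤ L.length := by
  simpa [eliminate] using length_foldl_elimStep_le p L (none, [])

lemma exec_vecLoop {n : ℕ} (hn : 0 < n) (p : Bits n) (L : List (Bits n)) (N S C : List Bool)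
    (s : Option (Bits n) × List (Bits n)) :
    Exec O (.loop 7 vecProg) (st [N, S, toStr p, [], [], pivotStr s.1, [], L.flatMap toStr,
        s.2.flatMap toStr, C]) (L.length * (30 * n + 11) + 1)
      (st [N, S, toStr p, [], [], pivotStr (L.foldl (elimStep p) s).1, [], [],
        (L.foldl (elimStep p) s).2.flatMap toStr, C]) := by
  induction L generalizing s with
  | nil => exact (Exec.loopDone (by simp)).congr rfl (by simp) (by simp)
  | cons w L ih =>
    refine (Exec.loopStep ?_ (exec_vecProg hn p w N S (L.flatMap toStr) C s)
      (ih (elimStep p s w))).congr (by simp) ?_ (by simp)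
    · simp [← List.length_eq_zero_iff, hn.ne']
    · rw [List.length_cons, Nat.succ_mul L.length]
      omega

/-- Read one sample from register `1` into register `2`, missing bits counting as `0`. -/
def loadProg : Prog :=
  block [.loop 0 (block [.pop 0, .push 3 true,
    .branch 1 (.push 4 false) (.seq (.pop 1) (.push 4 false)) (.seq (.pop 1) (.push 4 true))]),
    mv 3 0, mv 4 2]

/-- The vector of the first `n` bits of a string, missing bits counting as `0`. -/
def takeBits (n : ℕ) (S : List Bool) : Bits n := fun i => if S.getD i false then 1 else 0

lemma takeBits_succ (n : ℕ) (S : List Bool) :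
    toStr (takeBits (n + 1) S) = S.headD false :: toStr (takeBits n S.tail) := by
  rw [toStr_succ]
  congr 1
  · cases S with
    | nil => simp [takeBits]
    | cons a S => cases a <;> simp [takeBits]
  · congr 1
    funext i
    cases S <;> simp [takeBits]

lemma exec_loadLoop (n : ℕ) (S T W V B B' C : List Bool) :
    Exec O (.loop 0 (block [.pop 0, .push 3 true,
      .branch 1 (.push 4 false) (.seq (.pop 1) (.push 4 false)) (.seq (.pop 1) (.push 4 true))]))
      (st [List.replicate n true, S, [], T, W, V, [], B, B', C]) (6 * n + 1)
      (st [[], S.drop n, [], List.replicate n true ++ T, (toStr (takeBits n S)).reverse ++ W, V,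
        [], B, B', C]) := by
  induction n generalizing S T W with
  | zero => exact (Exec.loopDone (by simp)).congr rfl (by simp) (by simp [toStr])
  | succ n ih =>
    refine (Exec.loopStep (by simp) ((exec_straight (k := 10) rfl rfl).1.congr rfl
      (τ' := st [List.replicate n true, S.tail, [], true :: T, S.headD false :: W, V, [], B, B', C])
      le_rfl ?_) (ih S.tail (true :: T) (S.headD false :: W))).congr rfl ?_ ?_
    · rw [List.replicate_succ]
      cases S with
      | nil => rfl
      | cons a S => cases a <;> rfl
    · simp [straightCost, block]
      omega
    · rw [takeBits_succ, List.drop_tail, List.replicate_succ']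
      simp

lemma exec_loadProg (n : ℕ) (S V B C : List Bool) :
    Exec O loadProg (st [List.replicate n true, S, [], [], [], V, [], B, [], C]) (14 * n + 3)
      (st [List.replicate n true, S.drop n, toStr (takeBits n S), [], [], V, [], B, [], C]) := by
  refine (Exec.block_cons (exec_loadLoop n S [] [] V B [] C)
    (Exec.block_cons (exec_mv (r := 3) (s := 0) (by decide) _)
      (Exec.block_single (exec_mv (r := 4) (s := 2) (by decide) _)))).congr rfl ?_ ?_
  · simp
    omega
  · simp

/-- Process one sample. -/
def sampleProg : Prog :=
  block [loadProg, .loop 7 vecProg, clear 5, clear 2, mv 8 3, mv 3 7]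

lemma length_flatMap_toStr {n : ℕ} (L : List (Bits n)) :
    (L.flatMap toStr).length = L.length * n := by
  simp [List.length_flatMap]

lemma length_pivotStr_le {n : ℕ} (V : Option (Bits n)) : (pivotStr V).length ≤ n := by
  cases V <;> simp [pivotStr]

lemma exec_sampleProg {n : ℕ} (L : List (Bits n)) (hL : L.length ≤ n) (S C : List Bool) :
    Exec O sampleProg
      (st [List.replicate n true, S, [], [], [], [], [], L.flatMap toStr, [], C])
      (38 * n * n + 29 * n + 8)
      (st [List.replicate n true, S.drop n, [], [], [], [], [],
        (eliminate (takeBits n S) L).flatMap toStr, [], C]) := by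
  have hloop : Exec O (.loop 7 vecProg) (st [List.replicate n true, S.drop n,
      toStr (takeBits n S), [], [], [], [], L.flatMap toStr, [], C]) (n * (30 * n + 11) + 1)
      (st [List.replicate n true, S.drop n, toStr (takeBits n S), [], [],
        pivotStr (L.foldl (elimStep (takeBits n S)) (none, [])).1, [], [],
        (eliminate (takeBits n S) L).flatMap toStr, C]) := by
    rcases Nat.eq_zero_or_pos n with h0 | hn
    · subst h0
      obtain rfl : L = [] := by simpa using hL
      exact (Exec.loopDone (by simp)).congr rfl (by simp) (by simp [eliminate, pivotStr])
    · exact (exec_vecLoop hn (takeBits n S) L _ (S.drop n) C (none, [])).congr rfl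
        (by gcongr) rfl
  refine (Exec.block_cons (exec_loadProg n S [] (L.flatMap toStr) C)
    (Exec.block_cons hloop (Exec.block_cons (exec_clear _) (Exec.block_cons (exec_clear _)
      (Exec.block_cons (exec_mv (r := 8) (s := 3) (by decide) _)
        (Exec.block_single (exec_mv (r := 3) (s := 7) (by decide) _))))))).congr rfl ?_ ?_
  · have h1 := length_pivotStr_le (L.foldl (elimStep (takeBits n S)) (none, [])).1
    have h2 : ((eliminate (takeBits n S) L).flatMap toStr).length ≤ n * n := by
      rw [length_flatMap_toStr]
      exact Nat.mul_le_mul_right _ ((length_eliminate_le _ _).trans hL)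
    generalize hl : (eliminate (takeBits n S) L).flatMap toStr = l at h2 ⊢
    simp
    nlinarith
  · simp

/-- The result of processing the first `c` samples of a string. -/
def eliminateAll {n : ℕ} : ℕ → List Bool → List (Bits n) → List (Bits n)
  | 0, _, L => L
  | c + 1, S, L => eliminateAll c (S.drop n) (eliminate (takeBits n S) L)

lemma length_eliminateAll_le {n : ℕ} (c : ℕ) (S : List Bool) (L : List (Bits n)) :
    (eliminateAll c S L).length ≤ L.length := by
  induction c generalizing S L with
  | zero => exact le_rfl
  | succ c ih => exact (ih _ _).trans (length_eliminate_le _ _)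

lemma exec_sampleLoop {n : ℕ} (c : ℕ) (L : List (Bits n)) (hL : L.length ≤ n) (S : List Bool) :
    Exec O (.loop 9 (.seq (.pop 9) sampleProg)) (st [List.replicate n true, S, [], [], [], [], [],
        L.flatMap toStr, [], List.replicate c true]) (c * (38 * n * n + 29 * n + 10) + 1)
      (st [List.replicate n true, S.drop (c * n), [], [], [], [], [],
        (eliminateAll c S L).flatMap toStr, [], []]) := by
  induction c generalizing S L with
  | zero => exact (Exec.loopDone (by simp)).congr rfl (by simp) (by simp [eliminateAll])
  | succ c ih =>
    refine (Exec.loopStep (by simp) (Exec.seq Exec.pop ((exec_sampleProg L hL S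
      (List.replicate c true)).congr (by simp [List.replicate_succ]) le_rfl rfl))
      (ih (eliminate (takeBits n S) L) ((length_eliminate_le _ _).trans hL) (S.drop n))).congr
      rfl ?_ ?_
    · rw [Nat.succ_mul c]
      omega
    · rw [List.drop_drop, Nat.succ_mul, Nat.add_comm]
      rfl

/-- Push as many zeros onto register `7` as there are entries in register `r`. -/
def zerosProg (r : ℕ) : Prog :=
  .seq (.loop r (block [.pop r, .push 3 true, .push 7 false])) (mv 3 r)

lemma exec_zerosProg_two (a : ℕ) (N S W B C : List Bool) :
    Exec O (zerosProg 2) (st [N, S, List.replicate a true, [], W, [], [], B, [], C]) (8 * a + 2)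
      (st [N, S, List.replicate a true, [], W, [], [], List.replicate a false ++ B, [], C]) := by
  have h : ∀ T B, Exec O (.loop 2 (block [.pop 2, .push 3 true, .push 7 false]))
      (st [N, S, List.replicate a true, T, W, [], [], B, [], C]) (4 * a + 1)
      (st [N, S, [], List.replicate a true ++ T, W, [], [], List.replicate a false ++ B, [],
        C]) := by
    induction a with
    | zero => exact fun T B => (Exec.loopDone (by simp)).congr rfl (by simp) (by simp)
    | succ a ih =>
      intro T B
      refine (Exec.loopStep (by simp) ((exec_straight (k := 10) rfl rfl).1.congr rfl
        (τ' := st [N, S, List.replicate a true, true :: T, W, [], [], false :: B, [], C])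
        le_rfl rfl) (ih (true :: T) (false :: B))).congr rfl ?_ ?_
      · simp [straightCost, block]
        omega
      · simp [List.replicate_succ']
  refine (Exec.seq (h [] B) (exec_mv (r := 3) (s := 2) (by decide) _)).congr rfl ?_ ?_
  · simp
    omega
  · simp

lemma exec_zerosProg_four (a : ℕ) (N S P B C : List Bool) :
    Exec O (zerosProg 4) (st [N, S, P, [], List.replicate a true, [], [], B, [], C]) (8 * a + 2)
      (st [N, S, P, [], List.replicate a true, [], [], List.replicate a false ++ B, [], C]) := by
  have h : ∀ T B, Exec O (.loop 4 (block [.pop 4, .push 3 true, .push 7 false]))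
      (st [N, S, P, T, List.replicate a true, [], [], B, [], C]) (4 * a + 1)
      (st [N, S, P, List.replicate a true ++ T, [], [], [], List.replicate a false ++ B, [],
        C]) := by
    induction a with
    | zero => exact fun T B => (Exec.loopDone (by simp)).congr rfl (by simp) (by simp)
    | succ a ih =>
      intro T B
      refine (Exec.loopStep (by simp) ((exec_straight (k := 10) rfl rfl).1.congr rfl
        (τ' := st [N, S, P, true :: T, List.replicate a true, [], [], false :: B, [], C])
        le_rfl rfl) (ih (true :: T) (false :: B))).congr rfl ?_ ?_
      · simp [straightCost, block]
        omega
      · simp [List.replicate_succ']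
  refine (Exec.seq (h [] B) (exec_mv (r := 3) (s := 4) (by decide) _)).congr rfl ?_ ?_
  · simp
    omega
  · simp

/-- The standard basis vector with index `i`. -/
def basisBits (n i : ℕ) : Bits n := fun j => if (j : ℕ) = i then 1 else 0

lemma toStr_basisBits {n a z : ℕ} (h : a + 1 + z = n) :
    toStr (basisBits n a) = List.replicate a false ++ true :: List.replicate z false := by
  refine List.ext_getElem (by simp; omega) fun i h1 h2 => ?_
  simp only [toStr, basisBits, List.getElem_ofFn]
  rcases lt_trichotomy i a with hi | hi | hi
  · rw [List.getElem_append_left (by simpa using hi)]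
    simp [hi.ne]
  · subst hi
    simp
  · rw [List.getElem_append_right (by simpa using hi.le)]
    rw [List.getElem_cons]
    simp [hi.ne', Nat.sub_eq_zero_iff_le, hi]

/-- The standard basis. -/
def stdBasis (n : ℕ) : List (Bits n) := (List.range n).map (basisBits n)

/-- Write the standard basis into register `7`. -/
def basisProg : Prog :=
  .seq (block [.loop 0 (block [.pop 0, .push 3 true, .push 2 true]), mv 3 0])
    (block [.loop 2 (block [.pop 2, zerosProg 4, .push 7 true, zerosProg 2, .push 4 true]),
      clear 4])

lemma exec_copyLoop (n : ℕ) (S P T C : List Bool) :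
    Exec O (.loop 0 (block [.pop 0, .push 3 true, .push 2 true]))
      (st [List.replicate n true, S, P, T, [], [], [], [], [], C]) (4 * n + 1)
      (st [[], S, List.replicate n true ++ P, List.replicate n true ++ T, [], [], [], [], [],
        C]) := by
  induction n generalizing P T with
  | zero => exact (Exec.loopDone (by simp)).congr rfl (by simp) (by simp)
  | succ n ih =>
    refine (Exec.loopStep (by simp) ((exec_straight (k := 10) rfl rfl).1.congr rfl
      (τ' := st [List.replicate n true, S, true :: P, true :: T, [], [], [], [], [], C])
      le_rfl rfl) (ih (true :: P) (true :: T))).congr rfl ?_ ?_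
    · simp [straightCost, block]
      omega
    · simp [List.replicate_succ']

lemma exec_basisLoop {n : ℕ} (a z : ℕ) (h : a + z = n) (L : List (Bits n)) (N S C : List Bool) :
    Exec O (.loop 2 (block [.pop 2, zerosProg 4, .push 7 true, zerosProg 2, .push 4 true]))
      (st [N, S, List.replicate a true, [], List.replicate z true, [], [], L.flatMap toStr, [], C])
      (a * (8 * n + 8) + 1)
      (st [N, S, [], [], List.replicate n true, [], [],
        ((List.range a).map (basisBits n) ++ L).flatMap toStr, [], C]) := by
  induction a generalizing z L with
  | zero =>
    obtain rfl : z = n := by omega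
    exact (Exec.loopDone (by simp)).congr rfl (by simp) (by simp)
  | succ a ih =>
    have hbody : Exec O (block [.pop 2, zerosProg 4, .push 7 true, zerosProg 2, .push 4 true])
        (st [N, S, List.replicate (a + 1) true, [], List.replicate z true, [], [],
          L.flatMap toStr, [], C]) (8 * (a + z) + 7)
        (st [N, S, List.replicate a true, [], List.replicate (z + 1) true, [], [],
          (basisBits n a :: L).flatMap toStr, [], C]) := by
      refine (Exec.block_cons Exec.pop (Exec.block_cons ((exec_zerosProg_four z N S
        (List.replicate a true) (L.flatMap toStr) C).congr ?_ le_rfl rfl)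
        (Exec.block_cons Exec.push (Exec.block_cons ((exec_zerosProg_two a N S
        (List.replicate z true) (true :: (List.replicate z false ++ L.flatMap toStr)) C).congr
          ?_ le_rfl rfl) (Exec.block_single Exec.push))))).congr rfl ?_ ?_
      · simp [List.replicate_succ]
      · simp
      · omega
      · simp [toStr_basisBits (n := n) (a := a) (z := z) (by omega), List.replicate_succ]
    refine (Exec.loopStep (by simp) hbody (ih (z + 1) (by omega) (basisBits n a :: L))).congr
      rfl ?_ ?_
    · rw [Nat.succ_mul a]
      omega
    · simp [List.range_succ]

lemma exec_basisProg (n : ℕ) (S C : List Bool) :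
    Exec O basisProg (st [List.replicate n true, S, [], [], [], [], [], [], [], C])
      (8 * n * n + 18 * n + 4)
      (st [List.replicate n true, S, [], [], [], [], [], (stdBasis n).flatMap toStr, [], C]) := by
  have hc : Exec O (block [.loop 0 (block [.pop 0, .push 3 true, .push 2 true]), mv 3 0])
      (st [List.replicate n true, S, [], [], [], [], [], [], [], C]) (8 * n + 2)
      (st [List.replicate n true, S, List.replicate n true, [], [], [], [], [], [], C]) := by
    refine (Exec.block_cons (exec_copyLoop n S [] [] C) (Exec.block_single
      (exec_mv (r := 3) (s := 0) (by decide) _))).congr rfl ?_ ?_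
    · simp
      omega
    · simp
  refine (hc.seq (Exec.block_cons (exec_basisLoop (n := n) n 0 (by omega) [] (List.replicate n true) S C)
    (Exec.block_single (exec_clear _)))).congr rfl ?_ ?_
  · simp
    nlinarith
  · simp [stdBasis]

/-- Replace register `0` by register `7`. -/
def outputProg : Prog := block [clear 0, mv 7 3, mv 3 0]

/-- Compute a basis of the orthogonal complement of the first samples in register `1`; their number
is the length of register `9`. -/
def solveProg : Prog :=
  block [basisProg, .loop 9 (.seq (.pop 9) sampleProg), outputProg]

/-- The basis that `solveProg` computes. -/
def solve (n c : ℕ) (S : List Bool) : List (Bits n) := eliminateAll c S (stdBasis n)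

lemma length_stdBasis (n : ℕ) : (stdBasis n).length = n := by simp [stdBasis]

lemma exec_solveProg (n c : ℕ) (S : List Bool) :
    Exec O solveProg (st [List.replicate n true, S, [], [], [], [], [], [], [],
        List.replicate c true]) (16 * n * n + 20 * n + 8 + c * (38 * n * n + 29 * n + 10))
      (st [(solve n c S).flatMap toStr, S.drop (c * n), [], [], [], [], [], [], [], []]) := by
  have hlen : ((solve n c S).flatMap toStr).length ≤ n * n := by
    rw [length_flatMap_toStr]
    refine Nat.mul_le_mul_right _ ((length_eliminateAll_le _ _ _).trans ?_)
    rw [length_stdBasis]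
  refine (Exec.block_cons (exec_basisProg n S _) (Exec.block_cons
    (exec_sampleLoop c (stdBasis n) (length_stdBasis n).le S)
    (Exec.block_single (Exec.block_cons (exec_clear _) (Exec.block_cons
      (exec_mv (r := 7) (s := 3) (by decide) _)
      (Exec.block_single (exec_mv (r := 3) (s := 0) (by decide) _))))))).congr rfl ?_ ?_
  · rw [← solve]
    generalize (solve n c S).flatMap toStr = l at hlen ⊢
    simp
    nlinarith
  · simp [solve]

/-- Elimination with all the samples in register `1`, whose length bounds their number. -/
def recoverProg : Prog :=
  .seq (.seq (.loop 1 (.branch 1 .skip (block [.pop 1, .push 3 false, .push 9 true])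
    (block [.pop 1, .push 3 true, .push 9 true]))) (mv 3 1)) solveProg

lemma exec_lengthLoop (S N T C : List Bool) :
    Exec O (.loop 1 (.branch 1 .skip (block [.pop 1, .push 3 false, .push 9 true])
      (block [.pop 1, .push 3 true, .push 9 true])))
      (st [N, S, [], T, [], [], [], [], [], C]) (5 * S.length + 1)
      (st [N, [], [], S.reverse ++ T, [], [], [], [], [],
        List.replicate S.length true ++ C]) := by
  induction S generalizing T C with
  | nil => exact (Exec.loopDone (by simp)).congr rfl (by simp) (by simp)
  | cons a S ih =>
    refine (Exec.loopStep (by simp) ((exec_straight (k := 10) rfl rfl).1.congr rfl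
      (τ' := st [N, S, [], a :: T, [], [], [], [], [], true :: C]) le_rfl ?_)
      (ih (a :: T) (true :: C))).congr rfl ?_ ?_
    · cases a <;> rfl
    · simp [straightCost, block]
      omega
    · simp [List.replicate_succ']

lemma inputStore_eq_st (x y : List Bool) (k : ℕ) :
    inputStore x y = st (x :: y :: List.replicate k []) := by
  funext r
  match r with
  | 0 => rfl
  | 1 => rfl
  | r + 2 =>
    simp only [st_apply, inputStore, List.getD_cons_succ]
    rw [List.getD_eq_getElem?_getD, List.getElem?_replicate]
    split_ifs <;> rfl

lemma exec_recoverProg (n : ℕ) (S : List Bool) :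
    ∃ τ, Exec O recoverProg (inputStore (List.replicate n true) S)
      (9 * S.length + 2 + (16 * n * n + 20 * n + 8 + S.length * (38 * n * n + 29 * n + 10))) τ ∧
      τ 0 = (solve n S.length S).flatMap toStr := by
  refine ⟨_, Exec.seq ((Exec.seq (exec_lengthLoop S (List.replicate n true) [] [])
    (exec_mv (r := 3) (s := 1) (by decide) _)).congr (inputStore_eq_st _ _ 8).symm ?_ ?_)
    (exec_solveProg n S.length S), by simp⟩
  · simp
    omega
  · simp

/-- Elimination with the first `n + 2` samples in register `1`, where `n` is the length of
register `0`. -/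
def simonPost : Prog :=
  .seq (block [.loop 0 (block [.pop 0, .push 3 true, .push 9 true]), mv 3 0, .push 9 true,
    .push 9 true]) solveProg

lemma exec_counterLoop (N S T C : List Bool) :
    Exec O (.loop 0 (block [.pop 0, .push 3 true, .push 9 true]))
      (st [N, S, [], T, [], [], [], [], [], C]) (4 * N.length + 1)
      (st [[], S, [], List.replicate N.length true ++ T, [], [], [], [], [],
        List.replicate N.length true ++ C]) := by
  induction N generalizing T C with
  | nil => exact (Exec.loopDone (by simp)).congr rfl (by simp) (by simp)
  | cons a N ih =>
    refine (Exec.loopStep (by simp) ((exec_straight (k := 10) rfl rfl).1.congr rfl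
      (τ' := st [N, S, [], true :: T, [], [], [], [], [], true :: C]) le_rfl rfl)
      (ih (true :: T) (true :: C))).congr rfl ?_ ?_
    · simp [straightCost, block]
      omega
    · simp [List.replicate_succ']

lemma exec_simonPost (x S : List Bool) :
    ∃ L, Exec O simonPost (inputStore x S) (8 * x.length + 4 + (16 * x.length * x.length +
        20 * x.length + 8 + (x.length + 2) * (38 * x.length * x.length + 29 * x.length + 10)))
      (st ((solve x.length (x.length + 2) S).flatMap toStr :: L)) := by
  refine ⟨_, Exec.seq ((Exec.block_cons (exec_counterLoop x S [] [])
    (Exec.block_cons (exec_mv (r := 3) (s := 0) (by decide) _)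
    (Exec.block_cons Exec.push (Exec.block_single Exec.push)))).congr
    (inputStore_eq_st _ _ 8).symm ?_ ?_) (exec_solveProg x.length (x.length + 2) S)⟩
  · simp
    omega
  · simp [List.replicate_succ]

end Elimination

/-! ### Correctness of the elimination -/

section EliminationCorrect

variable {n : ℕ}

/-- The subgroup generated by a list. -/
def listSpan (L : List (Bits n)) : AddSubgroup (Bits n) := AddSubgroup.closure {g | g ∈ L}

/-- The vector `w`, corrected by the pivot `v` so as to become orthogonal to `p`. -/
def reduceBy (p v w : Bits n) : Bits n := if p ⬝ᵥ w = 0 then w else w + v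

lemma foldl_elimStep_some (p v : Bits n) (L acc : List (Bits n)) :
    L.foldl (elimStep p) (some v, acc) = (some v, (L.map (reduceBy p v)).reverse ++ acc) := by
  induction L generalizing acc with
  | nil => simp
  | cons w L ih =>
    have : elimStep p (some v, acc) w = (some v, reduceBy p v w :: acc) := by
      unfold elimStep reduceBy
      split_ifs <;> rfl
    rw [List.foldl_cons, this, ih]
    simp

lemma foldl_elimStep_orthogonal (p : Bits n) (L : List (Bits n)) (hL : ∀ w ∈ L, p ⬝ᵥ w = 0)
    (s : Option (Bits n) × List (Bits n)) :
    L.foldl (elimStep p) s = (s.1, L.reverse ++ s.2) := by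
  induction L generalizing s with
  | nil => simp
  | cons w L ih =>
    rw [List.forall_mem_cons] at hL
    rw [List.foldl_cons, ih hL.2]
    simp [elimStep, hL.1]

lemma eliminate_cases (p : Bits n) (L : List (Bits n)) :
    ((∀ w ∈ L, p ⬝ᵥ w = 0) ∧ eliminate p L = L.reverse) ∨
    ∃ L₁ v L₂, L = L₁ ++ v :: L₂ ∧ p ⬝ᵥ v = 1 ∧
      eliminate p L = ((L₁ ++ L₂).map (reduceBy p v)).reverse := by
  by_cases h : ∀ w ∈ L, p ⬝ᵥ w = 0
  · exact Or.inl ⟨h, by rw [eliminate, foldl_elimStep_orthogonal p L h, List.append_nil]⟩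
  · right
    have hs : (L.find? (fun w => p ⬝ᵥ w ≠ 0)).isSome := by
      rw [List.find?_isSome]
      push Not at h
      simpa using h
    obtain ⟨v, hv⟩ := Option.isSome_iff_exists.1 hs
    obtain ⟨hpv, L₁, L₂, rfl, h₁⟩ := List.find?_eq_some_iff_append.1 hv
    have hpv' : p ⬝ᵥ v = 1 := by
      rcases zmod_two_eq_zero_or_one (p ⬝ᵥ v) with h | h
      · simp [h] at hpv
      · exact h
    have h₁' : ∀ w ∈ L₁, p ⬝ᵥ w = 0 := fun w hw => by simpa using h₁ w hw
    refine ⟨L₁, v, L₂, rfl, hpv', ?_⟩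
    rw [eliminate, List.foldl_append, foldl_elimStep_orthogonal p L₁ h₁', List.foldl_cons]
    have : elimStep p (none, L₁.reverse ++ []) v = (some v, L₁.reverse) := by
      simp [elimStep, hpv']
    rw [this, foldl_elimStep_some]
    have hmap : L₁.map (reduceBy p v) = L₁ := by
      conv_rhs => rw [← List.map_id L₁]
      exact List.map_congr_left fun w hw => by simp [reduceBy, h₁' w hw]
    simp [hmap]

lemma reduceBy_orthogonal {p v : Bits n} (hv : p ⬝ᵥ v = 1) (w : Bits n) :
    p ⬝ᵥ reduceBy p v w = 0 := by
  unfold reduceBy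
  split_ifs with h
  · exact h
  · rw [dotProduct_add, hv]
    rcases zmod_two_eq_zero_or_one (p ⬝ᵥ w) with h' | h'
    · exact absurd h' h
    · rw [h', CharTwo.add_self_eq_zero]

/-- Modulo the reduced vectors, every element of the span is `0` or the pivot. -/
lemma mem_span_reduceBy {p v : Bits n} {L₁ L₂ : List (Bits n)} (hv : p ⬝ᵥ v = 1) {x : Bits n}
    (hx : x ∈ listSpan (L₁ ++ v :: L₂)) :
    reduceBy p v x ∈ listSpan ((L₁ ++ L₂).map (reduceBy p v)).reverse := by
  induction hx using AddSubgroup.closure_induction with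
  | mem w hw =>
    have hw' : w = v ∨ w ∈ L₁ ++ L₂ := by
      simp only [Set.mem_ofPred_eq, List.mem_append, List.mem_cons] at hw ⊢
      tauto
    rcases hw' with rfl | hw'
    · rw [reduceBy, hv, if_neg one_ne_zero, bits_add_self]
      exact zero_mem _
    · refine AddSubgroup.subset_closure ?_
      rw [Set.mem_ofPred_eq, List.mem_reverse]
      exact List.mem_map_of_mem hw'
  | zero =>
    rw [reduceBy, dotProduct_zero, if_pos rfl]
    exact zero_mem _
  | add x y _ _ hx hy =>
    have : reduceBy p v (x + y) = reduceBy p v x + reduceBy p v y := by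
      unfold reduceBy
      rw [dotProduct_add]
      rcases zmod_two_eq_zero_or_one (p ⬝ᵥ x) with h1 | h1 <;>
        rcases zmod_two_eq_zero_or_one (p ⬝ᵥ y) with h2 | h2
      · simp [h1, h2]
      · simp [h1, h2, add_assoc]
      · have : x + y + v = x + v + y := by abel
        simp [h1, h2, this]
      · have : x + v + (y + v) = x + y + (v + v) := by abel
        simp [h1, h2, CharTwo.add_self_eq_zero, this, bits_add_self]
    rw [this]
    exact add_mem hx hy
  | neg x _ hx =>
    have : -x = x := neg_eq_of_add_eq_zero_left (bits_add_self x)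
    rwa [this]

lemma listSpan_reduceBy_le {p v : Bits n} {L₁ L₂ : List (Bits n)} :
    listSpan ((L₁ ++ L₂).map (reduceBy p v)).reverse ≤ listSpan (L₁ ++ v :: L₂) := by
  refine (AddSubgroup.closure_le _).2 fun x hx => ?_
  rw [Set.mem_ofPred_eq, List.mem_reverse, List.mem_map] at hx
  obtain ⟨w, hw, rfl⟩ := hx
  have hw' : w ∈ listSpan (L₁ ++ v :: L₂) := by
    refine AddSubgroup.subset_closure ?_
    simp only [Set.mem_ofPred_eq, List.mem_append, List.mem_cons] at hw ⊢
    tauto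
  have hv' : v ∈ listSpan (L₁ ++ v :: L₂) := AddSubgroup.subset_closure (by simp)
  unfold reduceBy
  split_ifs
  · exact hw'
  · exact add_mem hw' hv'

/-- The vectors orthogonal to `p` form a subgroup. -/
def orthogonalTo (p : Bits n) : AddSubgroup (Bits n) where
  carrier := {x | p ⬝ᵥ x = 0}
  zero_mem' := dotProduct_zero p
  add_mem' := fun {x y} hx hy => by
    rw [Set.mem_ofPred_eq, dotProduct_add, hx.out, hy.out, add_zero]
  neg_mem' := fun {x} hx => by
    rw [Set.mem_ofPred_eq, dotProduct_neg, hx.out, neg_zero]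

lemma mem_orthogonalTo {p x : Bits n} : x ∈ orthogonalTo p ↔ p ⬝ᵥ x = 0 := Iff.rfl

lemma listSpan_reverse (L : List (Bits n)) : listSpan L.reverse = listSpan L := by
  simp [listSpan]

lemma mem_listSpan_eliminate (p : Bits n) (L : List (Bits n)) (x : Bits n) :
    x ∈ listSpan (eliminate p L) ↔ x ∈ listSpan L ∧ p ⬝ᵥ x = 0 := by
  rcases eliminate_cases p L with ⟨h, he⟩ | ⟨L₁, v, L₂, rfl, hv, he⟩
  · rw [he, listSpan_reverse, iff_self_and]
    exact fun hx => mem_orthogonalTo.1 ((AddSubgroup.closure_le (orthogonalTo p)).2 h hx)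
  · rw [he]
    refine ⟨fun hx => ⟨listSpan_reduceBy_le hx, ?_⟩, fun hx => ?_⟩
    · refine mem_orthogonalTo.1 ((AddSubgroup.closure_le (orthogonalTo p)).2 (fun w hw => ?_) hx)
      rw [Set.mem_ofPred_eq, List.mem_reverse, List.mem_map] at hw
      obtain ⟨w, -, rfl⟩ := hw
      exact reduceBy_orthogonal hv w
    · have := mem_span_reduceBy hv hx.1
      rwa [reduceBy, if_pos hx.2] at this

/-- Elimination keeps the generators independent: the span never gets smaller than the number of
their subsets. -/
lemma two_pow_length_eliminate_le (p : Bits n) (L : List (Bits n))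
    (hL : 2 ^ L.length ≤ Nat.card (listSpan L)) :
    2 ^ (eliminate p L).length ≤ Nat.card (listSpan (eliminate p L)) := by
  rcases eliminate_cases p L with ⟨h, he⟩ | ⟨L₁, v, L₂, rfl, hv, he⟩
  · rw [he, listSpan_reverse]
    simpa using hL
  · rw [he]
    set K' := listSpan ((L₁ ++ L₂).map (reduceBy p v)).reverse with hK'
    have hsub : (listSpan (L₁ ++ v :: L₂) : Set (Bits n)) ⊆
        (K' : Set (Bits n)) ∪ (fun x => x + v) '' K' := by
      intro x hx
      have h := mem_span_reduceBy hv hx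
      unfold reduceBy at h
      split_ifs at h
      · exact Or.inl h
      · exact Or.inr ⟨x + v, h, by simp [add_assoc, bits_add_self]⟩
    have h1 := (Set.ncard_le_ncard hsub (Set.toFinite _)).trans (Set.ncard_union_le _ _)
    have h2 : ((fun x => x + v) '' (K' : Set (Bits n))).ncard ≤ (K' : Set (Bits n)).ncard :=
      Set.ncard_image_le (Set.toFinite _)
    have h3 : (listSpan (L₁ ++ v :: L₂) : Set (Bits n)).ncard =
        Nat.card (listSpan (L₁ ++ v :: L₂)) := rfl
    have h4 : (K' : Set (Bits n)).ncard = Nat.card K' := rfl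
    have h5 : (L₁ ++ v :: L₂).length = ((L₁ ++ L₂).map (reduceBy p v)).reverse.length + 1 := by
      simp
      omega
    rw [h5, pow_succ, ← h3] at hL
    rw [h4] at h1 h2
    have h6 := h1.trans (Nat.add_le_add_left h2 _)
    omega

lemma mem_listSpan_eliminateAll (c : ℕ) (S : List Bool) (L : List (Bits n)) (x : Bits n) :
    x ∈ listSpan (eliminateAll c S L) ↔
      x ∈ listSpan L ∧ ∀ i < c, takeBits n (S.drop (i * n)) ⬝ᵥ x = 0 := by
  induction c generalizing S L with
  | zero => simp [eliminateAll]
  | succ c ih =>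
    rw [eliminateAll, ih, mem_listSpan_eliminate, and_assoc, Nat.forall_lt_succ_left]
    simp [Nat.add_mul, List.drop_drop, Nat.add_comm]

lemma two_pow_length_eliminateAll_le (c : ℕ) (S : List Bool) (L : List (Bits n))
    (hL : 2 ^ L.length ≤ Nat.card (listSpan L)) :
    2 ^ (eliminateAll c S L).length ≤ Nat.card (listSpan (eliminateAll c S L)) := by
  induction c generalizing S L with
  | zero => exact hL
  | succ c ih => exact ih _ _ (two_pow_length_eliminate_le _ _ hL)

lemma listSpan_stdBasis : listSpan (stdBasis n) = ⊤ := by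
  rw [eq_top_iff]
  intro x _
  have hx : x = ∑ i : Fin n, (x i).val • basisBits n i := by
    ext j
    rw [Finset.sum_apply, Finset.sum_eq_single j]
    · simp [basisBits]
    · intro i _ hij
      simp [basisBits, Fin.val_inj, hij.symm]
    · simp
  rw [hx]
  refine sum_mem fun i _ => nsmul_mem (AddSubgroup.subset_closure ?_) _
  rw [Set.mem_ofPred_eq, stdBasis, List.mem_map]
  exact ⟨i, List.mem_range.2 i.2, rfl⟩

lemma mem_listSpan_solve (c : ℕ) (S : List Bool) (x : Bits n) :
    x ∈ listSpan (solve n c S) ↔ ∀ i < c, takeBits n (S.drop (i * n)) ⬝ᵥ x = 0 := by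
  rw [solve, mem_listSpan_eliminateAll, listSpan_stdBasis]
  simp

lemma two_pow_length_solve_le (c : ℕ) (S : List Bool) :
    2 ^ (solve n c S).length ≤ Nat.card (listSpan (solve n c S)) := by
  refine two_pow_length_eliminateAll_le c S _ ?_
  rw [listSpan_stdBasis, length_stdBasis]
  simp

lemma takeBits_toStr_append (x : Bits n) (R : List Bool) : takeBits n (toStr x ++ R) = x := by
  ext i
  have : (toStr x ++ R).getD i false = decide (x i = 1) := by
    rw [List.getD_eq_getElem?_getD, List.getElem?_append_left (by simp)]
    simp [toStr]
  rw [takeBits, this]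
  rcases zmod_two_eq_zero_or_one (x i) with h | h <;> simp [h]

lemma takeBits_nil : takeBits n [] = 0 := by
  ext i
  simp [takeBits]

lemma takeBits_drop_flatMap (L : List (Bits n)) (R : List Bool) (i : ℕ) (hi : i < L.length) :
    takeBits n ((L.flatMap toStr ++ R).drop (i * n)) = L[i] := by
  induction L generalizing i with
  | nil => simp at hi
  | cons x L ih =>
    cases i with
    | zero => simp [takeBits_toStr_append]
    | succ i =>
      rw [List.flatMap_cons, List.append_assoc, Nat.succ_mul, Nat.add_comm, ← List.drop_drop,
        List.drop_left' (length_toStr x)]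
      simpa using ih i (by simpa using hi)

lemma length_samplesStr {m : ℕ} (p : Fin m → Bits n) : (samplesStr p).length = m * n := by
  rw [samplesStr, length_flatMap_toStr, List.length_ofFn]

lemma mem_listSpan_solve_samplesStr {m : ℕ} (p : Fin m → Bits n) (x : Bits n) :
    x ∈ listSpan (solve n (m * n) (samplesStr p)) ↔ ∀ i, p i ⬝ᵥ x = 0 := by
  rw [mem_listSpan_solve]
  rcases Nat.eq_zero_or_pos n with rfl | hn
  · simp [dotProduct]
  · have h : ∀ i : Fin m, takeBits n ((samplesStr p).drop (i * n)) = p i := fun i => by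
      have := takeBits_drop_flatMap (List.ofFn p) [] i (by simp)
      simpa [samplesStr] using this
    constructor
    · intro hx i
      rw [← h i]
      exact hx i (i.2.trans_le (Nat.le_mul_of_pos_right m hn))
    · intro hx i _
      by_cases hi : i < m
      · rw [h ⟨i, hi⟩]
        exact hx _
      · rw [List.drop_eq_nil_of_le, takeBits_nil, zero_dotProduct]
        rw [length_samplesStr]
        exact Nat.mul_le_mul_right n (not_lt.1 hi)

/-- The running time allowed to the post-processing. -/
noncomputable def recoverTime : Polynomial ℕ :=
  9 * Polynomial.X ^ 2 + 2 + (16 * Polynomial.X ^ 2 + 20 * Polynomial.X + 8 +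
    Polynomial.X ^ 2 * (38 * Polynomial.X ^ 2 + 29 * Polynomial.X + 10))

lemma computes_recoverProg (M k : ℕ) (p : Fin (M + k) → Bits M) :
    Computes noOracle recoverProg (List.replicate M true) (samplesStr p)
      ((solve M ((M + k) * M) (samplesStr p)).flatMap toStr) (recoverTime.eval (M + k)) := by
  obtain ⟨τ, ⟨t, ht, hr⟩, hτ⟩ := exec_recoverProg (O := noOracle) M (samplesStr p)
  rw [length_samplesStr] at ht hτ
  refine ⟨τ, t, hr, ht.trans ?_, hτ⟩
  have h1 : M ≤ M + k := Nat.le_add_right _ _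
  generalize M + k = s at h1
  have h2 : s * M ≤ s ^ 2 := by
    rw [pow_two]
    exact Nat.mul_le_mul_left s h1
  have h3 : M * M ≤ s ^ 2 := by
    rw [pow_two]
    exact Nat.mul_le_mul h1 h1
  simp only [recoverTime, Polynomial.eval_add, Polynomial.eval_mul, Polynomial.eval_pow,
    Polynomial.eval_X, Polynomial.eval_ofNat]
  have h4 : s * M * (38 * M * M + 29 * M + 10) ≤ s ^ 2 * (38 * s ^ 2 + 29 * s + 10) := by
    refine Nat.mul_le_mul h2 ?_
    have : 38 * M * M = 38 * (M * M) := by ring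
    omega
  have : 16 * M * M = 16 * (M * M) := by ring
  omega

lemma one_sub_le_recoveryProb (M k N : ℕ) (f : Bits M → Bits N) (H : AddSubgroup (Bits M))
    (hf : Hides f H) :
    1 - 1 / 2 ^ k ≤ recoveryProb f H recoverProg (M + k) (recoverTime.eval (M + k)) := by
  classical
  have hpow : (2 : ℝ) ^ M / 2 ^ (M + k) = 1 / 2 ^ k := by
    rw [pow_add]
    field_simp
  rw [← hpow, recoveryProb]
  refine one_sub_le_sum_orthogonal_eq hf (M + k) _ fun ω hω => ?_
  refine ⟨_, computes_recoverProg M k _, _, rfl, ?_⟩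
  ext x
  rw [← listSpan, mem_listSpan_solve_samplesStr, hω]

end EliminationCorrect

/-! ### The circuit of Simon's algorithm -/

section CircuitSemantics

variable {w : ℕ} (O : List Bool → List Bool)

/-- The state after a list of gates. -/
noncomputable def runGates (l : List (Gate w)) (ψ : (Fin w → Bool) → ℝ) : (Fin w → Bool) → ℝ :=
  l.foldl (fun ψ g => (g.matrix O).mulVec ψ) ψ

lemma runGates_append (l l' : List (Gate w)) (ψ : (Fin w → Bool) → ℝ) :
    runGates O (l ++ l') ψ = runGates O l' (runGates O l ψ) := List.foldl_append

lemma had_mulVec (i : Fin w) (ψ : (Fin w → Bool) → ℝ) (y : Fin w → Bool) :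
    ((Gate.had i).matrix O).mulVec ψ y =
      (√2)⁻¹ * ∑ b : Bool, (if b && y i then -1 else 1) * ψ (Function.update y i b) := by
  have hinj : Function.Injective (fun b : Bool => Function.update y i b) :=
    Function.update_injective y i
  rw [Matrix.mulVec, dotProduct, Finset.mul_sum,
    ← Finset.sum_subset (Finset.subset_univ (Finset.univ.map ⟨_, hinj⟩)), Finset.sum_map]
  · refine Finset.sum_congr rfl fun b _ => ?_
    have h : ∀ j, j ≠ i → y j = Function.update y i b j := fun j hj => by simp [hj]
    simp only [Function.Embedding.coeFn_mk, Gate.matrix, Matrix.of_apply]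
    rw [if_pos h, Function.update_self]
    ring
  · intro x _ hx
    simp only [Gate.matrix, Matrix.of_apply]
    rw [if_neg, zero_mul]
    intro h
    refine hx (Finset.mem_map.2 ⟨x i, Finset.mem_univ _, ?_⟩)
    funext j
    by_cases hj : j = i
    · subst hj
      simp
    · simp [hj, h j hj]

/-- The sign `(-1)^(s · y)`, the product being over the wires of the list `l`. -/
noncomputable def layerSign (l : List (Fin w)) (s y : Fin w → Bool) : ℝ :=
  (l.map fun j => if s j && y j then (-1 : ℝ) else 1).prod

/-- Hadamard gates on distinct wires act as the Fourier transform of these wires. -/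
lemma runGates_had (l : List (Fin w)) (hl : l.Nodup) (ψ : (Fin w → Bool) → ℝ)
    (y : Fin w → Bool) :
    runGates O (l.map Gate.had) ψ y = (√2)⁻¹ ^ l.length *
      ∑ s : Fin w → Bool, if ∀ j, j ∉ l → s j = y j then layerSign l s y * ψ s else 0 := by
  classical
  induction l using List.reverseRecOn generalizing y with
  | nil =>
    simp [← funext_iff, runGates, layerSign]
  | append_singleton l i ih =>
    have hi : i ∉ l := by
      rw [List.nodup_append] at hl
      exact fun h => hl.2.2 i h i (by simp) rfl
    have hl' : l.Nodup := (List.nodup_append.1 hl).1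
    rw [List.map_append, runGates_append]
    change ((Gate.had i).matrix O).mulVec _ y = _
    rw [had_mulVec, List.length_append, List.length_singleton, pow_succ', mul_assoc]
    congr 1
    simp_rw [ih hl']
    rw [Finset.mul_sum]
    simp_rw [← mul_assoc, mul_comm _ ((√2)⁻¹ ^ l.length), mul_assoc, Finset.mul_sum]
    rw [Finset.sum_comm]
    refine Finset.sum_congr rfl fun s _ => ?_
    have hsign : ∀ b, layerSign l s (Function.update y i b) = layerSign l s y := fun b => by
      refine congrArg List.prod (List.map_congr_left fun j hj => ?_)
      rw [Function.update_of_ne (show j ≠ i from fun h => hi (h ▸ hj))]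
    have hcond : ∀ b, (∀ j, j ∉ l → s j = Function.update y i b j) ↔
        s i = b ∧ ∀ j, j ∉ l ++ [i] → s j = y j := by
      intro b
      constructor
      · refine fun h => ⟨by simpa using h i hi, fun j hj => ?_⟩
        simp only [List.mem_append, List.mem_singleton, not_or] at hj
        simpa [hj.2] using h j hj.1
      · rintro ⟨h1, h2⟩ j hj
        by_cases hji : j = i
        · subst hji
          simpa using h1
        · simpa [hji] using h2 j (by simp [hj, hji])
    have happ : layerSign (l ++ [i]) s y =
        layerSign l s y * (if s i && y i then -1 else 1) := by
      simp [layerSign]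
    simp only [hsign, hcond, happ]
    by_cases hc : ∀ j, j ∉ l ++ [i] → s j = y j
    · have hb : ∀ b, (s i = b ∧ ∀ j, j ∉ l ++ [i] → s j = y j) ↔ s i = b := fun b =>
        and_iff_left hc
      simp only [hb, if_pos hc]
      rw [Finset.sum_eq_single (s i)]
      · rw [if_pos (c := s i = s i) rfl]
        ring
      · intro b _ hb
        rw [if_neg (c := s i = b) fun h => hb h.symm]
        ring
      · simp
    · simp only [hc, and_false, if_false, mul_zero, Finset.sum_const_zero]

lemma permutation_mulVec (g : Gate w) (hg : ∀ i, g ≠ .had i)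
    (hinv : Function.Involutive (g.act O)) (ψ : (Fin w → Bool) → ℝ) (y : Fin w → Bool) :
    (g.matrix O).mulVec ψ y = ψ (g.act O y) := by
  have hm : g.matrix O = Matrix.of fun y x => if y = g.act O x then (1 : ℝ) else 0 := by
    cases g <;> first | rfl | exact absurd rfl (hg _)
  rw [hm, Matrix.mulVec, dotProduct, Finset.sum_eq_single (g.act O y)]
  · simp [hinv y]
  · intro x _ hx
    rw [Matrix.of_apply, if_neg, zero_mul]
    rintro rfl
    exact hx (hinv x).symm
  · simp

end CircuitSemantics

section SimonCircuit

variable (m n : ℕ)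

/-- The wire of bit `j` of the query of run `i`. -/
def inWire (i : Fin m) (j : Fin n) : Fin (m * n + m * n) :=
  Fin.castAdd (m * n) (finProdFinEquiv (i, j))

/-- The wire of bit `j` of the answer of run `i`. -/
def outWire (i : Fin m) (j : Fin n) : Fin (m * n + m * n) :=
  Fin.natAdd (m * n) (finProdFinEquiv (i, j))

variable {m n}

lemma inWire_inj {i i' : Fin m} {j j' : Fin n} :
    inWire m n i j = inWire m n i' j' ↔ i = i' ∧ j = j' := by
  rw [inWire, inWire, (Fin.castAdd_injective _ _).eq_iff, finProdFinEquiv.injective.eq_iff,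
    Prod.mk_inj]

lemma outWire_inj {i i' : Fin m} {j j' : Fin n} :
    outWire m n i j = outWire m n i' j' ↔ i = i' ∧ j = j' := by
  rw [outWire, outWire, (Fin.natAdd_injective _ _).eq_iff, finProdFinEquiv.injective.eq_iff,
    Prod.mk_inj]

lemma inWire_ne_outWire (i i' : Fin m) (j j' : Fin n) : inWire m n i j ≠ outWire m n i' j' := by
  intro h
  have := congrArg Fin.val h
  simp only [inWire, outWire, Fin.val_castAdd, Fin.val_natAdd] at this
  have h2 := (finProdFinEquiv (i, j)).2
  omega

lemma nodup_wires (i : Fin m) :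
    (List.ofFn (inWire m n i) ++ List.ofFn (outWire m n i)).Nodup := by
  rw [List.nodup_append]
  refine ⟨List.nodup_ofFn.2 fun j j' h => (inWire_inj.1 h).2,
    List.nodup_ofFn.2 fun j j' h => (outWire_inj.1 h).2, ?_⟩
  intro a ha b hb
  rw [List.mem_ofFn] at ha hb
  obtain ⟨j, rfl⟩ := ha
  obtain ⟨j', rfl⟩ := hb
  exact inWire_ne_outWire _ _ _ _

variable (m n)

/-- The wires of all the queries. -/
def queryWires : List (Fin (m * n + m * n)) := (List.finRange (m * n)).map (Fin.castAdd (m * n))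

/-- The oracle gate of run `i`. -/
def runGate (i : Fin m) : Gate (m * n + m * n) :=
  .oracle (List.ofFn (inWire m n i)) (List.ofFn (outWire m n i)) (nodup_wires i)

/-- The circuit for `m` parallel runs of the quantum subroutine on `n` bits. -/
def simonCircuit : Circuit where
  width := m * n + m * n
  gates := (queryWires m n).map Gate.had ++ (List.finRange m).map (runGate m n) ++
    (queryWires m n).map Gate.had

variable {m n}

lemma forall_wire {P : Fin (m * n + m * n) → Prop} :
    (∀ k, P k) ↔ (∀ i j, P (inWire m n i j)) ∧ ∀ i j, P (outWire m n i j) := by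
  refine ⟨fun h => ⟨fun i j => h _, fun i j => h _⟩, fun h k => ?_⟩
  refine Fin.addCases (fun k => ?_) (fun k => ?_) k
  · obtain ⟨⟨i, j⟩, rfl⟩ := finProdFinEquiv.surjective k
    exact h.1 i j
  · obtain ⟨⟨i, j⟩, rfl⟩ := finProdFinEquiv.surjective k
    exact h.2 i j

/-- A bit as a scalar. -/
def bit (b : Bool) : ZMod 2 := if b then 1 else 0

lemma bit_injective : Function.Injective bit := by decide

lemma bit_xor (a b : Bool) : bit (a ^^ b) = bit a + bit b := by
  revert a b
  decide

lemma decide_bit (b : Bool) : decide (bit b = 1) = b := by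
  revert b
  decide

lemma bit_decide (a : ZMod 2) : bit (decide (a = 1)) = a := by
  revert a
  decide

/-- The answers and the queries of the runs, read off from the wires. -/
def decodeFun (y : Fin (m * n + m * n) → Bool) : Fin m → Bits n × Bits n := fun i =>
  (fun j => bit (y (outWire m n i j)), fun j => bit (y (inWire m n i j)))

lemma decodeFun_bijective : Function.Bijective (decodeFun (m := m) (n := n)) := by
  rw [Fintype.bijective_iff_injective_and_card]
  constructor
  · intro y y' h
    funext k
    revert k
    rw [forall_wire]
    refine ⟨fun i j => ?_, fun i j => ?_⟩
    · exact bit_injective (congrFun (congrArg Prod.snd (congrFun h i)) j)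
    · exact bit_injective (congrFun (congrArg Prod.fst (congrFun h i)) j)
  · simp [ZMod.card, mul_comm m n, pow_mul, pow_add, mul_pow]

/-- The answers and the queries of the runs determine the state of the wires. -/
noncomputable def decode : (Fin (m * n + m * n) → Bool) ≃ (Fin m → Bits n × Bits n) :=
  Equiv.ofBijective decodeFun decodeFun_bijective

lemma decode_fst (y : Fin (m * n + m * n) → Bool) (i : Fin m) (j : Fin n) :
    (decode y i).1 j = bit (y (outWire m n i j)) := rfl

lemma decode_snd (y : Fin (m * n + m * n) → Bool) (i : Fin m) (j : Fin n) :
    (decode y i).2 j = bit (y (inWire m n i j)) := rfl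

lemma mem_queryWires_inWire (i : Fin m) (j : Fin n) : inWire m n i j ∈ queryWires m n :=
  List.mem_map.2 ⟨_, List.mem_finRange _, rfl⟩

lemma not_mem_queryWires_outWire (i : Fin m) (j : Fin n) : outWire m n i j ∉ queryWires m n := by
  intro h
  obtain ⟨k, -, hk⟩ := List.mem_map.1 h
  have := congrArg Fin.val hk
  simp only [outWire, Fin.val_castAdd, Fin.val_natAdd] at this
  have h2 := k.2
  omega

lemma nodup_queryWires : (queryWires m n).Nodup :=
  (List.nodup_finRange _).map (Fin.castAdd_injective _ _)

lemma agree_off_queryWires (s y : Fin (m * n + m * n) → Bool) :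
    (∀ k, k ∉ queryWires m n → s k = y k) ↔ ∀ i, (decode s i).1 = (decode y i).1 := by
  rw [forall_wire]
  constructor
  · rintro ⟨-, h⟩ i
    ext j
    rw [decode_fst, decode_fst, h i j (not_mem_queryWires_outWire i j)]
  · refine fun h => ⟨fun i j hk => absurd (mem_queryWires_inWire i j) hk, fun i j _ => ?_⟩
    exact bit_injective (congrFun (h i) j)

lemma layerSign_queryWires (s y : Fin (m * n + m * n) → Bool) :
    layerSign (queryWires m n) s y = ∏ i, bitChar (decode y i).2 (decode s i).2 := by
  have h1 : layerSign (queryWires m n) s y =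
      ∏ i : Fin m, ∏ j : Fin n, if s (inWire m n i j) && y (inWire m n i j) then (-1 : ℝ) else 1 := by
    rw [layerSign, queryWires, List.map_map, ← Fintype.prod_prod_type',
      ← List.ofFn_eq_map, List.prod_ofFn]
    exact (Fintype.prod_equiv finProdFinEquiv _ _ fun x => rfl).symm
  rw [h1]
  refine Finset.prod_congr rfl fun i _ => ?_
  have h2 : ∀ (k : ℕ) (a b : Fin k → Bool),
      (∏ j, if a j && b j then (-1 : ℝ) else 1) =
        bitChar (fun j => bit (b j)) (fun j => bit (a j)) := by
    intro k
    induction k with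
    | zero => intro a b; simp [bitChar_apply, dotProduct]
    | succ k ih =>
      intro a b
      have hs : (fun j => bit (b j)) ⬝ᵥ (fun j => bit (a j)) = bit (b 0) * bit (a 0) +
          (fun j : Fin k => bit (b j.succ)) ⬝ᵥ (fun j => bit (a j.succ)) := Fin.sum_univ_succ _
      rw [Fin.prod_univ_succ, ih (fun j => a j.succ) (fun j => b j.succ), bitChar_apply,
        bitChar_apply, hs]
      rcases zmod_two_eq_zero_or_one
        ((fun j : Fin k => bit (b j.succ)) ⬝ᵥ (fun j => bit (a j.succ))) with h | h <;>
      rw [h] <;> cases a 0 <;> cases b 0 <;> simp [bit, CharTwo.add_self_eq_zero]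
  exact h2 n _ _

variable {O : List Bool → List Bool} {f : Bits n → Bits n}

/-- The effect of the oracle on one run. -/
def oracleStep (f : Bits n → Bits n) (x : Bits n × Bits n) : Bits n × Bits n :=
  (x.1 + f x.2, x.2)

lemma decode_act_runGate (hO : ∀ v : Bits n, O (toStr v) = toStr (f v)) (i : Fin m)
    (y : Fin (m * n + m * n) → Bool) :
    decode ((runGate m n i).act O y) =
      Function.update (decode y) i (oracleStep f (decode y i)) := by
  have hin : (List.ofFn (inWire m n i)).map y = toStr (decode y i).2 := by
    rw [toStr, List.map_ofFn]
    congr 1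
    funext j
    rw [decode_snd, decide_bit]
    rfl
  have hmem : ∀ i' j, outWire m n i' j ∈ List.ofFn (outWire m n i) ↔ i' = i := by
    intro i' j
    rw [List.mem_ofFn]
    constructor
    · rintro ⟨j', h⟩
      exact (outWire_inj.1 h).1.symm
    · rintro rfl
      exact ⟨j, rfl⟩
  have hidx : ∀ j, (List.ofFn (outWire m n i)).idxOf (outWire m n i j) = j := by
    intro j
    have hnd : (List.ofFn (outWire m n i)).Nodup :=
      List.nodup_ofFn.2 fun j j' h => (outWire_inj.1 h).2
    have := hnd.idxOf_getElem (j : ℕ) (by simp)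
    simpa using this
  funext i'
  refine Prod.ext (funext fun j => ?_) (funext fun j => ?_)
  · rw [decode_fst]
    simp only [runGate, Gate.act, hmem]
    by_cases h : i' = i
    · subst h
      rw [if_pos rfl, hidx, hin, hO, bit_xor, Function.update_self]
      congr 1
      rw [List.getD_eq_getElem?_getD, toStr, List.getElem?_ofFn]
      simp [bit_decide]
    · rw [if_neg h, Function.update_of_ne h]
      rfl
  · rw [decode_snd]
    have : inWire m n i' j ∉ List.ofFn (outWire m n i) := by
      rw [List.mem_ofFn]
      rintro ⟨j', h⟩
      exact inWire_ne_outWire _ _ _ _ h.symm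
    simp only [runGate, Gate.act, if_neg this]
    by_cases h : i' = i
    · subst h
      rw [Function.update_self]
      rfl
    · rw [Function.update_of_ne h]
      rfl

lemma oracleStep_oracleStep (x : Bits n × Bits n) : oracleStep f (oracleStep f x) = x := by
  simp [oracleStep, add_assoc, bits_add_self]

lemma act_runGate_involutive (hO : ∀ v : Bits n, O (toStr v) = toStr (f v)) (i : Fin m) :
    Function.Involutive ((runGate m n i).act O) := by
  intro y
  apply decode.injective
  rw [decode_act_runGate hO, decode_act_runGate hO]
  simp [oracleStep_oracleStep]

lemma runGates_oracles (hO : ∀ v : Bits n, O (toStr v) = toStr (f v)) (l : List (Fin m))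
    (hl : l.Nodup) (ψ : (Fin (m * n + m * n) → Bool) → ℝ) (y : Fin (m * n + m * n) → Bool) :
    runGates O (l.map (runGate m n)) ψ y =
      ψ (decode.symm fun i => if i ∈ l then oracleStep f (decode y i) else decode y i) := by
  induction l generalizing ψ with
  | nil => simp [runGates]
  | cons i l ih =>
    rw [List.nodup_cons] at hl
    rw [List.map_cons]
    change runGates O (l.map (runGate m n)) (((runGate m n i).matrix O).mulVec ψ) y = _
    rw [ih hl.2, permutation_mulVec O _ (by simp [runGate]) (act_runGate_involutive hO i)]
    congr 1
    apply decode.injective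
    rw [decode_act_runGate hO, Equiv.apply_symm_apply, Equiv.apply_symm_apply]
    funext k
    by_cases hk : k = i
    · subst hk
      simp [hl.1]
    · simp [hk]

/-- The amplitude of an outcome of the circuit is the product of the scalars of the runs of the
quantum subroutine. -/
lemma simonCircuit_final (hO : ∀ v : Bits n, O (toStr v) = toStr (f v))
    (y : Fin (m * n + m * n) → Bool) :
    (simonCircuit m n).final O y =
      ∏ i, subroutineScalar f (decode y i).1 (bitCharState (decode y i).2) := by
  have hsq : (√2 : ℝ)⁻¹ ^ (m * n) * (√2)⁻¹ ^ (m * n) = ∏ _i : Fin m, ((2 : ℝ) ^ n)⁻¹ := by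
    rw [← mul_pow, ← mul_inv, Real.mul_self_sqrt (by norm_num)]
    simp [mul_comm m n, pow_mul]
  have hlen : (queryWires m n).length = m * n := by simp [queryWires]
  have hzero : ∀ s : Fin (m * n + m * n) → Bool,
      (∀ i, (decode (fun _ => false : Fin (m * n + m * n) → Bool) i).1 = (decode s i).1) ↔
        ∀ i, (decode s i).1 = 0 := by
    intro s
    refine forall_congr' fun i => ?_
    have : (decode (fun _ => false : Fin (m * n + m * n) → Bool) i).1 = 0 := rfl
    rw [this, eq_comm]
  have hprep : ∀ s : Fin (m * n + m * n) → Bool, runGates O ((queryWires m n).map Gate.had)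
      (Pi.single (fun _ => false) 1) s =
        (√2)⁻¹ ^ (m * n) * if ∀ i, (decode s i).1 = 0 then 1 else 0 := by
    intro s
    rw [runGates_had O _ nodup_queryWires, hlen, Finset.sum_eq_single (fun _ => false)]
    · simp only [agree_off_queryWires, hzero]
      simp [layerSign]
    · intro t _ ht
      simp [Pi.single_eq_of_ne ht]
    · simp
  refine Eq.trans (b := runGates O ((queryWires m n).map Gate.had ++ (List.finRange m).map
    (runGate m n) ++ (queryWires m n).map Gate.had)
    (Pi.single (fun _ : Fin (m * n + m * n) => false) 1) y) rfl ?_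
  rw [runGates_append, runGates_append, runGates_had O _ nodup_queryWires, hlen]
  simp_rw [runGates_oracles hO _ (List.nodup_finRange m), hprep, agree_off_queryWires,
    layerSign_queryWires]
  simp only [Equiv.apply_symm_apply, List.mem_finRange, if_true]
  have hterm : ∀ s : Fin (m * n + m * n) → Bool,
      (if ∀ i, (decode s i).1 = (decode y i).1 then
        (∏ i, bitChar (decode y i).2 (decode s i).2) * ((√2)⁻¹ ^ (m * n) *
          if ∀ i, (oracleStep f (decode s i)).1 = 0 then 1 else 0) else 0) =
      (√2)⁻¹ ^ (m * n) * ∏ i, (if (decode s i).1 = (decode y i).1 ∧ f (decode s i).2 =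
        (decode y i).1 then bitChar (decode y i).2 (decode s i).2 else 0) := by
    intro s
    have hstep : ∀ i, (oracleStep f (decode s i)).1 = 0 ↔ f (decode s i).2 = (decode s i).1 := by
      intro i
      rw [oracleStep, add_eq_zero_iff_eq_neg, eq_comm,
        neg_eq_of_add_eq_zero_left (bits_add_self _)]
    by_cases h1 : ∀ i, (decode s i).1 = (decode y i).1
    · rw [if_pos h1]
      simp only [hstep, h1, true_and]
      by_cases h2 : ∀ i, f (decode s i).2 = (decode y i).1
      · simp [h2, mul_comm]
      · rw [if_neg h2, mul_zero, mul_zero]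
        push Not at h2
        obtain ⟨i, hi⟩ := h2
        rw [Finset.prod_eq_zero (Finset.mem_univ i) (if_neg hi), mul_zero]
    · rw [if_neg h1]
      push Not at h1
      obtain ⟨i, hi⟩ := h1
      rw [Finset.prod_eq_zero (Finset.mem_univ i) (if_neg fun h => hi h.1), mul_zero]
  simp_rw [hterm]
  rw [← Finset.mul_sum, ← mul_assoc, hsq,
    Fintype.sum_equiv decode _ (fun ω : Fin m → Bits n × Bits n => ∏ i,
      (if (ω i).1 = (decode y i).1 ∧ f (ω i).2 = (decode y i).1 then
        bitChar (decode y i).2 (ω i).2 else 0)) fun s => rfl]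
  have hprod := (Finset.prod_univ_sum (fun _ : Fin m => (Finset.univ : Finset (Bits n × Bits n)))
    (fun i x => if x.1 = (decode y i).1 ∧ f x.2 = (decode y i).1 then
        bitChar (decode y i).2 x.2 else 0)).symm
  rw [Fintype.piFinset_univ] at hprod
  rw [hprod, ← Finset.prod_mul_distrib]
  refine Finset.prod_congr rfl fun i _ => ?_
  rw [subroutineScalar_eq, Fintype.sum_prod_type, Finset.sum_eq_single (decode y i).1]
  · simp [bitCharState_apply]
  · intro b _ hb
    simp [hb]
  · simp

lemma simonCircuit_prob (hO : ∀ v : Bits n, O (toStr v) = toStr (f v))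
    (y : Fin (m * n + m * n) → Bool) :
    (simonCircuit m n).prob O y =
      ∏ i, subroutineProb f (decode y i).1 (bitCharState (decode y i).2) := by
  refine (congrArg (· ^ 2) (simonCircuit_final hO y)).trans ?_
  exact (Finset.prod_pow _ _ _).symm

end SimonCircuit

/-! ### Uniformity of the circuits -/

section Uniform

variable {O : List Bool → List Bool}

/-- Push the unary code of the length of register `c` onto register `1`. -/
def emitUnary (c : ℕ) : Prog :=
  block [.push 1 false, .loop c (block [.pop c, .push 3 true, .push 1 true]), mv 3 c]

lemma exec_emitLoop {c : ℕ} (h1 : c ≠ 1) (h3 : c ≠ 3) (a : ℕ) (σ : ℕ → List Bool)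
    (hc : σ c = List.replicate a true) :
    Exec O (.loop c (block [.pop c, .push 3 true, .push 1 true])) σ (4 * a + 1)
      (Function.update (Function.update (Function.update σ c []) 3 (List.replicate a true ++ σ 3))
        1 (List.replicate a true ++ σ 1)) := by
  induction a generalizing σ with
  | zero =>
    refine (Exec.loopDone hc).congr rfl (by simp) ?_
    funext r
    by_cases hr : r = 1
    · subst hr; simp
    by_cases hr3 : r = 3
    · subst hr3; simp
    by_cases hrc : r = c
    · subst hrc; simp [hr, hr3, hc]
    simp [hr, hr3, hrc]
  | succ a ih =>
    refine (Exec.loopStep (by simp [hc]) (Exec.block_cons Exec.pop (Exec.block_cons Exec.push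
      (Exec.block_single Exec.push))) (ih _ ?_)).congr rfl (by omega) ?_
    · simp [hc, h1, h3, List.replicate_succ]
    · funext r
      by_cases hr : r = 1
      · subst hr; simp [h1.symm, List.replicate_succ']
      by_cases hr3 : r = 3
      · subst hr3; simp [h3.symm, List.replicate_succ']
      by_cases hrc : r = c
      · subst hrc; simp [hr, hr3]
      simp [hr, hr3, hrc]

lemma exec_emitUnary {c : ℕ} (h1 : c ≠ 1) (h3 : c ≠ 3) (a : ℕ) (σ : ℕ → List Bool)
    (hc : σ c = List.replicate a true) (hs : σ 3 = []) :
    Exec O (emitUnary c) σ (8 * a + 3) (Function.update σ 1 (unary a ++ σ 1)) := by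
  refine (Exec.block_cons Exec.push (Exec.block_cons (exec_emitLoop h1 h3 a _ ?_)
    (Exec.block_single (exec_mv h3.symm _)))).congr rfl ?_ ?_
  · simp [h1, hc]
  · simp [hs]
    omega
  · funext r
    by_cases hr : r = 1
    · subst hr; simp [h1.symm, unary]
    by_cases hr3 : r = 3
    · subst hr3; simp [h3.symm, hs]
    by_cases hrc : r = c
    · subst hrc; simp [hr, hr3, hc, hs]
    simp [hr, hr3, hrc]

/-- The code of Hadamard gates on the first `k` wires. -/
def hadCode (k : ℕ) : List Bool :=
  (List.range k).flatMap fun i => [false, false, true] ++ unary i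

/-- Emit the code of a layer of Hadamard gates, as many as register `c` has entries. -/
def emitHad (c : ℕ) : Prog :=
  .loop c (block [.pop c, emitUnary c, .push 1 true, .push 1 false, .push 1 false])

lemma exec_emitHad {c : ℕ} (h1 : c ≠ 1) (h3 : c ≠ 3) (k b : ℕ) (hb : k ≤ b) (σ : ℕ → List Bool)
    (hc : σ c = List.replicate k true) (hs : σ 3 = []) :
    Exec O (emitHad c) σ (k * (8 * b + 8) + 1)
      (Function.update (Function.update σ c []) 1 (hadCode k ++ σ 1)) := by
  induction k generalizing σ with
  | zero =>
    refine (Exec.loopDone hc).congr rfl (by simp) ?_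
    funext r
    by_cases hr : r = 1
    · subst hr; simp [hadCode]
    by_cases hrc : r = c
    · subst hrc; simp [hr, hc]
    simp [hr, hrc]
  | succ k ih =>
    refine (Exec.loopStep (by simp [hc]) (Exec.block_cons Exec.pop (Exec.block_cons
      (exec_emitUnary h1 h3 k _ ?_ ?_) (Exec.block_cons Exec.push (Exec.block_cons Exec.push
      (Exec.block_single Exec.push))))) (ih (by omega) _ ?_ ?_)).congr rfl ?_ ?_
    · simp [hc, List.replicate_succ]
    · simp [h3.symm, hs]
    · simp [hc, h1, List.replicate_succ]
    · simp [h3.symm, hs]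
    · rw [Nat.succ_mul k]
      omega
    · funext r
      by_cases hr : r = 1
      · subst hr; simp [h1.symm, hadCode, List.range_succ]
      by_cases hrc : r = c
      · subst hrc; simp [hr]
      simp [hr, hrc]

/-- The code of `a` consecutive wires starting with `s`, without the final bit. -/
def rangeCode (s a : ℕ) : List Bool := (List.range a).flatMap fun j => true :: unary (s + j)

/-- Emit the code of as many wires as register `0` has entries; register `d` holds the end of the
range of wires. -/
def emitRange (d : ℕ) : Prog :=
  .seq (.loop 0 (block [.pop 0, .push 6 true, .pop d, emitUnary d, .push 1 true])) (mv 6 0)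

lemma exec_emitRangeLoop {d : ℕ} (h0 : d ≠ 0) (h1 : d ≠ 1) (h3 : d ≠ 3) (h6 : d ≠ 6)
    (s a b : ℕ) (hb : s + a ≤ b) (σ : ℕ → List Bool) (hN : σ 0 = List.replicate a true)
    (hd : σ d = List.replicate (s + a) true) (hs : σ 3 = []) :
    Exec O (.loop 0 (block [.pop 0, .push 6 true, .pop d, emitUnary d, .push 1 true])) σ
      (a * (8 * b + 8) + 1)
      (Function.update (Function.update (Function.update (Function.update σ 0 []) 6
        (List.replicate a true ++ σ 6)) d (List.replicate s true)) 1 (rangeCode s a ++ σ 1)) := by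
  induction a generalizing σ with
  | zero =>
    refine (Exec.loopDone hN).congr rfl (by simp) ?_
    funext r
    by_cases hr : r = 1
    · subst hr; simp [rangeCode]
    by_cases hrd : r = d
    · subst hrd; simp [hr, hd]
    by_cases hr6 : r = 6
    · subst hr6; simp [hrd]
    by_cases hr0 : r = 0
    · subst hr0; simp [hrd, hN]
    simp [hr, hrd, hr6, hr0]
  | succ a ih =>
    refine (Exec.loopStep (by simp [hN]) (Exec.block_cons Exec.pop (Exec.block_cons Exec.push
      (Exec.block_cons Exec.pop (Exec.block_cons (exec_emitUnary h1 h3 (s + a) _ ?_ ?_)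
      (Exec.block_single Exec.push))))) (ih (by omega) _ ?_ ?_ ?_)).congr rfl ?_ ?_
    · simp [hd, h0, h6, ← Nat.add_assoc, List.replicate_succ]
    · simp [h3.symm, hs]
    · simp [hN, h0.symm, List.replicate_succ]
    · simp [hd, h0, h6, h1, ← Nat.add_assoc, List.replicate_succ]
    · simp [h3.symm, hs]
    · rw [Nat.succ_mul a]
      omega
    · funext r
      by_cases hr : r = 1
      · subst hr; simp [h1.symm, rangeCode, List.range_succ]
      by_cases hrd : r = d
      · subst hrd; simp [hr]
      by_cases hr6 : r = 6
      · subst hr6; simp [hrd, List.replicate_succ']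
      by_cases hr0 : r = 0
      · subst hr0; simp [hrd]
      simp [hr, hrd, hr6, hr0]

lemma exec_emitRange {d : ℕ} (h0 : d ≠ 0) (h1 : d ≠ 1) (h3 : d ≠ 3) (h6 : d ≠ 6)
    (s a b : ℕ) (hb : s + a ≤ b) (σ : ℕ → List Bool) (hN : σ 0 = List.replicate a true)
    (hd : σ d = List.replicate (s + a) true) (hs : σ 3 = []) (hs6 : σ 6 = []) :
    Exec O (emitRange d) σ (a * (8 * b + 12) + 2)
      (Function.update (Function.update σ d (List.replicate s true)) 1
        (rangeCode s a ++ σ 1)) := by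
  refine (Exec.seq (exec_emitRangeLoop h0 h1 h3 h6 s a b hb σ hN hd hs)
    (exec_mv (r := 6) (s := 0) (by decide) _)).congr rfl ?_ ?_
  · simp [hs6, h6.symm]
    ring_nf
    omega
  · funext r
    by_cases hr : r = 1
    · subst hr; simp
    by_cases hrd : r = d
    · subst hrd; simp [hr, h0, h6]
    by_cases hr6 : r = 6
    · subst hr6; simp [hrd, hs6]
    by_cases hr0 : r = 0
    · subst hr0; simp [hrd, hN, h6.symm, hs6]
    simp [hr, hrd, hr6, hr0]

/-- The code of the oracle gate of run `i`. -/
def oracleCode (m n i : ℕ) : List Bool :=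
  [true, false, false] ++ (rangeCode (n * i) n ++ [false]) ++
    (rangeCode (m * n + n * i) n ++ [false])

/-- Emit the codes of the oracle gates, as many as register `7` has entries. -/
def emitOracles : Prog :=
  .loop 7 (block [.pop 7, .push 1 false, emitRange 4, .push 1 false, emitRange 5, .push 1 false,
    .push 1 false, .push 1 true])

lemma exec_emitOracles (m n i b : ℕ) (hb : m * n + n * i ≤ b) (out c e w : List Bool) :
    Exec O emitOracles (st [List.replicate n true, out, c, [], List.replicate (m * n + n * i) true,
        List.replicate (n * i) true, [], List.replicate i true, w, e])
      (i * (n * (16 * b + 24) + 11) + 1)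
      (st [List.replicate n true, (List.range i).flatMap (oracleCode m n) ++ out, c, [],
        List.replicate (m * n) true, [], [], [], w, e]) := by
  induction i generalizing out with
  | zero => exact (Exec.loopDone (by simp)).congr rfl (by simp) (by simp)
  | succ i ih =>
    have hni : n * (i + 1) = n * i + n := Nat.mul_succ n i
    refine (Exec.loopStep (by simp) (Exec.block_cons Exec.pop (Exec.block_cons Exec.push
      (Exec.block_cons (exec_emitRange (d := 4) (by decide) (by decide) (by decide) (by decide)
        (m * n + n * i) n b (by omega) _ ?_ ?_ ?_ ?_)
      (Exec.block_cons Exec.push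
      (Exec.block_cons (exec_emitRange (d := 5) (by decide) (by decide) (by decide) (by decide)
        (n * i) n b (by omega) _ ?_ ?_ ?_ ?_)
      (Exec.block_cons Exec.push (Exec.block_cons Exec.push (Exec.block_single Exec.push))))))))
      ((ih (by omega) (oracleCode m n i ++ out)).congr ?_ le_rfl rfl)).congr rfl ?_ ?_
    · simp
    · simp [hni, Nat.add_assoc]
    · simp
    · simp
    · simp
    · simp [hni]
    · simp
    · simp
    · simp [oracleCode, List.replicate_succ]
    · ring_nf
      omega
    · simp [List.range_succ]

/-- Fill the counters: with `n` entries in register `0` and `m` in register `6`, there are `m * n`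
in registers `2`, `5`, `9`, twice as many in `4` and `8`, and `m` in `7`. -/
def countersProg : Prog :=
  .loop 6 (block [.pop 6, .push 7 true, .loop 0 (block [.pop 0, .push 3 true, .push 2 true,
    .push 4 true, .push 4 true, .push 5 true, .push 8 true, .push 8 true, .push 9 true]), mv 3 0])

lemma exec_countersLoop (n a b : ℕ) (T M R : List Bool) :
    Exec O (.loop 0 (block [.pop 0, .push 3 true, .push 2 true,
      .push 4 true, .push 4 true, .push 5 true, .push 8 true, .push 8 true, .push 9 true]))
      (st [List.replicate n true, [], List.replicate a true, T, List.replicate b true,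
        List.replicate a true, M, R, List.replicate b true, List.replicate a true]) (10 * n + 1)
      (st [[], [], List.replicate (n + a) true, List.replicate n true ++ T,
        List.replicate (2 * n + b) true, List.replicate (n + a) true, M, R,
        List.replicate (2 * n + b) true, List.replicate (n + a) true]) := by
  induction n generalizing a b T with
  | zero => exact (Exec.loopDone (by simp)).congr rfl (by simp) (by simp)
  | succ n ih =>
    refine (Exec.loopStep (by simp) ((exec_straight (k := 10) rfl rfl).1.congr rfl
      (τ' := st [List.replicate n true, [], List.replicate (a + 1) true, true :: T,
        List.replicate (b + 2) true, List.replicate (a + 1) true, M, R,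
        List.replicate (b + 2) true, List.replicate (a + 1) true]) le_rfl rfl)
      (ih (a + 1) (b + 2) (true :: T))).congr rfl ?_ ?_
    · simp [straightCost, block]
      omega
    · have h1 : n + (a + 1) = n + 1 + a := by ring
      have h2 : 2 * n + (b + 2) = 2 * (n + 1) + b := by ring
      rw [h1, h2, List.replicate_succ' (n := n)]
      simp

lemma exec_countersProg (m n a b r : ℕ) :
    Exec O countersProg (st [List.replicate n true, [], List.replicate a true, [],
        List.replicate b true, List.replicate a true, List.replicate m true,
        List.replicate r true, List.replicate b true, List.replicate a true])
      (m * (14 * n + 5) + 1)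
      (st [List.replicate n true, [], List.replicate (m * n + a) true, [],
        List.replicate (m * n + m * n + b) true, List.replicate (m * n + a) true, [],
        List.replicate (m + r) true, List.replicate (m * n + m * n + b) true,
        List.replicate (m * n + a) true]) := by
  induction m generalizing a b r with
  | zero => exact (Exec.loopDone (by simp)).congr rfl (by simp) (by simp)
  | succ m ih =>
    refine (Exec.loopStep (by simp) (Exec.block_cons Exec.pop (Exec.block_cons Exec.push
      (Exec.block_cons ((exec_countersLoop n a b [] (List.replicate m true)
        (List.replicate (r + 1) true)).congr ?_ le_rfl rfl)
      (Exec.block_single (exec_mv (r := 3) (s := 0) (by decide) _)))))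
      ((ih (n + a) (2 * n + b) (r + 1)).congr ?_ le_rfl rfl)).congr rfl ?_ ?_
    · simp [List.replicate_succ]
    · simp
    · simp
      rw [Nat.succ_mul m]
      omega
    · have h1 : m * n + (n + a) = (m + 1) * n + a := by ring
      have h2 : m * n + m * n + (2 * n + b) = (m + 1) * n + (m + 1) * n + b := by ring
      have h3 : m + (r + 1) = m + 1 + r := by ring
      rw [h1, h2, h3]

/-- Write the reversed code of the circuit of Simon's algorithm for strings of the length of
register `0` into register `1`: the code is written from its end to its beginning. -/
def simonPreMain : Prog :=
  .seq (block [.loop 0 (block [.pop 0, .push 3 true, .push 6 true]), mv 3 0, .push 6 true,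
    .push 6 true]) (block [countersProg, emitHad 2, emitOracles, emitHad 9, emitUnary 8])

/-- Write the code of the circuit of Simon's algorithm for strings of the length of
register `0`. -/
def simonPre : Prog := .seq simonPreMain (block [mv 1 3, clear 0, mv 3 0])

/-- The code of the circuit of Simon's algorithm. -/
def simonCode (m n : ℕ) : List Bool :=
  unary (m * n + m * n) ++ (hadCode (m * n) ++ ((List.range m).flatMap (oracleCode m n) ++
    hadCode (m * n)))

lemma flatMap_finRange {β : Type*} (k : ℕ) (g : ℕ → List β) :
    (List.finRange k).flatMap (fun i : Fin k => g i) = (List.range k).flatMap g := by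
  rw [← List.map_coe_finRange_eq_range, List.flatMap_map]

lemma wiresCode_eq {w : ℕ} (l : List (Fin w)) :
    wiresCode l = l.flatMap (fun k : Fin w => true :: unary k) ++ [false] := by
  simp [wiresCode, List.flatMap_assoc]

lemma code_simonCircuit (m n : ℕ) : (simonCircuit m n).code = simonCode m n := by
  have h1 : ((queryWires m n).map Gate.had).flatMap Gate.code = hadCode (m * n) := by
    rw [queryWires, List.flatMap_map, List.flatMap_map, hadCode, ← flatMap_finRange]
    rfl
  have h2 : ((List.finRange m).map (runGate m n)).flatMap Gate.code =
      (List.range m).flatMap (oracleCode m n) := by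
    rw [List.flatMap_map, ← flatMap_finRange]
    refine congrArg (fun g => (List.finRange m).flatMap g) (funext fun i => ?_)
    have hin : (List.ofFn (inWire m n i)).flatMap (fun k : Fin (m * n + m * n) => true :: unary k) =
        rangeCode (n * i) n := by
      rw [List.ofFn_eq_map, List.flatMap_map, rangeCode, ← flatMap_finRange]
      refine congrArg (fun g => (List.finRange n).flatMap g) (funext fun j => ?_)
      simp [inWire, Nat.add_comm]
    have hout : (List.ofFn (outWire m n i)).flatMap (fun k : Fin (m * n + m * n) => true :: unary k) =
        rangeCode (m * n + n * i) n := by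
      rw [List.ofFn_eq_map, List.flatMap_map, rangeCode, ← flatMap_finRange]
      refine congrArg (fun g => (List.finRange n).flatMap g) (funext fun j => ?_)
      simp [outWire, Nat.add_comm, Nat.add_left_comm]
    simp only [runGate, Gate.code, wiresCode_eq, oracleCode, hin, hout]
  have h3 : (simonCircuit m n).code = unary (m * n + m * n) ++
    ((queryWires m n).map Gate.had ++ (List.finRange m).map (runGate m n) ++
      (queryWires m n).map Gate.had).flatMap Gate.code := rfl
  rw [h3, List.flatMap_append, List.flatMap_append, h1, h2, List.append_assoc, simonCode]

lemma Run.length_le {p : Prog} {σ τ : ℕ → List Bool} {t : ℕ} (h : Run O p σ t τ) (r : ℕ) :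
    (τ r).length ≤ (σ r).length + t := by
  induction h with
  | skip => omega
  | push σ s b =>
    by_cases h : r = s
    · subst h; simp
    · simp [h]
  | pop σ s =>
    by_cases h : r = s
    · subst h; simp; omega
    · simp [h]
  | query σ q s =>
    by_cases h : r = s
    · subst h; simp; omega
    · simp [h]
  | seq _ _ ih₁ ih₂ => omega
  | branchEmpty _ _ ih => omega
  | branchFalse _ _ ih => omega
  | branchTrue _ _ ih => omega
  | loopDone _ => omega
  | loopStep _ _ _ ih₁ ih₂ => omega

lemma exec_prepLoop (x T M : List Bool) :
    Exec O (.loop 0 (block [.pop 0, .push 3 true, .push 6 true]))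
      (st [x, [], [], T, [], [], M, [], [], []]) (4 * x.length + 1)
      (st [[], [], [], List.replicate x.length true ++ T, [], [],
        List.replicate x.length true ++ M, [], [], []]) := by
  induction x generalizing T M with
  | nil => exact (Exec.loopDone (by simp)).congr rfl (by simp) (by simp)
  | cons a x ih =>
    refine (Exec.loopStep (by simp) ((exec_straight (k := 10) rfl rfl).1.congr rfl
      (τ' := st [x, [], [], true :: T, [], [], true :: M, [], [], []]) le_rfl rfl)
      (ih (true :: T) (true :: M))).congr rfl ?_ ?_
    · simp [straightCost, block]
      omega
    · simp [List.replicate_succ']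

/-- A bound for the running time of `simonPreMain`, with `K` the number of query wires. -/
def simonPreBound (n m K : ℕ) : ℕ :=
  8 * n + 4 + (m * (14 * n + 5) + 1 + (K * (8 * K + 8) + 1 + (m * (n * (16 * (2 * K) + 24) + 11) +
    1 + (K * (8 * K + 8) + 1 + (8 * (2 * K) + 3)))))

lemma exec_simonPreMain (x : List Bool) :
    Exec O simonPreMain (inputStore x [])
      (simonPreBound x.length (x.length + 2) ((x.length + 2) * x.length))
      (st [List.replicate x.length true, simonCode (x.length + 2) x.length, [], [],
        List.replicate ((x.length + 2) * x.length) true, [], [], [],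
        List.replicate ((x.length + 2) * x.length + (x.length + 2) * x.length) true, []]) := by
  have hA : Exec O (block [.loop 0 (block [.pop 0, .push 3 true, .push 6 true]), mv 3 0,
      .push 6 true, .push 6 true]) (inputStore x []) (8 * x.length + 4)
      (st [List.replicate x.length true, [], [], [], [], [], List.replicate (x.length + 2) true,
        [], [], []]) := by
    refine (Exec.block_cons (exec_prepLoop x [] []) (Exec.block_cons
      (exec_mv (r := 3) (s := 0) (by decide) _) (Exec.block_cons Exec.push
      (Exec.block_single Exec.push)))).congr (inputStore_eq_st _ _ 8).symm ?_ ?_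
    · simp
      omega
    · simp [List.replicate_succ]
  refine hA.seq ?_
  generalize x.length = n
  generalize n + 2 = m
  have h9 := exec_emitHad (O := O) (c := 9) (by decide) (by decide) (m * n) (m * n) le_rfl
    (st [List.replicate n true, (List.range m).flatMap (oracleCode m n) ++ hadCode (m * n), [], [],
      List.replicate (m * n) true, [], [], [], List.replicate (m * n + m * n) true,
      List.replicate (m * n) true]) (by simp) (by simp)
  have h8 := exec_emitUnary (O := O) (c := 8) (by decide) (by decide) (m * n + m * n)
    (st [List.replicate n true, hadCode (m * n) ++ ((List.range m).flatMap (oracleCode m n) ++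
      hadCode (m * n)), [], [], List.replicate (m * n) true, [], [], [],
      List.replicate (m * n + m * n) true, []]) (by simp) (by simp)
  have h2 := exec_emitHad (O := O) (c := 2) (by decide) (by decide) (m * n) (m * n) le_rfl
    (st [List.replicate n true, [], List.replicate (m * n) true, [],
      List.replicate (m * n + n * m) true, List.replicate (n * m) true, [], List.replicate m true,
      List.replicate (m * n + m * n) true, List.replicate (m * n) true]) (by simp) (by simp)
  have hmn : n * m = m * n := Nat.mul_comm n m
  refine Exec.block_cons ((exec_countersProg m n 0 0 0).congr (by simp) le_rfl rfl)
    (Exec.block_cons (h2.congr (by simp [hmn]) le_rfl rfl)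
    (Exec.block_cons ((exec_emitOracles m n m (2 * (m * n)) (by omega) (hadCode (m * n)) []
      (List.replicate (m * n) true) (List.replicate (m * n + m * n) true)).congr
      (by simp) (T' := m * (n * (16 * (2 * (m * n)) + 24) + 11) + 1) (by ring_nf; omega) rfl)
    (Exec.block_cons h9 (Exec.block_single ((h8.congr (by simp) (by omega) ?_))))))
  simp [simonCode]

/-- The running time of the generation of the circuits. -/
noncomputable def preTime : Polynomial ℕ :=
  let n : Polynomial ℕ := Polynomial.X
  let m := n + 2
  let K := m * n
  9 * (8 * n + 4 + (m * (14 * n + 5) + 1 + (K * (8 * K + 8) + 1 +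
    (m * (n * (16 * (2 * K) + 24) + 11) + 1 + (K * (8 * K + 8) + 1 + (8 * (2 * K) + 3)))))) +
    2 * n + 3

lemma eval_preTime (n : ℕ) :
    preTime.eval n = 9 * simonPreBound n (n + 2) ((n + 2) * n) + 2 * n + 3 := by
  simp [preTime, simonPreBound]

lemma exec_simonPre (x : List Bool) :
    ∃ τ, Exec O simonPre (inputStore x []) (preTime.eval x.length) τ ∧
      τ 0 = simonCode (x.length + 2) x.length := by
  have h := exec_simonPreMain (O := O) x
  have hlen : (simonCode (x.length + 2) x.length).length ≤
      simonPreBound x.length (x.length + 2) ((x.length + 2) * x.length) := by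
    obtain ⟨t, ht, hr⟩ := h
    have := hr.length_le 1
    simp [inputStore] at this
    omega
  refine ⟨_, (Exec.seq h (Exec.block_cons (exec_mv (r := 1) (s := 3) (by decide) _)
    (Exec.block_cons (exec_clear _) (Exec.block_single
      (exec_mv (r := 3) (s := 0) (by decide) _))))).of_le ?_, by simp⟩
  rw [eval_preTime]
  simp
  omega

end Uniform

/-! ### Simon's algorithm -/

section Simon

variable {O : List Bool → List Bool}

/-- Programs are deterministic. -/
lemma Run.unique {p : Prog} {σ τ τ' : ℕ → List Bool} {t t' : ℕ} (h : Run O p σ t τ)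
    (h' : Run O p σ t' τ') : t = t' ∧ τ = τ' := by
  induction h generalizing t' τ' with
  | skip | push | pop | query => cases h'; exact ⟨rfl, rfl⟩
  | seq _ _ ih₁ ih₂ =>
    cases h' with
    | seq k₁ k₂ =>
      obtain ⟨rfl, rfl⟩ := ih₁ k₁
      obtain ⟨rfl, rfl⟩ := ih₂ k₂
      exact ⟨rfl, rfl⟩
  | branchEmpty h₀ _ ih | branchFalse h₀ _ ih | branchTrue h₀ _ ih =>
    cases h' with
    | branchEmpty k₀ k | branchFalse k₀ k | branchTrue k₀ k =>
      first
      | (obtain ⟨rfl, rfl⟩ := ih k; exact ⟨rfl, rfl⟩)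
      | simp [h₀] at k₀
  | loopDone h₀ =>
    cases h' with
    | loopDone => exact ⟨rfl, rfl⟩
    | loopStep k₀ => exact absurd h₀ k₀
  | loopStep h₀ _ _ ih₁ ih₂ =>
    cases h' with
    | loopDone k₀ => exact absurd k₀ h₀
    | loopStep _ k₁ k₂ =>
      obtain ⟨rfl, rfl⟩ := ih₁ k₁
      obtain ⟨rfl, rfl⟩ := ih₂ k₂
      exact ⟨rfl, rfl⟩

lemma Computes.unique {p : Prog} {x y out out' : List Bool} {T T' : ℕ}
    (h : Computes O p x y out T) (h' : Computes O p x y out' T') : out = out' := by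
  obtain ⟨σ, t, hr, -, rfl⟩ := h
  obtain ⟨σ', t', hr', -, rfl⟩ := h'
  rw [(hr.unique hr').2]

lemma bits_mem_zmultiples {n : ℕ} {z x : Bits n} :
    x ∈ AddSubgroup.zmultiples z ↔ x = 0 ∨ x = z := by
  rw [AddSubgroup.mem_zmultiples_iff]
  constructor
  · rintro ⟨k, rfl⟩
    have hz : (2 : ℤ) • z = 0 := by rw [two_zsmul, bits_add_self]
    rcases Int.even_or_odd' k with ⟨c, rfl | rfl⟩
    · left
      rw [mul_comm, mul_zsmul, hz, zsmul_zero]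
    · right
      rw [add_zsmul, mul_comm, mul_zsmul, hz, zsmul_zero, zero_add, one_zsmul]
  · rintro (rfl | rfl)
    · exact ⟨0, zero_zsmul _⟩
    · exact ⟨1, one_zsmul _⟩

lemma IsSimon.hides {n : ℕ} {f : Bits n → Bits n} {z : Bits n} (h : IsSimon f z) :
    Hides f (AddSubgroup.zmultiples z) := fun x y => by
  rw [h.2 x y, bits_mem_zmultiples, sub_eq_zero, sub_eq_iff_eq_add']

lemma IsSimon.card {n : ℕ} {f : Bits n → Bits n} {z : Bits n} (h : IsSimon f z) :
    Nat.card (AddSubgroup.zmultiples z) = 2 := by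
  rw [Nat.card_zmultiples, addOrderOf_eq_prime (by rw [two_nsmul, bits_add_self]) h.1]

lemma eq_singleton_of_listSpan_eq {n : ℕ} {z : Bits n} (hz : z ≠ 0) {L : List (Bits n)}
    (hL : listSpan L = AddSubgroup.zmultiples z) (hlen : L.length ≤ 1) : L = [z] := by
  match L, hlen with
  | [], _ =>
    have : z ∈ listSpan [] := by
      rw [hL]
      exact AddSubgroup.mem_zmultiples z
    simp [listSpan, hz] at this
  | [v], _ =>
    have hv : v ∈ AddSubgroup.zmultiples z := by
      rw [← hL]
      exact AddSubgroup.subset_closure (by simp)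
    have hz' : z ∈ AddSubgroup.zmultiples v := by
      have : listSpan [v] = AddSubgroup.zmultiples v := by
        rw [AddSubgroup.zmultiples_eq_closure, listSpan]
        congr 1
        ext
        simp
      rw [← this, hL]
      exact AddSubgroup.mem_zmultiples z
    rw [(bits_mem_zmultiples.1 hz').resolve_left hz]
  | _ :: _ :: _, h => simp at h

lemma takeBits_drop_ofFn {m n : ℕ} (y : Fin (m * n + m * n) → Bool) (i : Fin m) :
    takeBits n ((List.ofFn y).drop (i * n)) = (decode y i).2 := by
  funext j
  rw [decode_snd, takeBits, bit, List.getD_eq_getElem?_getD, List.getElem?_drop,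
    List.getElem?_ofFn]
  have h : (i : ℕ) * n + j < m * n + m * n := by
    have := (inWire m n i j).2
    simp only [inWire, Fin.val_castAdd, finProdFinEquiv_apply_val] at this
    rw [mul_comm (i : ℕ) n]
    omega
  rw [dif_pos h]
  have : (⟨(i : ℕ) * n + j, h⟩ : Fin (m * n + m * n)) = inWire m n i j := by
    ext
    simp [inWire, mul_comm, add_comm]
  rw [this, Option.getD_some]

lemma solve_eq_singleton {m n : ℕ} {f : Bits n → Bits n} {z : Bits n} (hf : IsSimon f z)
    (y : Fin (m * n + m * n) → Bool)
    (hy : ∀ x, x ∈ AddSubgroup.zmultiples z ↔ ∀ i, (decode y i).2 ⬝ᵥ x = 0) :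
    solve n m (List.ofFn y) = [z] := by
  have hspan : listSpan (solve n m (List.ofFn y)) = AddSubgroup.zmultiples z := by
    ext x
    rw [mem_listSpan_solve, hy]
    constructor
    · intro h i
      rw [← takeBits_drop_ofFn]
      exact h i i.2
    · intro h i hi
      have := takeBits_drop_ofFn y ⟨i, hi⟩
      rw [this]
      exact h _
  refine eq_singleton_of_listSpan_eq hf.1 hspan ?_
  have := two_pow_length_solve_le (n := n) m (List.ofFn y)
  rw [hspan, hf.card] at this
  by_contra hlt
  have h4 : 2 ^ 2 ≤ 2 ^ (solve n m (List.ofFn y)).length :=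
    Nat.pow_le_pow_right (by norm_num) (by omega)
  omega

lemma oracleOf_toStr (f : ∀ n, Bits n → Bits n) {n : ℕ} (v : Bits n) :
    oracleOf f (toStr v) = toStr (f n v) := by
  have key : ∀ (l : List Bool) (h : l.length = n), oracleOf f l =
      toStr (f n fun i => if l.get (i.cast h.symm) then 1 else 0) := by
    rintro l rfl
    rfl
  rw [key (toStr v) (length_toStr v)]
  congr 2
  funext i
  have hget : (toStr v).get (i.cast (length_toStr v).symm) = decide (v i = 1) := by
    simp only [toStr, List.get_eq_getElem, List.getElem_ofFn]
    rfl
  rw [hget]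
  rcases zmod_two_eq_zero_or_one (v i) with h | h <;> simp [h]

/-- The measured bits lead to the solution, except with probability at most `1/4`. -/
lemma three_fourths_le_sum_prob (f : ∀ n, Bits n → Bits n) {n : ℕ} {z : Bits n}
    (hf : IsSimon (f n) z) (Q : (Fin ((n + 2) * n + (n + 2) * n) → Bool) → Prop)
    [DecidablePred Q] (hQ : ∀ y, solve n (n + 2) (List.ofFn y) = [z] → Q y) :
    3 / 4 ≤ ∑ y, if Q y then (simonCircuit (n + 2) n).prob (oracleOf f) y else 0 := by
  classical
  have h := one_sub_le_sum_orthogonal_eq hf.hides (n + 2) (fun ω => Q (decode.symm ω))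
    fun ω hω => hQ _ (solve_eq_singleton hf _ fun x => by
      rw [hω x, Equiv.apply_symm_apply])
  have h1 : (1 : ℝ) - 2 ^ n / 2 ^ (n + 2) = 3 / 4 := by
    rw [pow_add]
    field_simp
    norm_num
  rw [h1] at h
  refine h.trans (le_of_eq ?_)
  refine Fintype.sum_equiv decode.symm _ _ fun ω => ?_
  rw [simonCircuit_prob (oracleOf_toStr f), Equiv.apply_symm_apply]

lemma sum_prob_eq_one (f : ∀ n, Bits n → Bits n) {n m : ℕ} {z : Bits n}
    (hf : IsSimon (f n) z) : ∑ y, (simonCircuit m n).prob (oracleOf f) y = 1 := by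
  have h : ∑ ω : Fin m → Bits n × Bits n,
      ∏ i, subroutineProb (f n) (ω i).1 (bitCharState (ω i).2) = 1 := by
    rw [← Fintype.sum_pow (fun ω : Bits n × Bits n =>
      subroutineProb (f n) ω.1 (bitCharState ω.2)), sum_subroutineProb hf.hides, one_pow]
  rw [← h]
  exact Fintype.sum_equiv decode _ _ fun y => simonCircuit_prob (oracleOf_toStr f) y

/-- The running time of `simonPost`. -/
noncomputable def postTime : Polynomial ℕ :=
  let n : Polynomial ℕ := Polynomial.X
  8 * n + 4 + (16 * n * n + 20 * n + 8 + (n + 2) * (38 * n * n + 29 * n + 10))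

lemma exec_simonPost_postTime (x S : List Bool) :
    ∃ L, Exec O simonPost (inputStore x S) (postTime.eval x.length)
      (st ((solve x.length (x.length + 2) S).flatMap toStr :: L)) := by
  obtain ⟨L, h⟩ := exec_simonPost (O := O) x S
  exact ⟨L, h.of_le (by simp [postTime])⟩

/-- The elimination for Simon's problem, followed by the extraction of the first bit. -/
def firstBitPost : Prog :=
  .seq simonPost (.branch 0 .skip (.seq (clear 0) (.push 0 false)) (.seq (clear 0) (.push 0 true)))

lemma exec_firstBitPost (x S : List Bool) :
    ∃ τ, Exec O firstBitPost (inputStore x S) (3 * postTime.eval x.length + 2 * x.length + 4) τ ∧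
      τ 0 = ((solve x.length (x.length + 2) S).flatMap toStr).take 1 := by
  obtain ⟨L, h⟩ := exec_simonPost_postTime (O := O) x S
  generalize (solve x.length (x.length + 2) S).flatMap toStr = l at h ⊢
  have hlen : l.length ≤ x.length + postTime.eval x.length := by
    obtain ⟨t, ht, hr⟩ := h
    have := hr.length_le 0
    simp [inputStore] at this
    omega
  cases l with
  | nil => exact ⟨_, (h.seq (Exec.branchEmpty (by simp) Exec.skip)).of_le (by omega), by simp⟩
  | cons b l =>
    refine ⟨Function.update (st ((b :: l) :: L)) 0 [b],
      (h.seq (Exec.branchCons (b := b) (l := l) (T := 2 * (b :: l).length + 2) (by simp) ?_)).of_le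
        (by omega), by simp⟩
    have hc : ∀ b', Exec O (.seq (clear 0) (.push 0 b')) (st ((b :: l) :: L))
        (2 * (b :: l).length + 2) (Function.update (st ((b :: l) :: L)) 0 [b']) := fun b' =>
      (Exec.seq (exec_clear _) Exec.push).congr rfl (by simp) (by simp)
    cases b
    · exact hc false
    · exact hc true

/-- The time allowed to Simon's algorithm. -/
noncomputable def simonTime : Polynomial ℕ :=
  preTime + (3 * postTime + 2 * Polynomial.X + 4)

lemma computes_simonPre (x : List Bool) :
    Computes noOracle simonPre x [] (simonCircuit (x.length + 2) x.length).code
      (simonTime.eval x.length) := by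
  obtain ⟨τ, ⟨t, ht, hr⟩, hτ⟩ := exec_simonPre (O := noOracle) x
  refine ⟨τ, t, hr, ht.trans ?_, by rw [hτ, code_simonCircuit]⟩
  simp [simonTime]

lemma computes_simonPost (x S : List Bool) :
    Computes noOracle simonPost x S ((solve x.length (x.length + 2) S).flatMap toStr)
      (simonTime.eval x.length) := by
  obtain ⟨L, ⟨t, ht, hr⟩⟩ := exec_simonPost_postTime (O := noOracle) x S
  refine ⟨_, t, hr, ht.trans ?_, by simp⟩
  simp [simonTime]
  omega

lemma computes_firstBitPost (x S : List Bool) :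
    Computes noOracle firstBitPost x S
      (((solve x.length (x.length + 2) S).flatMap toStr).take 1) (simonTime.eval x.length) := by
  obtain ⟨τ, ⟨t, ht, hr⟩, hτ⟩ := exec_firstBitPost (O := noOracle) x S
  refine ⟨τ, t, hr, ht.trans ?_, hτ⟩
  simp [simonTime]

/-- Simon's algorithm on strings of length `n`: `n + 2` runs of the quantum subroutine, followed by
elimination. -/
noncomputable def simonAlgorithm : RealQuantumAlgorithm where
  circuit x := simonCircuit (x.length + 2) x.length
  pre := simonPre
  post := simonPost
  time := simonTime
  uniform := computes_simonPre
  post_halts x _ := ⟨_, computes_simonPost x _⟩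

/-- Simon's algorithm, with the first bit of the solution as output. -/
noncomputable def firstBitAlgorithm : RealQuantumAlgorithm where
  circuit x := simonCircuit (x.length + 2) x.length
  pre := simonPre
  post := firstBitPost
  time := simonTime
  uniform := computes_simonPre
  post_halts x _ := ⟨_, computes_firstBitPost x _⟩

lemma simonAlgorithm_outputProb (f : ∀ n, Bits n → Bits n) (x : List Bool) {z : Bits x.length}
    (hf : IsSimon (f x.length) z) :
    3 / 4 ≤ simonAlgorithm.outputProb (oracleOf f) x (toStr z) := by
  classical
  refine (three_fourths_le_sum_prob f hf (fun y => Computes noOracle simonPost x (List.ofFn y)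
    (toStr z) (simonTime.eval x.length)) fun y hy => ?_).trans (le_of_eq ?_)
  · have := computes_simonPost x (List.ofFn y)
    rw [hy] at this
    simpa using this
  · rw [RealQuantumAlgorithm.outputProb]
    refine Finset.sum_congr rfl fun y _ => ?_
    exact if_congr Iff.rfl rfl rfl

lemma firstBitAlgorithm_outputProb (f : ∀ n, Bits n → Bits n) (x : List Bool)
    {z : Bits x.length} (hf : IsSimon (f x.length) z) :
    3 / 4 ≤ firstBitAlgorithm.outputProb (oracleOf f) x ((toStr z).take 1) := by
  classical
  refine (three_fourths_le_sum_prob f hf (fun y => Computes noOracle firstBitPost x (List.ofFn y)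
    ((toStr z).take 1) (simonTime.eval x.length)) fun y hy => ?_).trans (le_of_eq ?_)
  · have := computes_firstBitPost x (List.ofFn y)
    rw [hy] at this
    simpa using this
  · rw [RealQuantumAlgorithm.outputProb]
    refine Finset.sum_congr rfl fun y _ => ?_
    exact if_congr Iff.rfl rfl rfl

lemma simon_solved (f : ∀ n, Bits n → Bits n) (n : ℕ) (z : Bits n) (hf : IsSimon (f n) z) :
    2 / 3 ≤ simonAlgorithm.outputProb (oracleOf f) (List.replicate n true) (toStr z) := by
  have key : ∀ x : List Bool, ∀ h : x.length = n,
      3 / 4 ≤ simonAlgorithm.outputProb (oracleOf f) x (toStr z) := by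
    rintro x rfl
    exact simonAlgorithm_outputProb f x hf
  linarith [key (List.replicate n true) List.length_replicate]

/-- The strings whose length `n` is such that the solution of `f n` starts with the bit `1`. -/
def firstBitLanguage (f : ∀ n, Bits n → Bits n) : Set (List Bool) :=
  {x | ∃ z, IsSimon (f x.length) z ∧ (toStr z).take 1 = [true]}

lemma firstBitLanguage_mem_BQPReal (f : ∀ n, Bits n → Bits n)
    (hf : ∀ n, 0 < n → ∃ z, IsSimon (f n) z) : firstBitLanguage f ∈ BQPReal (oracleOf f) := by
  classical
  refine ⟨firstBitAlgorithm, fun x => ⟨?_, fun hx => ?_⟩⟩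
  · rintro ⟨z, hz, h1⟩
    have := firstBitAlgorithm_outputProb f x hz
    rw [h1] at this
    linarith
  · rcases Nat.eq_zero_or_pos x.length with h0 | hpos
    · -- With no wires to measure the output is empty.
      rw [RealQuantumAlgorithm.outputProb, Finset.sum_eq_zero]
      · norm_num
      · intro y _
        rw [if_neg]
        intro h
        have h1 := h.unique (computes_firstBitPost x (List.ofFn y))
        have h2 : ((solve x.length (x.length + 2) (List.ofFn y)).flatMap toStr).length = 0 := by
          rw [length_flatMap_toStr, h0, mul_zero]
        rw [List.length_eq_zero_iff.1 h2] at h1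
        simp at h1
    · obtain ⟨z, hz⟩ := hf _ hpos
      have hne : (toStr z).take 1 ≠ [true] := fun h => hx ⟨z, hz, h⟩
      have h1 := firstBitAlgorithm_outputProb f x hz
      have h2 : firstBitAlgorithm.outputProb (oracleOf f) x ((toStr z).take 1) +
          firstBitAlgorithm.outputProb (oracleOf f) x [true] ≤ 1 := by
        rw [← sum_prob_eq_one f (m := x.length + 2) hz, RealQuantumAlgorithm.outputProb,
          RealQuantumAlgorithm.outputProb, ← Finset.sum_add_distrib]
        refine Finset.sum_le_sum fun y _ => ?_
        have h0 : 0 ≤ (simonCircuit (x.length + 2) x.length).prob (oracleOf f) y := sq_nonneg _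
        split_ifs with ha hb hb
        · exact absurd (ha.unique hb) hne
        · rw [add_zero]
          exact le_rfl
        · rw [zero_add]
          exact le_rfl
        · rw [add_zero]
          exact h0
      linarith

end Simon

/-! ### Classical query complexity of Simon's problem -/

section Queries

variable {O O' : List Bool → List Bool}

/-- A run depends on the oracle only through the answers to queries that it has time to write. -/
lemma Run.congr_oracle {p : Prog} {σ τ : ℕ → List Bool} {t : ℕ} (h : Run O p σ t τ)
    (hO : ∀ s : List Bool, s.length ≤ t → O' s = O s) : Run O' p σ t τ := by
  induction h with
  | skip σ => exact .skip σ
  | push σ r b => exact .push σ r b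
  | pop σ r => exact .pop σ r
  | query σ r s =>
    rw [← hO (σ r) (by omega)]
    exact .query σ r s
  | seq _ _ ih₁ ih₂ =>
    exact .seq (ih₁ fun s hs => hO s (by omega)) (ih₂ fun s hs => hO s (by omega))
  | branchEmpty h _ ih => exact .branchEmpty h (ih fun s hs => hO s (by omega))
  | branchFalse h _ ih => exact .branchFalse h (ih fun s hs => hO s (by omega))
  | branchTrue h _ ih => exact .branchTrue h (ih fun s hs => hO s (by omega))
  | loopDone h => exact .loopDone h
  | loopStep h _ _ ih₁ ih₂ =>
    exact .loopStep h (ih₁ fun s hs => hO s (by omega)) (ih₂ fun s hs => hO s (by omega))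

lemma Run.pos {p : Prog} {σ τ : ℕ → List Bool} {t : ℕ} (h : Run O p σ t τ) : 0 < t := by
  induction h <;> omega

lemma Computes.congr_oracle {p : Prog} {x y out : List Bool} {T : ℕ}
    (h : Computes O p x y out T) (hO : ∀ s : List Bool, s.length ≤ T → O' s = O s) :
    Computes O' p x y out T := by
  obtain ⟨σ, t, hr, ht, ho⟩ := h
  exact ⟨σ, t, hr.congr_oracle fun s hs => hO s (hs.trans ht), ht, ho⟩

/-- One round of a loop on register `r` with body `F`; nothing happens if the register is empty. -/
def loopRound (r : ℕ) (F : List (List Bool) × (ℕ → List Bool) → List (List Bool) × (ℕ → List Bool))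
    (c : List (List Bool) × (ℕ → List Bool)) : List (List Bool) × (ℕ → List Bool) :=
  if c.2 r = [] then c else F c

/-- A total interpreter that records the queries, most recent first. It ignores queries after the
first `T` and ends every loop after `T` rounds, so that it agrees with `Run` on computations of at
most `T` steps but makes at most `T` queries on every program and oracle. -/
def interp (O : List Bool → List Bool) (T : ℕ) :
    Prog → List (List Bool) × (ℕ → List Bool) → List (List Bool) × (ℕ → List Bool)
  | .skip, c => c
  | .push r b, c => (c.1, Function.update c.2 r (b :: c.2 r))
  | .pop r, c => (c.1, Function.update c.2 r (c.2 r).tail)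
  | .query r s, c =>
    if c.1.length < T then (c.2 r :: c.1, Function.update c.2 s (O (c.2 r))) else c
  | .seq p q, c => interp O T q (interp O T p c)
  | .branch r p p₀ p₁, c =>
    match c.2 r with
    | [] => interp O T p c
    | false :: _ => interp O T p₀ c
    | true :: _ => interp O T p₁ c
  | .loop r p, c => (loopRound r (interp O T p))^[T] c

lemma iterate_loopRound_of_eq_nil {r : ℕ}
    {F : List (List Bool) × (ℕ → List Bool) → List (List Bool) × (ℕ → List Bool)}
    {c : List (List Bool) × (ℕ → List Bool)} (h : c.2 r = []) (j : ℕ) :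
    (loopRound r F)^[j] c = c :=
  Function.iterate_fixed (by rw [loopRound, if_pos h]) j

/-- The interpreter agrees with runs that are short enough. For a loop of `t` steps any number
`j ≥ t - 1` of rounds is enough, which is the statement that goes through the induction. -/
lemma Run.interp_eq {T : ℕ} {p : Prog} {σ τ : ℕ → List Bool} {t : ℕ} (h : Run O p σ t τ) :
    (∀ Q : List (List Bool), Q.length + t ≤ T →
      (interp O T p (Q, σ)).2 = τ ∧ (interp O T p (Q, σ)).1.length ≤ Q.length + t) ∧
    ∀ r q, p = .loop r q → ∀ j, t ≤ j + 1 → ∀ Q : List (List Bool), Q.length + t ≤ T →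
      ((loopRound r (interp O T q))^[j] (Q, σ)).2 = τ ∧
      ((loopRound r (interp O T q))^[j] (Q, σ)).1.length ≤ Q.length + t := by
  induction h with
  | skip | push | pop => exact ⟨fun Q hQ => by simp [interp], by simp⟩
  | query σ r s =>
    refine ⟨fun Q hQ => ?_, by simp⟩
    have : Q.length < T := by omega
    simp only [interp, this, if_true, List.length_cons, true_and]
    omega
  | @seq σ τ υ p q t₁ t₂ _ _ ih₁ ih₂ =>
    refine ⟨fun Q hQ => ?_, by simp⟩
    obtain ⟨h₁, h₂⟩ := ih₁.1 Q (by omega)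
    have := ih₂.1 (interp O T p (Q, σ)).1 (by omega)
    rw [← h₁] at this
    exact ⟨this.1, this.2.trans (by omega)⟩
  | branchEmpty h _ ih | branchFalse h _ ih | branchTrue h _ ih =>
    refine ⟨fun Q hQ => ?_, by simp⟩
    obtain ⟨h₁, h₂⟩ := ih.1 Q (by omega)
    simp only [interp, h]
    exact ⟨h₁, h₂.trans (by omega)⟩
  | loopDone h =>
    have key : ∀ j q, ∀ Q : List (List Bool), (loopRound _ (interp O T q))^[j] (Q, _) = (Q, _) :=
      fun j q Q => iterate_loopRound_of_eq_nil (c := (Q, _)) h j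
    refine ⟨fun Q hQ => ?_, ?_⟩
    · rw [interp, key]
      exact ⟨rfl, by simp⟩
    · rintro r q ⟨⟩ j - Q -
      rw [key]
      exact ⟨rfl, by simp⟩
  | @loopStep σ τ υ r p t₁ t₂ h hr₁ _ ih₁ ih₂ =>
    have key : ∀ j, 1 + t₁ + t₂ ≤ j + 1 → ∀ Q : List (List Bool), Q.length + (1 + t₁ + t₂) ≤ T →
        ((loopRound r (interp O T p))^[j] (Q, σ)).2 = υ ∧
        ((loopRound r (interp O T p))^[j] (Q, σ)).1.length ≤ Q.length + (1 + t₁ + t₂) := by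
      intro j hj Q hQ
      have ht := hr₁.pos
      obtain ⟨j, rfl⟩ : ∃ i, j = i + 1 := ⟨j - 1, by omega⟩
      obtain ⟨h₁, h₂⟩ := ih₁.1 Q (by omega)
      rw [Function.iterate_succ_apply, loopRound, if_neg (by exact h)]
      have := ih₂.2 r p rfl j (by omega) (interp O T p (Q, σ)).1 (by omega)
      rw [← h₁] at this
      exact ⟨this.1, this.2.trans (by omega)⟩
    refine ⟨fun Q hQ => ?_, ?_⟩
    · rw [interp]
      exact key T (by omega) Q hQ
    · rintro r q ⟨⟩
      exact key

lemma iterate_loopRound_induction {r : ℕ}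
    {F : List (List Bool) × (ℕ → List Bool) → List (List Bool) × (ℕ → List Bool)}
    (P : List (List Bool) × (ℕ → List Bool) → Prop) (hF : ∀ c, P c → P (F c)) (j : ℕ)
    {c : List (List Bool) × (ℕ → List Bool)} (hc : P c) : P ((loopRound r F)^[j] c) := by
  induction j generalizing c with
  | zero => exact hc
  | succ j ih =>
    rw [Function.iterate_succ_apply]
    refine ih ?_
    rw [loopRound]
    split_ifs
    · exact hc
    · exact hF c hc

/-- A property of configurations that queries preserve as long as there are fewer than `T`, and
that depends on the recorded queries only, is preserved by the interpreter. -/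
lemma interp_induction {T : ℕ} (P : List (List Bool) → Prop)
    (hP : ∀ Q s, Q.length < T → P Q → P (s :: Q)) (p : Prog)
    {c : List (List Bool) × (ℕ → List Bool)} (hc : P c.1) : P (interp O T p c).1 := by
  induction p generalizing c with
  | skip | push | pop => exact hc
  | query r s =>
    rw [interp]
    split_ifs with h
    · exact hP _ _ h hc
    · exact hc
  | seq p q ih₁ ih₂ => exact ih₂ (ih₁ hc)
  | branch r p p₀ p₁ ih ih₀ ih₁ =>
    rw [interp]
    split
    · exact ih hc
    · exact ih₀ hc
    · exact ih₁ hc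
  | loop r p ih => exact iterate_loopRound_induction (fun c => P c.1) (fun c => ih) T hc

lemma length_interp_le {T : ℕ} (p : Prog) {c : List (List Bool) × (ℕ → List Bool)}
    (hc : c.1.length ≤ T) : (interp O T p c).1.length ≤ T :=
  interp_induction (fun Q => Q.length ≤ T) (fun _ _ h _ => h) p hc

lemma subset_interp (T : ℕ) (p : Prog) (c : List (List Bool) × (ℕ → List Bool)) :
    c.1 ⊆ (interp O T p c).1 :=
  interp_induction (c.1 ⊆ ·) (fun _ _ _ h => List.subset_cons_of_subset _ h) p (List.Subset.refl _)

/-- The interpreter depends on the oracle only through the answers to the recorded queries. -/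
lemma interp_congr_oracle (T : ℕ) (p : Prog) (c : List (List Bool) × (ℕ → List Bool))
    (hO : ∀ s ∈ (interp O T p c).1, O' s = O s) : interp O' T p c = interp O T p c := by
  induction p generalizing c with
  | skip | push | pop => rfl
  | query r s =>
    rw [interp] at hO ⊢
    rw [interp]
    split_ifs with h
    · rw [if_pos h] at hO
      rw [hO (c.2 r) (by simp)]
    · rfl
  | seq p q ih₁ ih₂ =>
    rw [interp] at hO ⊢
    rw [interp, ih₁ c fun s hs => hO s (subset_interp T q _ hs)]
    exact ih₂ _ hO
  | branch r p p₀ p₁ ih ih₀ ih₁ =>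
    rw [interp] at hO ⊢
    rw [interp]
    split
    · rename_i h
      exact ih c (by simpa only [h] using hO)
    · rename_i h
      exact ih₀ c (by simpa only [h] using hO)
    · rename_i h
      exact ih₁ c (by simpa only [h] using hO)
  | loop r p ih =>
    rw [interp] at hO ⊢
    rw [interp]
    have key : ∀ j c, (∀ s ∈ ((loopRound r (interp O T p))^[j] c).1, O' s = O s) →
        (loopRound r (interp O' T p))^[j] c = (loopRound r (interp O T p))^[j] c := by
      intro j
      induction j with
      | zero => exact fun _ _ => rfl
      | succ j ihj =>
        intro c hc
        rw [Function.iterate_succ_apply] at hc ⊢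
        rw [Function.iterate_succ_apply, ← ihj _ hc]
        congr 1
        rw [loopRound, loopRound]
        split_ifs with h
        · rfl
        · rw [loopRound, if_neg h] at hc
          exact ih c fun s hs => hc s (iterate_loopRound_induction
            ((interp O T p c).1 ⊆ ·.1) (fun d hd => List.Subset.trans hd (subset_interp T p d)) j
            (List.Subset.refl _) hs)
    exact key T c hO

end Queries

section Counting

lemma exists_perm_eq_of_injOn {A : Type*} [Fintype A] [DecidableEq A] {s : Finset A} {f : A → A}
    (hf : Set.InjOn f s) : ∃ σ : Equiv.Perm A, ∀ v ∈ s, σ v = f v := by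
  obtain ⟨g, hg⟩ := Finset.exists_equiv_extend_of_card_eq (t := Finset.univ)
    Finset.card_univ.symm (Finset.subset_univ _) hf
  exact ⟨g.trans (Equiv.subtypeUnivEquiv Finset.mem_univ), hg⟩

/-- An algorithm making at most `T` queries `Q g` to a function `g` cannot decide a balanced
property `S` of `z` from `π ∘ rep z`, where `rep z` identifies points only if they differ by `z`:
unless `z` is a difference of two queries to the permutation `π`, relabelling `π` gives a
permutation `π'` such that `π' ∘ rep z` answers these queries as `π` does. As `π` and `z` can be
recovered from `π'` and `z`, the answer is nearly independent of `z`. -/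
lemma card_mul_card_le_card_wrong_add {A : Type*} [Fintype A] [DecidableEq A]
    [AddCommGroup A]
    {rep : A → A → A} (hrep : ∀ z x y, z ≠ 0 → rep z x = rep z y → x = y ∨ z = x - y)
    {Q : (A → A) → Finset A} {acc : (A → A) → Prop}
    (hQ : ∀ g g', (∀ v ∈ Q g, g' v = g v) → Q g' = Q g ∧ (acc g' ↔ acc g))
    {T : ℕ} (hT : ∀ g, (Q g).card ≤ T) {S : A → Prop} [DecidablePred S] {m : ℕ}
    (hS : (Finset.univ.filter S).card ≤ m) (hS' : (Finset.univ.filter fun z => ¬ S z).card ≤ m)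
    [DecidablePred fun c : Equiv.Perm A × A => c.2 ≠ 0 ∧ ¬ (acc (c.1 ∘ rep c.2) ↔ S c.2)] :
    Fintype.card (Equiv.Perm A) * Fintype.card A ≤
      (Finset.univ.filter fun c : Equiv.Perm A × A =>
        c.2 ≠ 0 ∧ ¬ (acc (c.1 ∘ rep c.2) ↔ S c.2)).card +
      Fintype.card (Equiv.Perm A) * (1 + m + T ^ 2) := by
  classical
  let diff : Equiv.Perm A → Finset A := fun π => (Q π ×ˢ Q π).image fun q => q.1 - q.2
  have hdiff : ∀ π, (diff π).card ≤ T ^ 2 := fun π => by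
    refine Finset.card_image_le.trans ?_
    rw [Finset.card_product, sq]
    exact Nat.mul_le_mul (hT _) (hT _)
  have hinj : ∀ (π : Equiv.Perm A) z, z ≠ 0 → z ∉ diff π → Set.InjOn (rep z) (Q π) := by
    intro π z hz hzd x hx y hy hxy
    refine (hrep z x y hz hxy).resolve_right fun h => hzd ?_
    exact Finset.mem_image.2 ⟨(x, y), Finset.mem_product.2 ⟨hx, hy⟩, h.symm⟩
  have hex : ∀ (s : Finset A) z, ∃ σ : Equiv.Perm A,
      Set.InjOn (rep z) s → ∀ v ∈ s, σ v = rep z v := fun s z => by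
    by_cases h : Set.InjOn (rep z) s
    · obtain ⟨σ, hσ⟩ := exists_perm_eq_of_injOn h
      exact ⟨σ, fun _ => hσ⟩
    · exact ⟨1, fun h' => absurd h' h⟩
  choose sig hsig using hex
  let good := Finset.univ.filter fun c : Equiv.Perm A × A =>
    c.2 ≠ 0 ∧ c.2 ∉ diff c.1 ∧ ¬ (acc c.1 ↔ S c.2)
  have hagree : ∀ (π : Equiv.Perm A) z, z ≠ 0 → z ∉ diff π →
      Q (⇑(π * (sig (Q π) z)⁻¹) ∘ rep z) = Q π ∧
        (acc (⇑(π * (sig (Q π) z)⁻¹) ∘ rep z) ↔ acc π) := by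
    intro π z hz hzd
    refine hQ _ _ fun v hv => ?_
    rw [Function.comp_apply, ← hsig (Q π) z (hinj π z hz hzd) v hv, Equiv.Perm.mul_apply]
    exact congrArg π (Equiv.symm_apply_apply _ v)
  have hgood : good.card ≤ (Finset.univ.filter fun c : Equiv.Perm A × A =>
      c.2 ≠ 0 ∧ ¬ (acc (c.1 ∘ rep c.2) ↔ S c.2)).card := by
    refine Finset.card_le_card_of_injOn (fun c => (c.1 * (sig (Q c.1) c.2)⁻¹, c.2)) ?_ ?_
    · rintro ⟨π, z⟩ hc
      obtain ⟨hz, hzd, hacc⟩ := (Finset.mem_filter.1 hc).2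
      refine Finset.mem_coe.2 (Finset.mem_filter.2 ⟨Finset.mem_univ _, hz, ?_⟩)
      rw [(hagree π z hz hzd).2]
      exact hacc
    · rintro ⟨π, z⟩ hc ⟨π', z'⟩ hc' h
      obtain ⟨hz, hzd, -⟩ := (Finset.mem_filter.1 hc).2
      obtain ⟨hz', hzd', -⟩ := (Finset.mem_filter.1 hc').2
      obtain ⟨h₁, rfl⟩ := Prod.mk.inj h
      have hQQ : Q π = Q π' := by
        rw [← (hagree π z hz hzd).1, ← (hagree π' z hz' hzd').1, h₁]
      simp only [hQQ] at h₁
      rw [mul_right_cancel h₁]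
  -- For a fixed `π` the answer is the same for all `z`, so it is right for at most `m` of them.
  have hrest : (goodᶜ).card ≤ Fintype.card (Equiv.Perm A) * (1 + m + T ^ 2) := by
    let F : Equiv.Perm A → Finset A := fun π =>
      ({0} ∪ Finset.univ.filter fun z => (acc π ↔ S z)) ∪ diff π
    have hF : ∀ π, (F π).card ≤ 1 + m + T ^ 2 := fun π => by
      refine (Finset.card_union_le _ _).trans (add_le_add ((Finset.card_union_le _ _).trans
        (add_le_add (by simp) ?_)) (hdiff π))
      by_cases h : acc π
      · simpa only [h, true_iff] using hS
      · simpa only [h, false_iff] using hS'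
    have hsub : goodᶜ ⊆ (Finset.univ.sigma F).image fun c => (c.1, c.2) := by
      rintro ⟨π, z⟩ hc
      refine Finset.mem_image.2 ⟨⟨π, z⟩, Finset.mem_sigma.2 ⟨Finset.mem_univ _, ?_⟩, rfl⟩
      simp only [good, Finset.mem_compl, Finset.mem_filter, Finset.mem_univ, true_and] at hc
      simp only [F, Finset.mem_union, Finset.mem_singleton, Finset.mem_filter, Finset.mem_univ,
        true_and]
      tauto
    refine (Finset.card_le_card hsub).trans (Finset.card_image_le.trans ?_)
    rw [Finset.card_sigma, ← Finset.card_univ, ← smul_eq_mul]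
    exact Finset.sum_le_card_nsmul _ _ _ fun π _ => hF π
  have htot : Fintype.card (Equiv.Perm A) * Fintype.card A = good.card + (goodᶜ).card := by
    rw [Finset.card_add_card_compl, Fintype.card_prod]
  omega

/-- A representative of the class of `x` modulo `z`. -/
noncomputable def cosetRep {n : ℕ} (z x : Bits n) : Bits n :=
  Quotient.out (x : Bits n ⧸ AddSubgroup.zmultiples z)

lemma cosetRep_eq_iff {n : ℕ} {z x y : Bits n} :
    cosetRep z x = cosetRep z y ↔ x = y ∨ x = y + z := by
  rw [cosetRep, cosetRep, Quotient.out_inj, QuotientAddGroup.eq, bits_mem_zmultiples,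
    neg_add_eq_zero, neg_add_eq_iff_eq_add]
  refine or_congr Iff.rfl ?_
  constructor <;> rintro rfl <;> rw [add_assoc, bits_add_self, add_zero]

lemma isSimon_perm_comp_cosetRep {n : ℕ} {z : Bits n} (hz : z ≠ 0) (π : Equiv.Perm (Bits n)) :
    IsSimon (π ∘ cosetRep z) z :=
  ⟨hz, fun x y => by rw [Function.comp_apply, Function.comp_apply, π.apply_eq_iff_eq,
    cosetRep_eq_iff]⟩

lemma IsSimon.unique {n : ℕ} {f : Bits n → Bits n} {z z' : Bits n} (h : IsSimon f z)
    (h' : IsSimon f z') : z = z' := by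
  have h0 : f z = f 0 := (h.2 z 0).2 (Or.inr (zero_add z).symm)
  rcases (h'.2 z 0).1 h0 with h1 | h1
  · exact absurd h1 h.1
  · rw [h1, zero_add]

lemma toStr_injective {n : ℕ} : Function.Injective (toStr (n := n)) := by
  intro v w h
  funext i
  have := congrFun (List.ofFn_injective h) i
  rcases zmod_two_eq_zero_or_one (v i) with hv | hv <;>
    rcases zmod_two_eq_zero_or_one (w i) with hw | hw <;> simp_all

lemma toStr_take_one {n : ℕ} (z : Bits (n + 1)) : (toStr z).take 1 = [true] ↔ z 0 = 1 := by
  rw [toStr, List.ofFn_succ, List.take_succ_cons, List.take_zero]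
  simp

lemma exists_toStr_eq {n : ℕ} {s : List Bool} (h : s.length = n) :
    ∃ v : Bits n, toStr v = s := by
  subst h
  refine ⟨fun i => if s.get i then 1 else 0, ?_⟩
  conv_rhs => rw [← List.ofFn_get s]
  rw [toStr]
  congr 1
  funext i
  cases s.get i <;> simp

lemma card_bits_eq (n : ℕ) (b : ZMod 2) :
    (Finset.univ.filter fun z : Bits (n + 1) => z 0 = b).card = 2 ^ n := by
  rw [← Fintype.card_subtype]
  let e : {z : Bits (n + 1) // z 0 = b} ≃ Bits n :=
    { toFun z := Fin.tail z.1
      invFun v := ⟨Fin.cons b v, rfl⟩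
      left_inv z := by
        ext1
        conv_rhs => rw [← Fin.cons_self_tail z.1]
        rw [z.2]
      right_inv v := Fin.tail_cons _ _ }
  rw [Fintype.card_congr e]
  simp [ZMod.card]

end Counting

/-! ### The separation -/

section Separation

/-- The condition on one input `x` in the definition of `BPP`, for a program using `R` random bits
and time `T`. -/
def DecidesAt (O : List Bool → List Bool) (L : Set (List Bool)) (p : Prog) (R T : ℕ)
    (x : List Bool) : Prop :=
  (∀ ρ : Fin R → Bool, ∃ out, Computes O p x (List.ofFn ρ) out T) ∧
  (x ∈ L → 2 / 3 ≤
    (Nat.card {ρ : Fin R → Bool // Computes O p x (List.ofFn ρ) [true] T} : ℝ) / 2 ^ R) ∧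
  (x ∉ L →
    (Nat.card {ρ : Fin R → Bool // Computes O p x (List.ofFn ρ) [true] T} : ℝ) / 2 ^ R ≤ 1 / 3)

lemma DecidesAt.congr {O O' : List Bool → List Bool} {L L' : Set (List Bool)} {p : Prog}
    {R T : ℕ} {x : List Bool} (h : DecidesAt O L p R T x) (hL : x ∈ L' ↔ x ∈ L)
    (hO : ∀ s : List Bool, s.length ≤ T → O' s = O s) : DecidesAt O' L' p R T x := by
  have key : ∀ y out, Computes O' p x y out T ↔ Computes O p x y out T := fun y out =>
    ⟨fun k => k.congr_oracle fun s hs => (hO s hs).symm, fun k => k.congr_oracle hO⟩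
  simpa only [DecidesAt, key, hL] using h

lemma oracleOf_congr {f f' : ∀ n, Bits n → Bits n} {s : List Bool}
    (h : f s.length = f' s.length) : oracleOf f s = oracleOf f' s := by
  rw [oracleOf, oracleOf, h]

lemma mem_firstBitLanguage_congr {f f' : ∀ n, Bits n → Bits n} {x : List Bool}
    (h : f x.length = f' x.length) : x ∈ firstBitLanguage f ↔ x ∈ firstBitLanguage f' := by
  rw [firstBitLanguage, firstBitLanguage, Set.mem_ofPred_eq, Set.mem_ofPred_eq, h]

lemma mem_firstBitLanguage_iff {f : ∀ n, Bits n → Bits n} {n : ℕ} {z : Bits (n + 1)}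
    (hz : IsSimon (f (n + 1)) z) {x : List Bool} (hx : x.length = n + 1) :
    x ∈ firstBitLanguage f ↔ z 0 = 1 := by
  have key : ∀ m, m = n + 1 → ((∃ w, IsSimon (f m) w ∧ (toStr w).take 1 = [true]) ↔ z 0 = 1) := by
    rintro m rfl
    constructor
    · rintro ⟨w, hw, h1⟩
      rw [hz.unique hw]
      exact (toStr_take_one w).1 h1
    · exact fun h => ⟨z, hz, (toStr_take_one z).2 h⟩
  exact key _ hx

/-- A program that halts within `T` steps computes what the interpreter says. -/
lemma computes_iff_interp {O : List Bool → List Bool} {p : Prog} {x y : List Bool} {T : ℕ}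
    (h : ∃ out, Computes O p x y out T) (out : List Bool) :
    Computes O p x y out T ↔ (interp O T p ([], inputStore x y)).2 0 = out := by
  obtain ⟨o, σ, t, hr, ht, ho⟩ := h
  rw [(hr.interp_eq.1 [] (by simpa using ht)).1]
  constructor
  · rintro ⟨σ', t', hr', -, ho'⟩
    rw [(hr.unique hr').2, ho']
  · exact fun h => ⟨σ, t, hr, ht, h⟩

lemma oracleOf_update_eq {f : ∀ n, Bits n → Bits n} {n : ℕ} {g g' : Bits n → Bits n}
    {s : List Bool} (h : ∀ v, toStr v = s → g' v = g v) :
    oracleOf (Function.update f n g') s = oracleOf (Function.update f n g) s := by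
  by_cases hs : s.length = n
  · obtain ⟨v, rfl⟩ := exists_toStr_eq hs
    rw [oracleOf_toStr, oracleOf_toStr, Function.update_self, Function.update_self, h v rfl]
  · refine oracleOf_congr ?_
    rw [Function.update_of_ne hs, Function.update_of_ne hs]

/-- A randomised program that finds the first bit of the solution of Simon's problem on `n + 1`
bits takes exponential time. -/
lemma two_pow_le_of_decidesAt {f : ∀ n, Bits n → Bits n} {n : ℕ} {p : Prog} {R T : ℕ}
    {x : List Bool} (hx : x.length = n + 1)
    (h : ∀ (g : Bits (n + 1) → Bits (n + 1)) (z : Bits (n + 1)), IsSimon g z →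
      DecidesAt (oracleOf (Function.update f (n + 1) g))
        (firstBitLanguage (Function.update f (n + 1) g)) p R T x) :
    2 ^ n ≤ 3 * (1 + T ^ 2) := by
  classical
  let cfg : (Fin R → Bool) → (Bits (n + 1) → Bits (n + 1)) →
      List (List Bool) × (ℕ → List Bool) := fun ρ g =>
    interp (oracleOf (Function.update f (n + 1) g)) T p ([], inputStore x (List.ofFn ρ))
  let acc : (Fin R → Bool) → (Bits (n + 1) → Bits (n + 1)) → Prop := fun ρ g =>
    (cfg ρ g).2 0 = [true]
  let Q : (Fin R → Bool) → (Bits (n + 1) → Bits (n + 1)) → Finset (Bits (n + 1)) := fun ρ g =>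
    Finset.univ.filter fun v => toStr v ∈ (cfg ρ g).1
  have hQ : ∀ ρ g g', (∀ v ∈ Q ρ g, g' v = g v) → Q ρ g' = Q ρ g ∧ (acc ρ g' ↔ acc ρ g) := by
    intro ρ g g' hg
    have : cfg ρ g' = cfg ρ g := interp_congr_oracle T p _ fun s hs =>
      oracleOf_update_eq fun v hv => hg v (Finset.mem_filter.2 ⟨Finset.mem_univ _, by rwa [hv]⟩)
    simp only [Q, acc, this, and_self]
  have hT : ∀ ρ g, (Q ρ g).card ≤ T := fun ρ g => by
    refine le_trans ?_ ((List.toFinset_card_le _).trans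
      (length_interp_le (O := oracleOf (Function.update f (n + 1) g)) p (c := ([], inputStore x (List.ofFn ρ))) (Nat.zero_le T)))
    refine Finset.card_le_card_of_injOn toStr (fun v hv => ?_) toStr_injective.injOn
    exact Finset.mem_coe.2 (List.mem_toFinset.2 (Finset.mem_filter.1 hv).2)
  let wrong : (Fin R → Bool) → Equiv.Perm (Bits (n + 1)) × Bits (n + 1) → Prop := fun ρ c =>
    c.2 ≠ 0 ∧ ¬ (acc ρ (c.1 ∘ cosetRep c.2) ↔ c.2 0 = 1)
  have hA : Fintype.card (Bits (n + 1)) = 2 ^ (n + 1) := by simp [ZMod.card]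
  -- For fixed random bits, the program is deterministic and often wrong.
  have h1 : ∀ ρ, Fintype.card (Equiv.Perm (Bits (n + 1))) * 2 ^ (n + 1) ≤
      (Finset.univ.filter (wrong ρ)).card +
        Fintype.card (Equiv.Perm (Bits (n + 1))) * (1 + 2 ^ n + T ^ 2) := by
    intro ρ
    have := card_mul_card_le_card_wrong_add (rep := cosetRep)
      (fun z x y _ hxy => (cosetRep_eq_iff.1 hxy).imp_right fun e => by rw [e, add_sub_cancel_left])
      (hQ ρ) (hT ρ) (S := fun z => z 0 = 1) (m := 2 ^ n)
      (card_bits_eq n 1).le (by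
        rw [← card_bits_eq n 0]
        refine (Finset.card_le_card fun z hz => ?_)
        simp only [Finset.mem_filter, Finset.mem_univ, true_and] at hz ⊢
        exact (zmod_two_eq_zero_or_one _).resolve_right hz)
    rwa [hA] at this
  -- For a fixed oracle, at most a third of the random bits may lead to a wrong answer.
  have h2 : ∀ c, 3 * (Finset.univ.filter fun ρ => wrong ρ c).card ≤ 2 ^ R := by
    rintro ⟨π, z⟩
    by_cases hz : z = 0
    · simp [wrong, hz]
    have hS := isSimon_perm_comp_cosetRep hz π
    obtain ⟨hhalt, hin, hout⟩ := h _ _ hS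
    have hmem := mem_firstBitLanguage_iff (f := Function.update f (n + 1) (π ∘ cosetRep z))
      (z := z) (by rwa [Function.update_self]) hx
    have hc : ∀ ρ : Fin R → Bool, Computes (oracleOf (Function.update f (n + 1) (π ∘ cosetRep z)))
        p x (List.ofFn ρ) [true] T ↔ acc ρ (π ∘ cosetRep z) := fun ρ =>
      computes_iff_interp (hhalt ρ) _
    have htot := Finset.card_filter_add_card_filter_not (s := Finset.univ)
      fun ρ : Fin R → Bool => acc ρ (π ∘ cosetRep z)
    rw [Finset.card_univ, Fintype.card_fun, Fintype.card_bool, Fintype.card_fin] at htot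
    have hpos : (0 : ℝ) < 2 ^ R := by positivity
    simp only [hc, hmem, Nat.card_eq_fintype_card, Fintype.card_subtype] at hin hout
    by_cases hz1 : z 0 = 1
    · have := hin hz1
      rw [le_div_iff₀ hpos] at this
      have h3 : 2 * 2 ^ R ≤
          3 * (Finset.univ.filter fun ρ => acc ρ (π ∘ cosetRep z)).card := by
        have : (2 * 2 ^ R : ℝ) ≤
            3 * (Finset.univ.filter fun ρ => acc ρ (π ∘ cosetRep z)).card := by linarith
        exact_mod_cast this
      simp only [wrong, hz, hz1, ne_eq, not_false_eq_true, iff_true, true_and]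
      omega
    · have := hout hz1
      rw [div_le_iff₀ hpos] at this
      have h3 : 3 * (Finset.univ.filter fun ρ => acc ρ (π ∘ cosetRep z)).card ≤ 2 ^ R := by
        have : (3 * (Finset.univ.filter fun ρ => acc ρ (π ∘ cosetRep z)).card : ℝ) ≤ 2 ^ R := by
          linarith
        exact_mod_cast this
      simp only [wrong, hz, hz1, ne_eq, not_false_eq_true, iff_false, not_not, true_and]
      exact h3
  have h3 := Finset.sum_card_bipartiteAbove_eq_sum_card_bipartiteBelow (s := Finset.univ)
    (t := Finset.univ) wrong
  simp only [Finset.bipartiteAbove, Finset.bipartiteBelow] at h3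
  have h4 := Finset.sum_le_sum fun ρ (_ : ρ ∈ Finset.univ) => h1 ρ
  have h5 := Finset.sum_le_sum fun c (_ : c ∈ Finset.univ) => h2 c
  rw [← Finset.mul_sum, ← h3] at h5
  rw [Finset.sum_add_distrib] at h4
  simp only [Finset.sum_const, Finset.card_univ, Fintype.card_fun, Fintype.card_bool,
    Fintype.card_fin, Fintype.card_prod, ZMod.card, smul_eq_mul] at h4 h5
  have hP : 0 < 2 ^ R * Fintype.card (Equiv.Perm (Bits (n + 1))) :=
    Nat.mul_pos (by positivity) Fintype.card_pos
  generalize Fintype.card (Equiv.Perm (Bits (n + 1))) = P at h4 h5 hP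
  generalize ∑ ρ, (Finset.univ.filter (wrong ρ)).card = W at h4 h5
  have h6 : 2 ^ R * P * (3 * 2 ^ (n + 1)) ≤
      2 ^ R * P * (2 ^ (n + 1) + 3 * (1 + 2 ^ n + T ^ 2)) := by
    nlinarith
  have h7 := Nat.le_of_mul_le_mul_left h6 hP
  rw [pow_succ] at h7
  omega

/-- An injective numbering of the programs. -/
def Prog.number : Prog → ℕ
  | .skip => Nat.pair 0 0
  | .push r b => Nat.pair 1 (Nat.pair r b.toNat)
  | .pop r => Nat.pair 2 r
  | .query r s => Nat.pair 3 (Nat.pair r s)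
  | .seq p q => Nat.pair 4 (Nat.pair p.number q.number)
  | .branch r p p₀ p₁ =>
    Nat.pair 5 (Nat.pair r (Nat.pair p.number (Nat.pair p₀.number p₁.number)))
  | .loop r p => Nat.pair 6 (Nat.pair r p.number)

lemma Prog.number_injective : Function.Injective Prog.number := by
  intro p
  induction p with
  | skip => intro q h; cases q <;> simp [number] at h ⊢
  | push r b =>
    intro q h
    cases q <;> simp [number] at h ⊢
    exact ⟨h.1, Function.LeftInverse.injective Bool.ofNat_toNat h.2⟩
  | pop r | query r s => intro q h; cases q <;> simp [number] at h ⊢; tauto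
  | seq p q ih₁ ih₂ =>
    intro q h
    cases q <;> simp [number] at h ⊢
    exact ⟨ih₁ h.1, ih₂ h.2⟩
  | branch r p p₀ p₁ ih ih₀ ih₁ =>
    intro q h
    cases q <;> simp [number] at h ⊢
    exact ⟨h.1, ih h.2.1, ih₀ h.2.2.1, ih₁ h.2.2.2⟩
  | loop r p ih =>
    intro q h
    cases q <;> simp [number] at h ⊢
    exact ⟨h.1, ih h.2⟩

instance : Countable Prog := Prog.number_injective.countable

instance : Countable (Polynomial ℕ) :=
  (AddMonoidAlgebra.coeff_injective.comp Polynomial.toFinsupp_injective).countable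

lemma polynomial_eval_isLittleO (P : Polynomial ℕ) :
    (fun n : ℕ => ((P.eval n : ℕ) : ℝ)) =o[Filter.atTop] fun n => (2 : ℝ) ^ n := by
  induction P using Polynomial.induction_on' with
  | add P Q hP hQ => simpa using hP.add hQ
  | monomial k a =>
    simpa using (isLittleO_pow_const_const_pow_of_one_lt k one_lt_two).const_mul_left (a : ℝ)

/-- The functions on `n` bits admitted by Simon's promise, which is void for `n = 0`. -/
abbrev SimonFun (n : ℕ) : Type := {g : Bits n → Bits n // 0 < n → ∃ z, IsSimon g z}

instance (n : ℕ) : TopologicalSpace (SimonFun n) := ⊥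

instance (n : ℕ) : DiscreteTopology (SimonFun n) := ⟨rfl⟩

instance (n : ℕ) : Nonempty (SimonFun n) := by
  by_cases hn : 0 < n
  · have : Function.const (Fin n) (1 : ZMod 2) ≠ 0 := fun h =>
      one_ne_zero (congrFun h ⟨0, hn⟩)
    exact ⟨⟨_, fun _ => ⟨_, isSimon_perm_comp_cosetRep this 1⟩⟩⟩
  · exact ⟨⟨id, fun h => absurd h hn⟩⟩

/-- A condition that depends on finitely many coordinates only is closed. -/
lemma isClosed_of_congr {X : ℕ → Type*} [∀ n, TopologicalSpace (X n)]
    [∀ n, DiscreteTopology (X n)] (P : (∀ n, X n) → Prop) (m : ℕ)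
    (hP : ∀ f f', (∀ n ≤ m, f n = f' n) → P f' → P f) : IsClosed {f | P f} := by
  rw [← isOpen_compl_iff, isOpen_pi_iff]
  intro f hf
  refine ⟨Finset.range (m + 1), fun n => {f n}, fun n _ => ⟨isOpen_discrete _, rfl⟩, ?_⟩
  intro f' hf' hP'
  refine hf (hP f f' (fun n hn => ?_) hP')
  exact (hf' n (Finset.mem_coe.2 (Finset.mem_range.2 (by omega)))).symm

/-- By the Baire category theorem in the compact space of all oracles with Simon's promise, some
oracle defeats all of the countably many randomised polynomial-time programs: a program that decides
the first bit for an open set of oracles would do so for all solutions on all large numbers of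
bits. -/
lemma exists_firstBitLanguage_notMem_BPP :
    ∃ f : ∀ n, Bits n → Bits n, (∀ n, 0 < n → ∃ z, IsSimon (f n) z) ∧
      firstBitLanguage f ∉ BPP (oracleOf f) := by
  by_contra! hcon
  let B : Prog × Polynomial ℕ × Polynomial ℕ → Set (∀ n, SimonFun n) := fun a =>
    {f | ∀ x : List Bool, DecidesAt (oracleOf fun n => (f n).1) (firstBitLanguage fun n => (f n).1)
      a.1 (a.2.1.eval x.length) (a.2.2.eval x.length) x}
  have hclosed : ∀ a, IsClosed (B a) := by
    intro a
    simp only [B, Set.ofPred_forall]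
    refine isClosed_iInter fun x => isClosed_of_congr _ (max x.length (a.2.2.eval x.length)) ?_
    intro f f' hff h
    refine h.congr (mem_firstBitLanguage_congr ?_) fun s hs => oracleOf_congr ?_
    · rw [hff _ (le_max_left _ _)]
    · rw [hff _ (hs.trans (le_max_right _ _))]
  have hcover : ⋃ a, B a = Set.univ := by
    refine Set.eq_univ_of_forall fun f => Set.mem_iUnion.2 ?_
    obtain ⟨p, rand, time, h⟩ := hcon (fun n => (f n).1) fun n => (f n).2
    exact ⟨(p, rand, time), h⟩
  obtain ⟨⟨p, rand, time⟩, f, hf⟩ := nonempty_interior_of_iUnion_of_closed hclosed hcover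
  obtain ⟨I, u, hu, hsub⟩ := isOpen_pi_iff.1 isOpen_interior f hf
  have hlarge : ∀ᶠ n : ℕ in Filter.atTop, 6 * (1 + (time.eval n) ^ 2) < 2 ^ n := by
    have := (polynomial_eval_isLittleO (6 * (1 + time ^ 2))).bound (c := 1 / 2) (by norm_num)
    filter_upwards [this] with n hn
    have h2 : (0 : ℝ) < 2 ^ n := by positivity
    rw [Real.norm_of_nonneg (by positivity), Real.norm_of_nonneg h2.le] at hn
    have hn' : ((Polynomial.eval n (6 * (1 + time ^ 2)) : ℕ) : ℝ) < ((2 ^ n : ℕ) : ℝ) := by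
      push_cast
      linarith
    have := Nat.cast_lt.1 hn'
    simpa using this
  obtain ⟨n, hn, hnI⟩ := (hlarge.and (Filter.eventually_gt_atTop (I.sup id))).exists
  have hpos : 0 < n := by omega
  obtain ⟨n, rfl⟩ : ∃ k, n = k + 1 := ⟨n - 1, by omega⟩
  have hx : (List.replicate (n + 1) true).length = n + 1 := List.length_replicate
  have := two_pow_le_of_decidesAt (f := fun n => (f n).1) (p := p) (R := rand.eval (n + 1))
    (T := time.eval (n + 1)) hx fun g z hg => by
      have hmem : Function.update f (n + 1) ⟨g, fun _ => ⟨z, hg⟩⟩ ∈ B (p, rand, time) := by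
        refine interior_subset (hsub fun i hi => ?_)
        have hi' : i ≠ n + 1 := by
          have : i ≤ I.sup id := Finset.le_sup (f := id) hi
          omega
        rw [Function.update_of_ne hi']
        exact (hu i hi).2
      have := hmem (List.replicate (n + 1) true)
      rw [hx] at this
      have heq : (fun m => (Function.update f (n + 1) ⟨g, fun _ => ⟨z, hg⟩⟩ m).1) =
          Function.update (fun m => (f m).1) (n + 1) g := by
        funext m
        by_cases hm : m = n + 1
        · subst hm
          rw [Function.update_self, Function.update_self]
        · rw [Function.update_of_ne hm, Function.update_of_ne hm]
      rwa [heq] at this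
  rw [pow_succ 2 n] at hn
  omega

end Separation

end RealQT

theorem mainTheorem8 :
    -- Requirements (a), (b), (c) hold for all finite abelian groups and all hidden subgroups, and
    -- the coherent factorisation promise for all subgroup hiding functions; the measurements have
    -- orthogonal classical states, and (d) holds exactly for the groups of exponent at most two.
    (∀ (G : Type u) [AddCommGroup G] [Fintype G] (H : AddSubgroup G) [Fintype H]
        [Fintype (G ⧸ H)] (N : ℕ),
      RequirementA G H N ∧ RequirementB ∧ RequirementC G H ∧
      (grp G).HasOrthogonalClassicalStates ∧
      (point (Bits N)).HasEnoughClassicalStates ∧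
      (point (Bits N)).HasOrthogonalClassicalStates ∧
      (RequirementD G N ↔ ∀ g : G, g + g = 0) ∧
      ∀ f : G → Bits N, Hides f H → CoherentPromise H f) ∧
    -- The multiplicative characters that arise are the real-valued ones; the annihilators
    -- determine the hidden subgroup exactly when the group has exponent at most two.
    (∀ (G : Type u) [AddCommGroup G] [Fintype G],
      (∀ ψ : Sp G, (grp G).IsClassicalState ψ ↔ ∃ χ : AddChar G ℝ, ψ = charState χ) ∧
      ((∀ H H' : AddSubgroup G, (∀ χ : AddChar G ℝ, Annihilates χ H ↔ Annihilates χ H') → H = H') ↔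
        ∀ g : G, g + g = 0)) ∧
    -- The oracle is unitary and the subroutine samples annihilators uniformly.
    (∀ (G : Type u) [AddCommGroup G] [Fintype G] (N : ℕ) (f : G → Bits N),
      IsUnitary (oracle f) ∧
      (∀ (g : G) (t : Bits N), oracle f (ket g ⊗ₜ[ℝ] ket t) = ket g ⊗ₜ[ℝ] ket (f g + t)) ∧
      ∀ H : AddSubgroup G, Hides f H → ∀ (b : Bits N) (χ : AddChar G ℝ),
        (b ∈ Set.range f ∧ Annihilates χ H →
          subroutineProb f b (charState χ) = (Nat.card H : ℝ) ^ 2 / (Nat.card G : ℝ) ^ 2) ∧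
        (¬(b ∈ Set.range f ∧ Annihilates χ H) → subroutineProb f b (charState χ) = 0)) ∧
    -- For `ℤ₂^M`: the outcomes are indexed by bit strings and exhaust all the probability.
    (∀ M : ℕ,
      (∀ ψ : Sp (Bits M), (grp (Bits M)).IsClassicalState ψ ↔ ∃! p : Bits M, ψ = bitCharState p) ∧
      ∀ (N : ℕ) (f : Bits M → Bits N) (H : AddSubgroup (Bits M)), Hides f H →
        ∑ b : Bits N, ∑ p : Bits M, subroutineProb f b (bitCharState p) = 1) ∧
    -- For `ℤ₂^M`: polynomial-time classical post-processing of `M + k` runs of the subroutine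
    -- recovers the hidden subgroup, except with probability at most `2^(-k)`.
    (∃ (post : Prog) (time : Polynomial ℕ), ∀ M k : ℕ,
      (∀ p : Fin (M + k) → Bits M, ∃ out,
        Computes noOracle post (List.replicate M true) (samplesStr p) out (time.eval (M + k))) ∧
      ∀ (N : ℕ) (f : Bits M → Bits N) (H : AddSubgroup (Bits M)), Hides f H →
        1 - 1 / 2 ^ k ≤ recoveryProb f H post (M + k) (time.eval (M + k))) ∧
    -- Simon's problem is solved by a polynomial-time real quantum algorithm.
    (∃ A : RealQuantumAlgorithm, ∀ (f : ∀ n, Bits n → Bits n) (n : ℕ) (z : Bits n),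
      IsSimon (f n) z →
        2 / 3 ≤ A.outputProb (oracleOf f) (List.replicate n true) (toStr z)) ∧
    -- Some oracle with Simon's promise separates `BQP_ℝ` from `BPP`.
    (∃ f : ∀ n, Bits n → Bits n, (∀ n, 0 < n → ∃ z, IsSimon (f n) z) ∧
      ¬ BQPReal (oracleOf f) ⊆ BPP (oracleOf f)) := by
  refine ⟨?_, ?_, ?_, ?_, ?_, ?_, ?_⟩
  · intro G _ _ H _ _ N
    exact ⟨⟨hasEncoding G, hasEncoding H, hasEncoding (G ⧸ H), hasEncoding (Bits N)⟩,
      requirementB, ⟨point_hasEnoughClassicalStates H, point_hasEnoughClassicalStates (G ⧸ H)⟩,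
      grp_hasOrthogonalClassicalStates G, point_hasEnoughClassicalStates (Bits N),
      point_hasOrthogonalClassicalStates (Bits N), requirementD_iff N,
      fun f hf => coherentPromise H hf⟩
  · intro G _ _
    exact ⟨grp_isClassicalState_iff, annihilators_determine_iff⟩
  · intro G _ _ N f
    exact ⟨oracle_isUnitary f, oracle_ket f, fun H hf b χ =>
      ⟨fun h => subroutineProb_charState_of_annihilates hf h.1 h.2,
        subroutineProb_charState_eq_zero hf⟩⟩
  · intro M
    refine ⟨grp_bits_isClassicalState_iff, fun N f H hf => ?_⟩
    rw [← sum_subroutineProb hf, Fintype.sum_prod_type]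
  · exact ⟨recoverProg, recoverTime, fun M k => ⟨fun p => ⟨_, computes_recoverProg M k p⟩,
      fun N f H hf => one_sub_le_recoveryProb M k N f H hf⟩⟩
  · exact ⟨simonAlgorithm, simon_solved⟩
  · obtain ⟨f, hf, h⟩ := exists_firstBitLanguage_notMem_BPP
    exact ⟨f, hf, fun hsub => h (hsub (firstBitLanguage_mem_BQPReal f hf))⟩
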